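/- For every sample size $n\ge 1$ consider the linear model $y=X\beta+\epsilon$ with a fixed $n\times p$ design $X=(x_{ij})$ of rank $p\le n$, $\beta\in\mathbb R^p$, and a $p_1\times p$ matrix $M=(m_{ij})$; $X,\beta,M,p,p_1$ and the law of $\epsilon$ may depend on $n$. Let $X=P\Lambda Q^T$ be a thin singular value decomposition, $P^TP=Q^TQ=QQ^T=I_p$, $P=(p_{ij})$, $Q=(q_{ij})$, $\Lambda=\mathrm{diag}(\lambda_1,\dots,\lambda_p)$, $\lambda_1\ge\dots\ge\lambda_p\ge0$. Let $\rho_n\in\mathbb R$ be the ridge parameter, $b_n$ the threshold, and $$\mathcal N=\{i:|\beta_i|>b_n\},\quad d_j=\frac{\lambda_j}{\lambda_j^2+\rho_n}+\frac{\rho_n\lambda_j}{(\lambda_j^2+\rho_n)^2},\quad c_{ij}=\sum_{k\in\mathcal N}m_{ik}q_{kj},$$ $$\mathcal M=\Big\{i:\sum_{j}c_{ij}^2>0\Big\},\qquad \tau_i=\Big(\frac1n+\sum_{j}c_{ij}^2d_j^2\Big)^{1/2}.$$ (Under Assumptions 1 and 4 below, $\lambda_j^2+\rho_n>0$ for all $j$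 and all large $n$, so these expressions are well defined for large $n$.) Errors: $\epsilon_i=g_i(\dots,e_{i-1},e_i)$, $i=1,\dots,n$, where $(e_i)_{i\in\mathbb Z}$ are independent real random variables and the $g_i$ are measurable. Let $(e_i^\dagger)_{i\in\mathbb Z}$ be independent, independent of $(e_i)$, with $e_i^\dagger\sim e_i$; let $\epsilon_{i,j}$ be $\epsilon_i$ with $e_{i-j}$ replaced by $e^\dagger_{i-j}$, and $\delta_{i,j,m}=\|\epsilon_i-\epsilon_{i,j}\|_m$, where $\|Z\|_m=(\mathbf E|Z|^m)^{1/m}$. Put $\Sigma=(\mathbf E\epsilon_i\epsilon_j)_{i,j}$. Estimators: $\tilde\beta^\star=(X^TX+\rho_nI_p)^{-1}X^Ty$, $\tilde\beta=\tilde\beta^\star+\rho_nQ(\Lambda^2+\rho_nI_p)^{-1}Q^T\tilde\beta^\star$, $\widehat{\mathcal N}=\{i:|\tilde\beta_i|>b_n\}$, $\hat\beta_i=\tilde\beta_i\mathbf 1_{i\in\widehat{\mathcal N}}$, $\hat\gamma=M\hat\beta$, $\hat c_{ij}=\sum_{k\in\widehat{\mathcal N}}m_{ik}q_{kj}$, $\hat\tau_i=\big(\frac1n+\sum_j\hat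 c_{ij}^2d_j^2\big)^{1/2}$. Assume, with constants not depending on $n$, for all $n\ge1$, and with orders as $n\to\infty$: 1. $0<\eta\le\frac12$, and for some $c_\lambda,C_\lambda>0$: $C_\lambda n^{1/2}\ge\lambda_1\ge\dots\ge\lambda_p\ge c_\lambda n^{\eta}$; $\max_{i,j}|x_{ij}|=O(1)$; $p_1=O(1)$. 2. $\mathbf E\epsilon_i=0$; $m>3/\eta$, $\alpha_\epsilon>1$; $\sup_{k\ge0}(k+1)^{\alpha_\epsilon}\sum_{j\ge k}\max_{i\le n}\delta_{i,j,m}=O(1)$; $\max_{i\le n}\|\epsilon_i\|_m=O(1)$; the smallest eigenvalue of $\Sigma$ exceeds a constant $c_\Sigma>0$. 3. $0\le\alpha_\beta<3\eta$, $\|\beta\|_2=O(n^{\alpha_\beta})$, $|\mathcal N|=o(n^{\eta-1/m})$. 4. $\rho_n=O(n^{2\eta-\delta})$ for some $\delta$ with $\frac{\eta+\alpha_\beta}{2}<\delta<2\eta$; $b_n=C_bn^{-\nu_b}$ with $C_b>0$, $0<\nu_b<\eta-\frac3m$; for some $0<c_b<1$: $|\beta_i|\le c_bb_n$ for $i\notin\mathcal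 N$ and $|\beta_i|\ge b_n/c_b$ for $i\in\mathcal N$. 5. $\mathcal M\ne\emptyset$; for some $0<c_{\mathcal M}\le C_{\mathcal M}<\infty$: $c_{\mathcal M}\le\sum_{k\in\mathcal N}m_{ik}^2\le C_{\mathcal M}$ for $i\in\mathcal M$; $\max_{i\le p_1}|\sum_{j\notin\mathcal N}m_{ij}\beta_j|=o(n^{-1/2})$; $\max_{i\le n}|\sum_{j\notin\mathcal N}x_{ij}\beta_j|=o(n^{(1/m-\eta)/2})$. 6. $(c_{ij})_{i\in\mathcal M,\,j\le p}$ has rank $|\mathcal M|$, and $\max_{i\in\mathcal M,\,l\le n}\frac1{\tau_i}\big|\sum_jc_{ij}d_jp_{lj}\big|=o(n^{-1/4}\log^{-z}n)$ with $z=\max\big(\frac92,\frac{3\alpha_\epsilon}{2\alpha_\epsilon-2}\big)$. Let $\xi=(\xi_1,\dots,\xi_n)^T$ be Gaussian with mean $0$ and covariance matrix $\Sigma$, and $H(x)=\mathrm{Prob}\Big(\max_{i\in\mathcal M}\frac1{\tau_i}\Big|\sum_{j=1}^p\sum_{l=1}^nc_{ij}d_jp_{lj}\xi_l\Big|\le x\Big)$.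 Then $$\sup_{x\in\mathbb R}\Big|\mathrm{Prob}\Big(\max_{i=1,\dots,p_1}\frac{|\hat\gamma_i-\sum_{j=1}^pm_{ij}\beta_j|}{\hat\tau_i}\le x\Big)-H(x)\Big|\to0\qquad(n\to\infty).$$ -/

import Mathlib

open Matrix MeasureTheory ProbabilityTheory Filter Topology Asymptotics
open scoped ENNReal NNReal

noncomputable section

namespace ThresholdRidge

/-- The nonrandom part of the linear model `y = X β + ε` at sample size `n`: the fixed `n × p`
design `X` of full column rank `p` (so `p ≤ n`), a thin singular value decomposition
`X = P Λ Qᵀ` with decreasingly ordered singular values, the parameter `β`, the `p₁ × p` matrix `M`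
of linear combinations, the ridge parameter `ρ` and the threshold `b`. -/
structure LinearModel (n : ℕ) where
  p : ℕ
  p₁ : ℕ
  X : Matrix (Fin n) (Fin p) ℝ
  β : Fin p → ℝ
  M : Matrix (Fin p₁) (Fin p) ℝ
  ρ : ℝ
  b : ℝ
  P : Matrix (Fin n) (Fin p) ℝ
  lam : Fin p → ℝ
  Q : Matrix (Fin p) (Fin p) ℝ
  rank_X : X.rank = p
  P_orth : Pᵀ * P = 1
  Q_orth : Qᵀ * Q = 1
  Q_orth' : Q * Qᵀ = 1
  lam_nonneg : ∀ j, 0 ≤ lam j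
  lam_antitone : Antitone lam
  svd : X = P * Matrix.diagonal lam * Qᵀ

namespace LinearModel

variable {n : ℕ} (S : LinearModel n)

/-- The set `N_b` of the coordinates with `|β i| > b`. -/
def support : Finset (Fin S.p) := Finset.univ.filter fun i => S.b < |S.β i|

/-- `c i j = ∑ k ∈ N, m i k * q k j` for a set `N` of coordinates. -/
def coef (N : Finset (Fin S.p)) : Matrix (Fin S.p₁) (Fin S.p) ℝ :=
  Matrix.of fun i j => ∑ k ∈ N, S.M i k * S.Q k j

/-- `λ j / (λ j ^ 2 + ρ) + ρ * λ j / (λ j ^ 2 + ρ) ^ 2`. -/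
def weight (j : Fin S.p) : ℝ :=
  S.lam j / (S.lam j ^ 2 + S.ρ) + S.ρ * S.lam j / (S.lam j ^ 2 + S.ρ) ^ 2

/-- The normalizing constants for a set `N` of coordinates: `τ i` for `N = N_b`, and the estimated
version when `N` is the estimated set. -/
def tau (N : Finset (Fin S.p)) (i : Fin S.p₁) : ℝ :=
  Real.sqrt (1 / (n : ℝ) + ∑ j, S.coef N i j ^ 2 * S.weight j ^ 2)

/-- The set `𝓜` of the rows `i` with `∑ j, c i j ^ 2 > 0`. -/
def activeRows : Finset (Fin S.p₁) :=
  Finset.univ.filter fun i => 0 < ∑ j, S.coef S.support i j ^ 2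

/-- `(1 / τ i) * ∑ j, c i j * weight j * p l j`, the normalized coefficient of the `l`-th error in
the `i`-th linear combination. -/
def normCoef (i : Fin S.p₁) (l : Fin n) : ℝ :=
  1 / S.tau S.support i * ∑ j, S.coef S.support i j * S.weight j * S.P l j

/-- The response `y = X β + ε`. -/
def response (ε : Fin n → ℝ) : Fin n → ℝ := S.X *ᵥ S.β + ε

/-- The ridge estimator `(Xᵀ X + ρ I)⁻¹ Xᵀ y`. -/
def ridge (y : Fin n → ℝ) : Fin S.p → ℝ :=
  (S.Xᵀ * S.X + S.ρ • (1 : Matrix (Fin S.p) (Fin S.p) ℝ))⁻¹ *ᵥ (S.Xᵀ *ᵥ y)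

/-- The de-biased ridge estimator `ridge + ρ Q (Λ² + ρ I)⁻¹ Qᵀ ridge`. -/
def debiased (y : Fin n → ℝ) : Fin S.p → ℝ :=
  S.ridge y + S.ρ •
    ((S.Q * (Matrix.diagonal S.lam ^ 2 + S.ρ • (1 : Matrix (Fin S.p) (Fin S.p) ℝ))⁻¹ * S.Qᵀ) *ᵥ
      S.ridge y)

/-- The estimated set of coordinates: those `i` with `|debiased i| > b`. -/
def supportHat (y : Fin n → ℝ) : Finset (Fin S.p) :=
  Finset.univ.filter fun i => S.b < |S.debiased y i|

/-- The thresholded estimator of `β`. -/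
def betaHat (y : Fin n → ℝ) (i : Fin S.p) : ℝ :=
  if i ∈ S.supportHat y then S.debiased y i else 0

/-- The estimator of `γ = M β`. -/
def gammaHat (y : Fin n → ℝ) : Fin S.p₁ → ℝ := S.M *ᵥ S.betaHat y

/-- The estimated normalizing constants. -/
def tauHat (y : Fin n → ℝ) (i : Fin S.p₁) : ℝ := S.tau (S.supportHat y) i

/-- The studentized maximum, as a function of the response. -/
def studentizedMax (y : Fin n → ℝ) : ℝ :=
  ⨆ i : Fin S.p₁, |S.gammaHat y i - (S.M *ᵥ S.β) i| / S.tauHat y i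

/-- The distribution function `H` of the maximum over `𝓜` of the absolute values of the normalized
linear combinations of a centred Gaussian vector with covariance matrix `V`. -/
def H (V : Matrix (Fin n) (Fin n) ℝ) (x : ℝ) : ℝ :=
  (multivariateGaussian 0 V).real
    {ξ | ⨆ i : {i // i ∈ S.activeRows}, |∑ l, S.normCoef i l * ξ l| ≤ x}

end LinearModel

/-- The errors at sample size `n`: independent innovations `e i` (`i ∈ ℤ`), independent copies
`e' i` of them, independent of all the `e j`, and measurable functions `g i` of the whole past. The
argument `k ↦ x k` of `g i` stands for the innovation `k` steps back in time. -/
structure ErrorProcess (n : ℕ) {Ω : Type*} [MeasurableSpace Ω] (μ : Measure Ω) where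
  e : ℤ → Ω → ℝ
  e' : ℤ → Ω → ℝ
  g : Fin n → (ℕ → ℝ) → ℝ
  measurable_e : ∀ t, Measurable (e t)
  measurable_e' : ∀ t, Measurable (e' t)
  measurable_g : ∀ i, Measurable (g i)
  indep : iIndepFun (fun s : ℤ ⊕ ℤ => Sum.elim e e' s) μ
  identDistrib : ∀ t, IdentDistrib (e' t) (e t) μ μ

namespace ErrorProcess

variable {n : ℕ} {Ω : Type*} [MeasurableSpace Ω] {μ : Measure Ω} (E : ErrorProcess n μ)

/-- The time of the error with index `i : Fin n`; times run from `1` to `n`. -/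
def time (i : Fin n) : ℤ := (i : ℤ) + 1

/-- The error `ε i = g i (…, e (i - 1), e i)`. -/
def err (ω : Ω) (i : Fin n) : ℝ := E.g i fun k => E.e (time i - k) ω

/-- The error with the innovation `j` steps back replaced by its independent copy. -/
def errCoupled (j : ℕ) (ω : Ω) (i : Fin n) : ℝ :=
  E.g i fun k => if k = j then E.e' (time i - k) ω else E.e (time i - k) ω

/-- The physical dependence measure `δ i j m`, the `L^m` norm of `ε i - ε i j`. -/
def delta (m : ℝ) (i : Fin n) (j : ℕ) : ℝ≥0∞ :=
  eLpNorm (fun ω => E.err ω i - E.errCoupled j ω i) (ENNReal.ofReal m) μ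

/-- The matrix `Σ` of the numbers `𝔼 (ε i * ε j)`. -/
def cov : Matrix (Fin n) (Fin n) ℝ := Matrix.of fun i j => ∫ ω, E.err ω i * E.err ω j ∂μ

end ErrorProcess

/-- Assumption on the singular values, entries of the design, number of combinations. -/
def DesignAssumption (S : ∀ n, LinearModel n) (η : ℝ) : Prop :=
  0 < η ∧ η ≤ 1 / 2 ∧
  (∃ c C : ℝ, 0 < c ∧ 0 < C ∧ ∀ n : ℕ, 1 ≤ n → ∀ j,
    c * (n : ℝ) ^ η ≤ (S n).lam j ∧ (S n).lam j ≤ C * (n : ℝ) ^ (1 / 2 : ℝ)) ∧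
  (∃ C : ℝ, ∀ n, 1 ≤ n → ∀ i j, |(S n).X i j| ≤ C) ∧
  ∃ C : ℕ, ∀ n, 1 ≤ n → (S n).p₁ ≤ C

/-- Assumption on the errors: centred, moments, weak dependence, non-degenerate covariance. -/
def ErrorAssumption {Ω : ℕ → Type*} [∀ n, MeasurableSpace (Ω n)] {μ : ∀ n, Measure (Ω n)}
    (E : ∀ n, ErrorProcess n (μ n)) (η m αε : ℝ) : Prop :=
  3 / η < m ∧ 1 < αε ∧
  (∀ n, 1 ≤ n → ∀ i, ∫ ω, (E n).err ω i ∂(μ n) = 0) ∧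
  (∃ C : ℝ≥0, ∀ n, 1 ≤ n →
    ⨆ k : ℕ, ((k : ℝ≥0∞) + 1) ^ αε * ∑' j : ℕ, ⨆ i : Fin n, (E n).delta m i (k + j) ≤ C) ∧
  (∃ C : ℝ≥0, ∀ n, 1 ≤ n → ∀ i,
    eLpNorm (fun ω => (E n).err ω i) (ENNReal.ofReal m) (μ n) ≤ C) ∧
  ∃ c : ℝ, 0 < c ∧ ∀ n, 1 ≤ n → ∀ a : ℝ,
    Module.End.HasEigenvalue (Matrix.toLin' (E n).cov) a → c < a

/-- Assumption on the size and sparsity of `β`. -/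
def SparsityAssumption (S : ∀ n, LinearModel n) (η m αβ : ℝ) : Prop :=
  0 ≤ αβ ∧ αβ < 3 * η ∧
  (fun n => ‖WithLp.toLp 2 (S n).β‖) =O[atTop] (fun n : ℕ => (n : ℝ) ^ αβ) ∧
  (fun n => ((S n).support.card : ℝ)) =o[atTop] (fun n : ℕ => (n : ℝ) ^ (η - 1 / m))

/-- Assumption on the ridge parameter, threshold, separation of large and small `β i`. -/
def TuningAssumption (S : ∀ n, LinearModel n) (η m αβ : ℝ) : Prop :=
  (∃ δ : ℝ, (η + αβ) / 2 < δ ∧ δ < 2 * η ∧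
    (fun n => (S n).ρ) =O[atTop] (fun n : ℕ => (n : ℝ) ^ (2 * η - δ))) ∧
  (∃ C ν : ℝ, 0 < C ∧ 0 < ν ∧ ν < η - 3 / m ∧
    ∀ n : ℕ, 1 ≤ n → (S n).b = C * (n : ℝ) ^ (-ν)) ∧
  ∃ c : ℝ, 0 < c ∧ c < 1 ∧ ∀ n, 1 ≤ n →
    (∀ i, i ∉ (S n).support → |(S n).β i| ≤ c * (S n).b) ∧
    ∀ i, i ∈ (S n).support → (S n).b / c ≤ |(S n).β i|

/-- Assumption on the rows of `M` on the large coordinates, and negligibility of the small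
coordinates. -/
def CombinationAssumption (S : ∀ n, LinearModel n) (η m : ℝ) : Prop :=
  (∀ n, 1 ≤ n → (S n).activeRows.Nonempty) ∧
  (∃ c C : ℝ, 0 < c ∧ c ≤ C ∧ ∀ n, 1 ≤ n → ∀ i ∈ (S n).activeRows,
    c ≤ ∑ k ∈ (S n).support, (S n).M i k ^ 2 ∧ ∑ k ∈ (S n).support, (S n).M i k ^ 2 ≤ C) ∧
  (fun n => ⨆ i : Fin (S n).p₁, |∑ j ∈ (S n).supportᶜ, (S n).M i j * (S n).β j|)
    =o[atTop] (fun n : ℕ => 1 / Real.sqrt n) ∧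
  (fun n => ⨆ i : Fin n, |∑ j ∈ (S n).supportᶜ, (S n).X i j * (S n).β j|)
    =o[atTop] (fun n : ℕ => (n : ℝ) ^ ((1 / m - η) / 2))

/-- Assumption on the coefficients: full rank of the active rows, and no dominating coefficient. -/
def NonDominanceAssumption (S : ∀ n, LinearModel n) (αε : ℝ) : Prop :=
  (∀ n, 1 ≤ n →
    (((S n).coef (S n).support).submatrix
      (fun i : {i // i ∈ (S n).activeRows} => (i : Fin (S n).p₁)) id).rank =
        (S n).activeRows.card) ∧
  (fun n => ⨆ i : {i // i ∈ (S n).activeRows}, ⨆ l : Fin n, |(S n).normCoef i l|)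
    =o[atTop] (fun n : ℕ => (n : ℝ) ^ (-(1 / 4) : ℝ) *
      Real.log n ^ (-(max (9 / 2) (3 * αε / (2 * αε - 2)))))

end ThresholdRidge

end

namespace ThresholdRidge

/-! By the singular value decomposition the de-biased ridge estimator is `Q D Pᵀ y`, with `D` the
diagonal matrix of the weights `d_j`, and `d_j λ_j = 1 - ρ² / (λ_j² + ρ)²`. Its error is thus a
linear form in the noise minus a bias of second order in `ρ`. Three facts give the theorem.

Support recovery (`tendsto_measureReal_supportHat_ne`). The noise in each coordinate is a weighted
sum of errors whose weights have `ℓ²` norm `O(n^(-η))`. A moment bound of even order `q ≤ m` and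
Markov's inequality make a deviation of order `b_n` have probability `O(n^(-(η - ν) q))`; since `ν <
η - 3/m`, this survives the union bound over `p ≤ n` coordinates. The bias is `o(b_n)`.

Linearization (`abs_studentizedMax_sub_le`). On the recovery event the studentized maximum differs
from the sup norm of `A ε` by a deterministic `o(1)`, where `A` holds the normalized coefficients,
padded by zero rows to a fixed number `d` of rows. The bias is compared with `τ` by Cauchy–Schwarz,
and the small coordinates of `β` by `τ ≥ n^(-1/2)`.

Gaussian approximation (`tendsto_integral_cis_sub`, `tendsto_iSup_abs_measureReal_sub`). As `d` is
fixed, a central limit theorem for scalar combinations of the rows suffices. The errors are replaced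
by `L`-dependent ones, for which the Stein–Tikhomirov method gives an error of order `L³` times the
largest coefficient; `L` is chosen before `n`. The covariances of `A ε` are bounded but need not
converge, so one passes to subsequences. Every limit has a coordinate of positive variance, because
the eigenvalues of `Σ` and the norm of an active row are bounded below. Hence the limiting maximum
has a continuous distribution function, and Pólya's theorem makes the convergence uniform.

The dependence is handled on a product space on which each error has its own independent copy of all
innovations. Exchanging one innovation with its copy changes the sign of one `increment` and leaves
those of later errors alone (`integral_sum_increment_pow_mul_increment`). So, at a fixed lag,
weighted increments behave like reversed martingale differences, and their moments are controlled by
the `ℓ²` norm of the weights. Summation over the lags yields both the moment bound and the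
`L`-dependent approximation. -/

lemma abs_pow_mul_abs_pow_le (x y : ℝ) (a b : ℕ) :
    |x| ^ a * |y| ^ b ≤ |x| ^ (a + b) + |y| ^ (a + b) := by
  rcases le_total |x| |y| with h | h
  · calc |x| ^ a * |y| ^ b ≤ |y| ^ a * |y| ^ b := by gcongr
      _ = |y| ^ (a + b) := by ring
      _ ≤ _ := le_add_of_nonneg_left (by positivity)
  · calc |x| ^ a * |y| ^ b ≤ |x| ^ a * |x| ^ b := by gcongr
      _ = |x| ^ (a + b) := by ring
      _ ≤ _ := le_add_of_nonneg_right (by positivity)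

/-- Only the terms of degree at least two in `y` are estimated: each such monomial is at most `(x ^
(2k) + y ^ (2k)) y²`, and their binomial coefficients add up to at most `2 ^ (2k + 2) = 4 ^ (k +
1)`. The linear term is kept exactly, because its expectation will vanish by orthogonality. -/
lemma add_pow_even_le (k : ℕ) (x y : ℝ) :
    (x + y) ^ (2 * k + 2) ≤ x ^ (2 * k + 2) + (2 * k + 2) * (x ^ (2 * k + 1) * y)
      + 4 ^ (k + 1) * (x ^ (2 * k) * y ^ 2 + y ^ (2 * k + 2)) := by
  have hterm : ∀ j ∈ Finset.range (2 * k + 1), y ^ (j + 2) * x ^ (2 * k + 2 - (j + 2)) *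
      ((2 * k + 2).choose (j + 2) : ℝ) ≤
      (x ^ (2 * k) * y ^ 2 + y ^ (2 * k + 2)) * ((2 * k + 2).choose (j + 2) : ℝ) := by
    intro j hj
    rw [Finset.mem_range] at hj
    obtain ⟨i, hi⟩ := Nat.exists_eq_add_of_le (Nat.lt_succ_iff.1 hj)
    have e : 2 * k + 2 - (j + 2) = i := by omega
    refine mul_le_mul_of_nonneg_right ?_ (by positivity)
    rw [e]
    calc y ^ (j + 2) * x ^ i ≤ |y ^ (j + 2) * x ^ i| := le_abs_self _
      _ = |x| ^ i * |y| ^ j * |y| ^ 2 := by rw [abs_mul, abs_pow, abs_pow]; ring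
      _ ≤ (|x| ^ (i + j) + |y| ^ (i + j)) * |y| ^ 2 := by
          gcongr; exact abs_pow_mul_abs_pow_le _ _ _ _
      _ = _ := by
        have e2 : i + j = 2 * k := by omega
        have hx : |x| ^ (2 * k) = x ^ (2 * k) := by rw [pow_mul, pow_mul, sq_abs]
        have hy : |y| ^ (2 * k) = y ^ (2 * k) := by rw [pow_mul, pow_mul, sq_abs]
        rw [e2, hx, hy, sq_abs]; ring
  have hsum : ∑ j ∈ Finset.range (2 * k + 1), ((2 * k + 2).choose (j + 2) : ℝ) ≤ 4 ^ (k + 1) := by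
    have := Nat.sum_range_choose (2 * k + 2)
    rw [Finset.sum_range_succ', Finset.sum_range_succ'] at this
    have h2 : ∑ j ∈ Finset.range (2 * k + 1), (2 * k + 2).choose (j + 2) ≤ 4 ^ (k + 1) := by
      have h4 : (2 : ℕ) ^ (2 * k + 2) = 4 ^ (k + 1) := by
        rw [show 2 * k + 2 = 2 * (k + 1) by ring, pow_mul]; norm_num
      rw [h4] at this
      exact (Nat.le_add_right _ _).trans ((Nat.le_add_right _ _).trans_eq this)
    exact_mod_cast h2
  rw [add_comm x y, add_pow, Finset.sum_range_succ', Finset.sum_range_succ']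
  have h := Finset.sum_le_sum hterm
  rw [← Finset.mul_sum] at h
  have h3 : (x ^ (2 * k) * y ^ 2 + y ^ (2 * k + 2)) *
      ∑ j ∈ Finset.range (2 * k + 1), ((2 * k + 2).choose (j + 2) : ℝ) ≤
      4 ^ (k + 1) * (x ^ (2 * k) * y ^ 2 + y ^ (2 * k + 2)) := by
    rw [mul_comm]
    refine mul_le_mul_of_nonneg_right hsum ?_
    rw [pow_mul, show 2 * k + 2 = 2 * (k + 1) by ring, pow_mul y]
    positivity
  have e0 : 2 * k + 2 - (0 + 1) = 2 * k + 1 := by omega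
  have h4 : ∑ j ∈ Finset.range (2 * k + 1), y ^ (j + 1 + 1) * x ^ (2 * k + 2 - (j + 1 + 1)) *
      ((2 * k + 2).choose (j + 1 + 1) : ℝ) ≤ _ := h.trans h3
  have h5 : y ^ (0 + 1) * x ^ (2 * k + 2 - (0 + 1)) * ((2 * k + 2).choose (0 + 1) : ℝ) =
      (2 * k + 2) * (x ^ (2 * k + 1) * y) := by
    rw [e0, zero_add, Nat.choose_one_right]; push_cast; ring
  have h6 : y ^ 0 * x ^ (2 * k + 2 - 0) * ((2 * k + 2).choose 0 : ℝ) = x ^ (2 * k + 2) := by simp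
  rw [h5, h6]
  linarith

/-! ### Even moments of sums of orthogonal terms -/

section Moments

variable {Ω : Type*} [MeasurableSpace Ω] {μ : Measure Ω}

lemma memLp_even_integrable {k : ℕ} {f : Ω → ℝ} (hf : MemLp f ((2 * k + 2 : ℕ) : ℝ≥0∞) μ) :
    Integrable (fun ω => |f ω| ^ (2 * k + 2)) μ := by
  simpa using hf.integrable_norm_pow (p := 2 * k + 2) (by omega)

lemma integrable_pow_mul_pow {k a b : ℕ} (hab : a + b = 2 * k + 2) {f g : Ω → ℝ}
    (hf : MemLp f ((2 * k + 2 : ℕ) : ℝ≥0∞) μ) (hg : MemLp g ((2 * k + 2 : ℕ) : ℝ≥0∞) μ) :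
    Integrable (fun ω => f ω ^ a * g ω ^ b) μ := by
  refine Integrable.mono' ((memLp_even_integrable hf).add (memLp_even_integrable hg))
    ((hf.1.pow a).mul (hg.1.pow b)) (ae_of_all _ fun ω => ?_)
  simp only [Real.norm_eq_abs, abs_mul, abs_pow, Pi.add_apply]
  rw [← hab]
  exact abs_pow_mul_abs_pow_le _ _ _ _

/-- Hölder's inequality up to a factor 2: after scaling `f²` by `W` and `g²` by `d` it is the
pointwise bound `u^k v ≤ u^(k+1) + v^(k+1)`. The positive bound `W` stands in for `V`, which may be
zero, since it occurs in a denominator. -/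
lemma integral_pow_mul_sq_le {k : ℕ} {f g : Ω → ℝ} {V d W : ℝ} (hV : 0 ≤ V) (hd : 0 < d)
    (hVW : V ≤ W) (hdW : 0 < W)
    (hf : MemLp f ((2 * k + 2 : ℕ) : ℝ≥0∞) μ) (hg : MemLp g ((2 * k + 2 : ℕ) : ℝ≥0∞) μ)
    (hfV : ∫ ω, f ω ^ (2 * k + 2) ∂μ ≤ V ^ (k + 1)) (hgd : ∫ ω, g ω ^ (2 * k + 2) ∂μ ≤ d ^ (k + 1)) :
    ∫ ω, f ω ^ (2 * k) * g ω ^ 2 ∂μ ≤ 2 * W ^ k * d := by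
  have hpt : ∀ ω, f ω ^ (2 * k) * g ω ^ 2 ≤ (d / W) * f ω ^ (2 * k + 2) +
      (W ^ k / d ^ k) * g ω ^ (2 * k + 2) := by
    intro ω
    have h := abs_pow_mul_abs_pow_le (f ω ^ 2 / W) (g ω ^ 2 / d) k 1
    have e1 : |f ω ^ 2 / W| = f ω ^ 2 / W := abs_of_nonneg (by positivity)
    have e2 : |g ω ^ 2 / d| = g ω ^ 2 / d := abs_of_nonneg (by positivity)
    rw [e1, e2] at h
    have h' := mul_le_mul_of_nonneg_left h (show 0 ≤ W ^ k * d by positivity)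
    have l : W ^ k * d * ((f ω ^ 2 / W) ^ k * (g ω ^ 2 / d) ^ 1) = f ω ^ (2 * k) * g ω ^ 2 := by
      rw [div_pow, pow_mul]; field_simp
    have r : W ^ k * d * ((f ω ^ 2 / W) ^ (k + 1) + (g ω ^ 2 / d) ^ (k + 1)) =
        (d / W) * f ω ^ (2 * k + 2) + (W ^ k / d ^ k) * g ω ^ (2 * k + 2) := by
      rw [show 2 * k + 2 = 2 * (k + 1) by ring, pow_mul, pow_mul, div_pow, div_pow, pow_succ W,
        pow_succ d]
      field_simp
    rw [l, r] at h'
    exact h'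
  have i1 : Integrable (fun ω => f ω ^ (2 * k + 2)) μ := by
    simpa using integrable_pow_mul_pow (b := 0) (by omega) hf hf
  have i2 : Integrable (fun ω => g ω ^ (2 * k + 2)) μ := by
    simpa using integrable_pow_mul_pow (b := 0) (by omega) hg hg
  calc ∫ ω, f ω ^ (2 * k) * g ω ^ 2 ∂μ
      ≤ ∫ ω, ((d / W) * f ω ^ (2 * k + 2) + (W ^ k / d ^ k) * g ω ^ (2 * k + 2)) ∂μ :=
        integral_mono (integrable_pow_mul_pow (by omega) hf hg)
          ((i1.const_mul _).add (i2.const_mul _)) hpt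
    _ = (d / W) * ∫ ω, f ω ^ (2 * k + 2) ∂μ + (W ^ k / d ^ k) * ∫ ω, g ω ^ (2 * k + 2) ∂μ := by
        rw [integral_add (i1.const_mul _) (i2.const_mul _), integral_const_mul, integral_const_mul]
    _ ≤ (d / W) * W ^ (k + 1) + (W ^ k / d ^ k) * d ^ (k + 1) := by
        gcongr
        exact hfV.trans (by gcongr)
    _ = 2 * W ^ k * d := by
        rw [pow_succ, pow_succ]; field_simp; ring

/-- A reversed Burkholder-type inequality for even moments: every `Z a` is orthogonal to the odd
power of each sum of the terms of larger index. -/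
lemma integral_sum_pow_even_le {ι : Type*} [LinearOrder ι] {k : ℕ} {Z : ι → Ω → ℝ}
    (hZ : ∀ i, MemLp (Z i) ((2 * k + 2 : ℕ) : ℝ≥0∞) μ) {c : ι → ℝ} (hc : ∀ i, 0 ≤ c i)
    (hZc : ∀ i, ∫ ω, Z i ω ^ (2 * k + 2) ∂μ ≤ c i ^ (k + 1))
    (horth : ∀ (a : ι) (s : Finset ι), (∀ x ∈ s, a < x) →
      ∫ ω, (∑ i ∈ s, Z i ω) ^ (2 * k + 1) * Z a ω ∂μ = 0) (s : Finset ι) :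
    ∫ ω, (∑ i ∈ s, Z i ω) ^ (2 * k + 2) ∂μ ≤ ((1 + 3 * 4 ^ (k + 1)) * ∑ i ∈ s, c i) ^ (k + 1) := by
  induction s using Finset.induction_on_min with
  | empty => simp
  | insert a s ha ih =>
    have has : a ∉ s := fun h => lt_irrefl _ (ha a h)
    set T : Ω → ℝ := fun ω => ∑ i ∈ s, Z i ω with hT
    have hTm : MemLp T ((2 * k + 2 : ℕ) : ℝ≥0∞) μ := memLp_finsetSum s fun i _ => hZ i
    set K : ℝ := 1 + 3 * 4 ^ (k + 1) with hK
    have hKpos : 0 < K := by positivity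
    set V : ℝ := K * ∑ i ∈ s, c i with hVdef
    have hV : 0 ≤ V := mul_nonneg hKpos.le (Finset.sum_nonneg fun i _ => hc i)
    have e : ∀ ω, ∑ i ∈ insert a s, Z i ω = T ω + Z a ω := fun ω => by
      rw [Finset.sum_insert has, add_comm]
    simp only [e]
    rw [Finset.sum_insert has]
    -- The scaling in `integral_pow_mul_sq_le` needs `0 < c a`; if `c a = 0`, the term `Z a`
    -- vanishes almost everywhere.
    rcases (hc a).eq_or_lt with h0 | hpos
    · have hz : ∫ ω, |Z a ω| ^ (2 * k + 2) ∂μ ≤ 0 := by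
        have := hZc a
        rw [← h0, zero_pow (by omega)] at this
        convert this using 3 with ω
        rw [show 2 * k + 2 = 2 * (k + 1) by ring, pow_mul, pow_mul, sq_abs]
      have hz0 : ∫ ω, |Z a ω| ^ (2 * k + 2) ∂μ = 0 :=
        le_antisymm hz (integral_nonneg fun ω => by positivity)
      rw [integral_eq_zero_iff_of_nonneg (fun ω => by positivity)
        (memLp_even_integrable (hZ a))] at hz0
      have hcong : (fun ω => (T ω + Z a ω) ^ (2 * k + 2)) =ᵐ[μ] fun ω => T ω ^ (2 * k + 2) := by
        filter_upwards [hz0] with ω hω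
        have : Z a ω = 0 := by simpa using hω
        simp [this]
      rw [integral_congr_ae hcong, ← h0, zero_add]
      exact ih
    · have i1 : Integrable (fun ω => T ω ^ (2 * k + 2)) μ := by
        simpa using integrable_pow_mul_pow (b := 0) (by omega) hTm hTm
      have i2 : Integrable (fun ω => Z a ω ^ (2 * k + 2)) μ := by
        simpa using integrable_pow_mul_pow (b := 0) (by omega) (hZ a) (hZ a)
      have i3 : Integrable (fun ω => T ω ^ (2 * k + 1) * Z a ω) μ := by
        simpa using integrable_pow_mul_pow (a := 2 * k + 1) (b := 1) (by omega) hTm (hZ a)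
      have i4 : Integrable (fun ω => T ω ^ (2 * k) * Z a ω ^ 2) μ :=
        integrable_pow_mul_pow (by omega) hTm (hZ a)
      have i5 : Integrable (fun ω => (T ω + Z a ω) ^ (2 * k + 2)) μ := by
        have := hTm.add (hZ a)
        simpa using integrable_pow_mul_pow (b := 0) (by omega) this this
      have hW : 0 < V + c a := by positivity
      calc ∫ ω, (T ω + Z a ω) ^ (2 * k + 2) ∂μ
          ≤ ∫ ω, (T ω ^ (2 * k + 2) + (2 * k + 2) * (T ω ^ (2 * k + 1) * Z a ω)
            + 4 ^ (k + 1) * (T ω ^ (2 * k) * Z a ω ^ 2 + Z a ω ^ (2 * k + 2))) ∂μ :=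
            integral_mono i5 ((i1.add (i3.const_mul _)).add ((i4.add i2).const_mul _))
              fun ω => add_pow_even_le k _ _
        _ = ∫ ω, T ω ^ (2 * k + 2) ∂μ
            + 4 ^ (k + 1) * (∫ ω, T ω ^ (2 * k) * Z a ω ^ 2 ∂μ + ∫ ω, Z a ω ^ (2 * k + 2) ∂μ) := by
            have j1 : Integrable (fun ω => (2 * k + 2) * (T ω ^ (2 * k + 1) * Z a ω)) μ :=
              i3.const_mul _
            have j2 : Integrable (fun ω => T ω ^ (2 * k + 2)
                + (2 * k + 2) * (T ω ^ (2 * k + 1) * Z a ω)) μ := i1.add j1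
            have j3 : Integrable (fun ω => (4 : ℝ) ^ (k + 1) *
                (T ω ^ (2 * k) * Z a ω ^ 2 + Z a ω ^ (2 * k + 2))) μ := (i4.add i2).const_mul _
            rw [integral_add j2 j3, integral_add i1 j1, integral_const_mul, horth a s ha, mul_zero,
              add_zero, integral_const_mul, integral_add i4 i2]
        _ ≤ V ^ (k + 1) + 4 ^ (k + 1) * (2 * (V + c a) ^ k * c a + c a ^ (k + 1)) := by
            gcongr
            · exact integral_pow_mul_sq_le hV hpos (by linarith) hW hTm (hZ a) ih (hZc a)
            · exact hZc a
        -- Both remainder terms are bounded by multiples of `(V + c a) ^ k * c a`, with factors 2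
        -- and 1; this is the 3 in `K`. The summand 1 in `K` provides `c a ≤ K * c a` further down.
        _ ≤ (V + c a) ^ k * V + 3 * 4 ^ (k + 1) * ((V + c a) ^ k * c a) := by
            have h1 : V ^ (k + 1) ≤ (V + c a) ^ k * V := by
              rw [pow_succ]; gcongr; linarith
            have h2 : c a ^ (k + 1) ≤ (V + c a) ^ k * c a := by
              rw [pow_succ]; gcongr; linarith
            have h3 : (0 : ℝ) ≤ 4 ^ (k + 1) := by positivity
            nlinarith [mul_le_mul_of_nonneg_left h2 h3]
        _ ≤ (V + c a) ^ k * (V + K * c a) := by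
            have : 0 ≤ (V + c a) ^ k * c a := by positivity
            rw [hK]; nlinarith
        _ ≤ (V + K * c a) ^ k * (V + K * c a) := by
            have hca : c a ≤ K * c a := by
              rw [hK]; nlinarith [show (0 : ℝ) < 4 ^ (k + 1) by positivity]
            gcongr
        _ = (K * (c a + ∑ i ∈ s, c i)) ^ (k + 1) := by
            rw [← pow_succ]; congr 1; rw [hVdef]; ring

lemma integral_pow_even_le_of_eLpNorm_le {k : ℕ} {f : Ω → ℝ} {d : ℝ} (hd : 0 ≤ d)
    (hf : MemLp f ((2 * k + 2 : ℕ) : ℝ≥0∞) μ)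
    (h : eLpNorm f ((2 * k + 2 : ℕ) : ℝ≥0∞) μ ≤ ENNReal.ofReal d) :
    ∫ ω, f ω ^ (2 * k + 2) ∂μ ≤ d ^ (2 * k + 2) := by
  have e : ∫ ω, f ω ^ (2 * k + 2) ∂μ = ∫ ω, ‖f ω‖ ^ (2 * k + 2) ∂μ := by
    congr with ω
    rw [show 2 * k + 2 = 2 * (k + 1) by ring, pow_mul, pow_mul, Real.norm_eq_abs, sq_abs]
  rw [hf.eLpNorm_eq_integral_rpow_norm (by simp) (ENNReal.natCast_ne_top _)] at h
  simp only [ENNReal.toReal_natCast, Real.rpow_natCast] at h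
  rw [ENNReal.ofReal_le_ofReal_iff hd] at h
  rw [e]
  have h0 : 0 ≤ ∫ ω, ‖f ω‖ ^ (2 * k + 2) ∂μ := integral_nonneg fun ω => by positivity
  calc ∫ ω, ‖f ω‖ ^ (2 * k + 2) ∂μ
      = ((∫ ω, ‖f ω‖ ^ (2 * k + 2) ∂μ) ^ (((2 * k + 2 : ℕ) : ℝ)⁻¹)) ^ (2 * k + 2) := by
        rw [Real.rpow_inv_natCast_pow h0 (by omega)]
    _ ≤ d ^ (2 * k + 2) := by gcongr

lemma eLpNorm_le_of_integral_pow_even_le {k : ℕ} {f : Ω → ℝ} {d : ℝ} (hd : 0 ≤ d)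
    (hf : MemLp f ((2 * k + 2 : ℕ) : ℝ≥0∞) μ)
    (h : ∫ ω, f ω ^ (2 * k + 2) ∂μ ≤ d ^ (2 * k + 2)) :
    eLpNorm f ((2 * k + 2 : ℕ) : ℝ≥0∞) μ ≤ ENNReal.ofReal d := by
  have e : ∫ ω, f ω ^ (2 * k + 2) ∂μ = ∫ ω, ‖f ω‖ ^ (2 * k + 2) ∂μ := by
    congr with ω
    rw [show 2 * k + 2 = 2 * (k + 1) by ring, pow_mul, pow_mul, Real.norm_eq_abs, sq_abs]
  rw [hf.eLpNorm_eq_integral_rpow_norm (by simp) (ENNReal.natCast_ne_top _)]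
  simp only [ENNReal.toReal_natCast, Real.rpow_natCast]
  refine ENNReal.ofReal_le_ofReal ?_
  rw [← e]
  have h0 : 0 ≤ ∫ ω, f ω ^ (2 * k + 2) ∂μ := by
    rw [e]; exact integral_nonneg fun ω => by positivity
  calc (∫ ω, f ω ^ (2 * k + 2) ∂μ) ^ (((2 * k + 2 : ℕ) : ℝ)⁻¹)
      ≤ (d ^ (2 * k + 2)) ^ (((2 * k + 2 : ℕ) : ℝ)⁻¹) := by gcongr
    _ = d := Real.pow_rpow_inv_natCast hd (by omega)

/-- The constant of the moment inequality for the norm of order `2 * k + 2`. -/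
noncomputable def momentConst (k : ℕ) : ℝ := Real.sqrt (1 + 3 * 4 ^ (k + 1))

lemma momentConst_pos (k : ℕ) : 0 < momentConst k := Real.sqrt_pos.2 (by positivity)

lemma eLpNorm_sum_le_of_orthogonal {ι : Type*} [LinearOrder ι] {k : ℕ} {Z : ι → Ω → ℝ}
    (hZ : ∀ i, MemLp (Z i) ((2 * k + 2 : ℕ) : ℝ≥0∞) μ) {d : ι → ℝ} (hd : ∀ i, 0 ≤ d i)
    (hZd : ∀ i, eLpNorm (Z i) ((2 * k + 2 : ℕ) : ℝ≥0∞) μ ≤ ENNReal.ofReal (d i))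
    (horth : ∀ (a : ι) (s : Finset ι), (∀ x ∈ s, a < x) →
      ∫ ω, (∑ i ∈ s, Z i ω) ^ (2 * k + 1) * Z a ω ∂μ = 0) (s : Finset ι) :
    eLpNorm (fun ω => ∑ i ∈ s, Z i ω) ((2 * k + 2 : ℕ) : ℝ≥0∞) μ
      ≤ ENNReal.ofReal (momentConst k * Real.sqrt (∑ i ∈ s, d i ^ 2)) := by
  refine eLpNorm_le_of_integral_pow_even_le (by have := momentConst_pos k; positivity)
    (memLp_finsetSum s fun i _ => hZ i) ?_
  refine (integral_sum_pow_even_le hZ (c := fun i => d i ^ 2) (fun i => sq_nonneg _) (fun i => ?_)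
    horth s).trans_eq ?_
  · rw [← pow_mul]; exact integral_pow_even_le_of_eLpNorm_le (hd i) (hZ i) (hZd i)
  · rw [show 2 * k + 2 = 2 * (k + 1) by ring, pow_mul, mul_pow (momentConst k), momentConst,
      Real.sq_sqrt (by positivity), Real.sq_sqrt (Finset.sum_nonneg fun i _ => sq_nonneg _)]

end Moments

/-! ### Characteristic functions and the Stein–Tikhomirov method -/

/-- The complex number `exp (i s)`. -/
noncomputable def cis (s : ℝ) : ℂ := Complex.exp (Complex.I * s)

@[simp] lemma cis_zero : cis 0 = 1 := by simp [cis]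

@[simp] lemma norm_cis (s : ℝ) : ‖cis s‖ = 1 := Complex.norm_exp_I_mul_ofReal s

lemma cis_add (s t : ℝ) : cis (s + t) = cis s * cis t := by
  simp [cis, mul_add, Complex.exp_add]

lemma continuous_cis : Continuous cis := by unfold cis; fun_prop

lemma measurable_cis : Measurable cis := continuous_cis.measurable

lemma norm_cis_sub_one_le (s : ℝ) : ‖cis s - 1‖ ≤ |s| :=
  Real.norm_exp_I_mul_ofReal_sub_one_le

lemma norm_cis_sub_cis_le (s t : ℝ) : ‖cis s - cis t‖ ≤ |s - t| := by
  have e : cis s - cis t = cis t * (cis (s - t) - 1) := by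
    rw [mul_sub, ← cis_add]; simp
  rw [e, norm_mul, norm_cis, one_mul]
  exact norm_cis_sub_one_le _

lemma norm_cis_sub_one_sub_le (s : ℝ) : ‖cis s - 1 - Complex.I * s‖ ≤ 2 * s ^ 2 := by
  rcases le_total |s| 1 with h | h
  · have h1 : ‖Complex.I * (s : ℂ)‖ ≤ 1 := by simpa using h
    refine (Complex.norm_exp_sub_one_sub_id_le h1).trans ?_
    simp only [Complex.norm_mul, Complex.norm_I, Complex.norm_real, Real.norm_eq_abs, one_mul,
      sq_abs]
    nlinarith [sq_nonneg s]
  · calc ‖cis s - 1 - Complex.I * s‖ ≤ ‖cis s - 1‖ + ‖Complex.I * s‖ := norm_sub_le _ _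
      _ ≤ |s| + |s| := by
        gcongr
        · exact norm_cis_sub_one_le s
        · simp
      _ ≤ 2 * s ^ 2 := by rw [← sq_abs]; nlinarith

section CharFun

variable {Ω : Type*} [MeasurableSpace Ω] {μ : Measure Ω} [IsProbabilityMeasure μ]

lemma integrable_pow_of_integrable_pow_three {T : Ω → ℝ} (hTm : Measurable T) (hT0 : ∀ ω, 0 ≤ T ω)
    (hT : Integrable (fun ω => T ω ^ 3) μ) {k : ℕ} (hk : k ≤ 3) :
    Integrable (fun ω => T ω ^ k) μ := by
  refine Integrable.mono' ((integrable_const (1 : ℝ)).add hT) (hTm.pow_const k).aestronglyMeasurable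
    (ae_of_all _ fun ω => ?_)
  rw [Real.norm_of_nonneg (pow_nonneg (hT0 ω) k)]
  simp only [Pi.add_apply]
  rcases le_total (T ω) 1 with h | h
  · exact (pow_le_one₀ (hT0 ω) h).trans (le_add_of_nonneg_right (pow_nonneg (hT0 ω) 3))
  · exact (pow_le_pow_right₀ h hk).trans (le_add_of_nonneg_left zero_le_one)

/-- The inequality `u² s ≤ u³ + s³` is integrated twice, first over `u = T` with `s` fixed and then
over `s = T`, as if `s` were an independent copy. -/
lemma integral_sq_mul_integral_le {T : Ω → ℝ} (hTm : Measurable T) (hT0 : ∀ ω, 0 ≤ T ω)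
    (hT : Integrable (fun ω => T ω ^ 3) μ) :
    (∫ ω, T ω ^ 2 ∂μ) * ∫ ω, T ω ∂μ ≤ 2 * ∫ ω, T ω ^ 3 ∂μ := by
  have i2 := integrable_pow_of_integrable_pow_three hTm hT0 hT (k := 2) (by norm_num)
  have i1 : Integrable T μ := by
    simpa using integrable_pow_of_integrable_pow_three hTm hT0 hT (k := 1) (by norm_num)
  have hpt : ∀ s : ℝ, 0 ≤ s → (∫ ω, T ω ^ 2 ∂μ) * s ≤ (∫ ω, T ω ^ 3 ∂μ) + s ^ 3 := by
    intro s hs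
    have : ∫ ω, T ω ^ 2 * s ∂μ ≤ ∫ ω, (T ω ^ 3 + s ^ 3) ∂μ := by
      refine integral_mono (i2.mul_const s) (hT.add (integrable_const _)) fun ω => ?_
      have := abs_pow_mul_abs_pow_le (T ω) s 2 1
      rwa [abs_of_nonneg (hT0 ω), abs_of_nonneg hs, pow_one] at this
    rw [integral_mul_const, integral_add hT (integrable_const _)] at this
    simpa using this
  have h := integral_mono (i1.const_mul (∫ ω, T ω ^ 2 ∂μ))
    ((integrable_const (∫ ω, T ω ^ 3 ∂μ)).add hT) fun ω => hpt (T ω) (hT0 ω)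
  simp only [Pi.add_apply] at h
  rw [integral_const_mul, integral_add (integrable_const _) hT] at h
  simp only [integral_const, probReal_univ, smul_eq_mul, one_mul] at h
  linarith

/-- One step of the Stein–Tikhomirov method for characteristic functions: `A` and `B` are local
neighbourhood sums around `X`, such that `X` is independent of `U - A` and `X * A` of `U - B`. -/
lemma norm_integral_mul_cis_sub_le {X A B U T : Ω → ℝ} (hX : Measurable X) (hA : Measurable A)
    (hB : Measurable B) (hU : Measurable U) (hTm : Measurable T)
    (hXT : ∀ ω, |X ω| ≤ T ω) (hAT : ∀ ω, |A ω| ≤ T ω) (hBT : ∀ ω, |B ω| ≤ T ω)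
    (hT : Integrable (fun ω => T ω ^ 3) μ) (hX0 : ∫ ω, X ω ∂μ = 0)
    (hXA : IndepFun X (fun ω => U ω - A ω) μ)
    (hXAB : IndepFun (fun ω => X ω * A ω) (fun ω => U ω - B ω) μ) (t : ℝ) :
    ‖(∫ ω, (X ω : ℂ) * cis (t * U ω) ∂μ) -
        Complex.I * t * ((∫ ω, X ω * A ω ∂μ : ℝ) : ℂ) * ∫ ω, cis (t * U ω) ∂μ‖
      ≤ 6 * t ^ 2 * ∫ ω, T ω ^ 3 ∂μ := by
  have hT0 : ∀ ω, 0 ≤ T ω := fun ω => (abs_nonneg _).trans (hXT ω)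
  have i2 := integrable_pow_of_integrable_pow_three hTm hT0 hT (k := 2) (by norm_num)
  have i1 : Integrable T μ := by
    simpa using integrable_pow_of_integrable_pow_three hTm hT0 hT (k := 1) (by norm_num)
  have hcm : ∀ {V : Ω → ℝ}, Measurable V → Measurable fun ω => cis (t * V ω) := fun hV =>
    measurable_cis.comp (hV.const_mul t)
  have hci : ∀ {V : Ω → ℝ}, Measurable V → Integrable (fun ω => cis (t * V ω)) μ := fun hV =>
    Integrable.of_bound (hcm hV).aestronglyMeasurable 1 (ae_of_all _ fun ω => by simp)
  have hUA : Measurable fun ω => U ω - A ω := hU.sub hA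
  have hUB : Measurable fun ω => U ω - B ω := hU.sub hB
  have hXi : Integrable X μ := i1.mono' hX.aestronglyMeasurable (ae_of_all _ hXT)
  have hXAi : Integrable (fun ω => X ω * A ω) μ := by
    refine i2.mono' (hX.mul hA).aestronglyMeasurable (ae_of_all _ fun ω => ?_)
    rw [Real.norm_eq_abs, abs_mul, sq]
    exact mul_le_mul (hXT ω) (hAT ω) (abs_nonneg _) (hT0 ω)
  have hmulc : ∀ {f : Ω → ℝ} {V : Ω → ℝ}, Integrable f μ → Measurable V →
      Integrable (fun ω => (f ω : ℂ) * cis (t * V ω)) μ := by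
    intro f V hf hV
    refine (hf.ofReal (𝕜 := ℂ)).mul_bdd (c := 1) (hcm hV).aestronglyMeasurable
      (ae_of_all _ fun ω => by simp)
  have z1 : ∫ ω, (X ω : ℂ) * cis (t * (U ω - A ω)) ∂μ = 0 := by
    have := (hXA.comp Complex.measurable_ofReal
      (measurable_cis.comp (measurable_const_mul t))).integral_fun_mul_eq_mul_integral
      (Complex.measurable_ofReal.comp hX).aestronglyMeasurable (hcm hUA).aestronglyMeasurable
    simp only [Function.comp_apply] at this
    rw [this, integral_complex_ofReal, hX0]; simp
  have z2 : ∫ ω, ((X ω * A ω : ℝ) : ℂ) * cis (t * (U ω - B ω)) ∂μ =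
      ((∫ ω, X ω * A ω ∂μ : ℝ) : ℂ) * ∫ ω, cis (t * (U ω - B ω)) ∂μ := by
    have := (hXAB.comp Complex.measurable_ofReal
      (measurable_cis.comp (measurable_const_mul t))).integral_fun_mul_eq_mul_integral
      (Complex.measurable_ofReal.comp (hX.mul hA)).aestronglyMeasurable
      (hcm hUB).aestronglyMeasurable
    simp only [Function.comp_apply] at this
    rw [this, integral_complex_ofReal]
  set m : ℝ := ∫ ω, X ω * A ω ∂μ with hm
  have hmT : |m| ≤ ∫ ω, T ω ^ 2 ∂μ := by
    rw [hm, ← Real.norm_eq_abs]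
    refine norm_integral_le_of_norm_le i2 (ae_of_all _ fun ω => ?_)
    rw [Real.norm_eq_abs, abs_mul, sq]
    exact mul_le_mul (hXT ω) (hAT ω) (abs_nonneg _) (hT0 ω)
  -- the three error terms
  have e1 : ‖∫ ω, (X ω : ℂ) * cis (t * (U ω - A ω)) *
      (cis (t * A ω) - 1 - Complex.I * (t * A ω : ℝ)) ∂μ‖ ≤ 2 * t ^ 2 * ∫ ω, T ω ^ 3 ∂μ := by
    rw [← integral_const_mul]
    refine norm_integral_le_of_norm_le (hT.const_mul _) (ae_of_all _ fun ω => ?_)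
    rw [norm_mul, norm_mul, norm_cis, mul_one, Complex.norm_real, Real.norm_eq_abs]
    calc |X ω| * ‖cis (t * A ω) - 1 - Complex.I * (t * A ω : ℝ)‖
        ≤ T ω * (2 * (t * A ω) ^ 2) := by
          gcongr
          · exact hT0 ω
          · exact hXT ω
          · exact norm_cis_sub_one_sub_le _
      _ = 2 * t ^ 2 * (T ω * |A ω| ^ 2) := by rw [sq_abs]; ring
      _ ≤ 2 * t ^ 2 * (T ω * T ω ^ 2) := by
          have := hT0 ω
          gcongr
          exact hAT ω
      _ = 2 * t ^ 2 * T ω ^ 3 := by ring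
  have e2 : ‖∫ ω, ((X ω * A ω : ℝ) : ℂ) * (cis (t * (U ω - A ω)) - cis (t * (U ω - B ω))) ∂μ‖
      ≤ 2 * |t| * ∫ ω, T ω ^ 3 ∂μ := by
    rw [← integral_const_mul]
    refine norm_integral_le_of_norm_le (hT.const_mul _) (ae_of_all _ fun ω => ?_)
    rw [norm_mul, Complex.norm_real, Real.norm_eq_abs, abs_mul]
    have h0 := hT0 ω
    calc |X ω| * |A ω| * ‖cis (t * (U ω - A ω)) - cis (t * (U ω - B ω))‖
        ≤ T ω * T ω * |t * (U ω - A ω) - t * (U ω - B ω)| := by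
          gcongr
          · exact hXT ω
          · exact hAT ω
          · exact norm_cis_sub_cis_le _ _
      _ = T ω * T ω * (|t| * |B ω - A ω|) := by rw [← abs_mul]; ring_nf
      _ ≤ T ω * T ω * (|t| * (T ω + T ω)) := by
          gcongr
          exact (abs_sub _ _).trans (add_le_add (hBT ω) (hAT ω))
      _ = 2 * |t| * T ω ^ 3 := by ring
  have e3 : ‖∫ ω, (cis (t * (U ω - B ω)) - cis (t * U ω)) ∂μ‖ ≤ |t| * ∫ ω, T ω ∂μ := by
    rw [← integral_const_mul]
    refine norm_integral_le_of_norm_le (i1.const_mul _) (ae_of_all _ fun ω => ?_)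
    refine (norm_cis_sub_cis_le _ _).trans ?_
    rw [show t * (U ω - B ω) - t * U ω = -(t * B ω) by ring, abs_neg, abs_mul]
    gcongr
    exact hBT ω
  have j1 := hmulc hXi hU
  have j2 := hmulc hXi hUA
  have j3 := hmulc hXAi hUA
  have j4 := hmulc hXAi hUB
  -- Write `U = (U - A) + A` and expand the factor of `A` to first order. The zeroth-order term is
  -- `z1`, which vanishes; in the first-order term `U - A` is replaced by `U - B`, the expectation
  -- factorizes by `z2`, and `U - B` is replaced by `U`. The three replacement errors are `e1`,
  -- `e2`, `e3`, each contributing 2 to the constant 6.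
  have key : (∫ ω, (X ω : ℂ) * cis (t * U ω) ∂μ) - Complex.I * t * (m : ℂ) * ∫ ω, cis (t * U ω) ∂μ =
      (∫ ω, (X ω : ℂ) * cis (t * (U ω - A ω)) *
        (cis (t * A ω) - 1 - Complex.I * (t * A ω : ℝ)) ∂μ) +
      Complex.I * t * (∫ ω, ((X ω * A ω : ℝ) : ℂ) *
        (cis (t * (U ω - A ω)) - cis (t * (U ω - B ω))) ∂μ) +
      Complex.I * t * m * ∫ ω, (cis (t * (U ω - B ω)) - cis (t * U ω)) ∂μ := by
    have k1 : ∫ ω, (X ω : ℂ) * cis (t * (U ω - A ω)) *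
        (cis (t * A ω) - 1 - Complex.I * (t * A ω : ℝ)) ∂μ =
        (∫ ω, (X ω : ℂ) * cis (t * U ω) ∂μ) - (∫ ω, (X ω : ℂ) * cis (t * (U ω - A ω)) ∂μ) -
        Complex.I * t * ∫ ω, ((X ω * A ω : ℝ) : ℂ) * cis (t * (U ω - A ω)) ∂μ := by
      have j12 : Integrable (fun ω => (X ω : ℂ) * cis (t * U ω) -
        (X ω : ℂ) * cis (t * (U ω - A ω))) μ := j1.sub j2
      rw [← integral_const_mul, ← integral_sub j1 j2, ← integral_sub j12 (j3.const_mul _)]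
      congr with ω
      have : cis (t * U ω) = cis (t * (U ω - A ω)) * cis (t * A ω) := by
        rw [← cis_add]; ring_nf
      rw [this]; push_cast; ring
    have k2 : ∫ ω, ((X ω * A ω : ℝ) : ℂ) * (cis (t * (U ω - A ω)) - cis (t * (U ω - B ω))) ∂μ =
        (∫ ω, ((X ω * A ω : ℝ) : ℂ) * cis (t * (U ω - A ω)) ∂μ) -
        ∫ ω, ((X ω * A ω : ℝ) : ℂ) * cis (t * (U ω - B ω)) ∂μ := by
      rw [← integral_sub j3 j4]
      congr with ω; ring
    rw [k1, k2, z1, z2, integral_sub (hci hUB) (hci hU)]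
    ring
  rw [key]
  have hIt : ‖Complex.I * (t : ℂ)‖ = |t| := by simp
  have hT3 : 0 ≤ ∫ ω, T ω ^ 3 ∂μ := integral_nonneg fun ω => pow_nonneg (hT0 ω) 3
  calc _ ≤ 2 * t ^ 2 * ∫ ω, T ω ^ 3 ∂μ + |t| * (2 * |t| * ∫ ω, T ω ^ 3 ∂μ)
        + |t| * (∫ ω, T ω ^ 2 ∂μ) * (|t| * ∫ ω, T ω ∂μ) := by
        refine norm_add₃_le.trans (add_le_add_three e1 ?_ ?_)
        · rw [norm_mul, hIt]; gcongr
        · rw [norm_mul, norm_mul, hIt, Complex.norm_real, Real.norm_eq_abs]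
          gcongr
    _ = 4 * t ^ 2 * ∫ ω, T ω ^ 3 ∂μ + t ^ 2 * ((∫ ω, T ω ^ 2 ∂μ) * ∫ ω, T ω ∂μ) := by
        rw [← sq_abs t]; ring
    _ ≤ 4 * t ^ 2 * ∫ ω, T ω ^ 3 ∂μ + t ^ 2 * (2 * ∫ ω, T ω ^ 3 ∂μ) := by
        have := mul_le_mul_of_nonneg_left (integral_sq_mul_integral_le hTm hT0 hT) (sq_nonneg t)
        linarith
    _ = _ := by ring

lemma hasDerivAt_integral_cis {U : Ω → ℝ} (hU : Measurable U) (hUi : Integrable U μ) (t : ℝ) :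
    HasDerivAt (fun s : ℝ => ∫ ω, cis (s * U ω) ∂μ)
      (Complex.I * ∫ ω, (U ω : ℂ) * cis (t * U ω) ∂μ) t := by
  rw [← integral_const_mul]
  have hcm : ∀ s : ℝ, Measurable fun ω => cis (s * U ω) := fun s =>
    measurable_cis.comp (hU.const_mul s)
  refine (hasDerivAt_integral_of_dominated_loc_of_deriv_le (s := Set.univ) (bound := fun ω => |U ω|)
    (F' := fun s ω => Complex.I * ((U ω : ℂ) * cis (s * U ω)))
    Filter.univ_mem (Eventually.of_forall fun s => (hcm s).aestronglyMeasurable)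
    (Integrable.of_bound (hcm t).aestronglyMeasurable 1 (ae_of_all _ fun ω => by simp))
    (((Complex.measurable_ofReal.comp hU).mul (hcm t)).const_mul _).aestronglyMeasurable
    (ae_of_all _ fun ω s _ => by simp) hUi.abs (ae_of_all _ fun ω s _ => ?_)).2
  have h1 : HasDerivAt (fun s : ℝ => Complex.I * ((s * U ω : ℝ) : ℂ)) (Complex.I * (U ω : ℂ)) s := by
    have : HasDerivAt (fun s : ℝ => s * U ω) (U ω) s := by
      simpa using (hasDerivAt_id s).mul_const (U ω)
    exact this.ofReal_comp.const_mul _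
  exact h1.cexp.congr_deriv (by unfold cis; ring)

/-- The hypothesis says that the characteristic function `φ` nearly solves the Gaussian equation `φ'
= -v t φ`. With the integrating factor `exp (v t² / 2)` the derivative is at most `R exp (v / 2)` on
`[0, 1]`; the final multiplication by `exp (-v / 2)` removes the exponential, so the bound is free
of `v`. -/
lemma norm_integral_cis_sub_exp_le {U : Ω → ℝ} (hU : Measurable U) (hUi : Integrable U μ)
    {v R : ℝ} (hv : 0 ≤ v)
    (h : ∀ t ∈ Set.Icc (0 : ℝ) 1, ‖(∫ ω, (U ω : ℂ) * cis (t * U ω) ∂μ) -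
        Complex.I * t * (v : ℂ) * ∫ ω, cis (t * U ω) ∂μ‖ ≤ R) :
    ‖(∫ ω, cis (U ω) ∂μ) - Complex.exp (-(v / 2 : ℝ))‖ ≤ R := by
  set φ : ℝ → ℂ := fun s => ∫ ω, cis (s * U ω) ∂μ with hφ
  have hR : 0 ≤ R := (norm_nonneg _).trans (h 0 (by simp))
  have hd : ∀ t, HasDerivAt (fun s : ℝ => φ s * Complex.exp ((v * s ^ 2 / 2 : ℝ) : ℂ))
      (Complex.I * ((∫ ω, (U ω : ℂ) * cis (t * U ω) ∂μ) - Complex.I * t * (v : ℂ) * φ t) *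
        Complex.exp ((v * t ^ 2 / 2 : ℝ) : ℂ)) t := by
    intro t
    have h1 : HasDerivAt (fun s : ℝ => v * s ^ 2 / 2) (v * t) t := by
      have := ((hasDerivAt_pow 2 t).const_mul v).div_const 2
      exact this.congr_deriv (by simp; ring)
    have h2 : HasDerivAt (fun s : ℝ => φ s * Complex.exp ((v * s ^ 2 / 2 : ℝ) : ℂ)) _ t :=
      (hasDerivAt_integral_cis hU hUi t).mul h1.ofReal_comp.cexp
    refine h2.congr_deriv ?_
    have : Complex.I * (Complex.I * t * (v : ℂ) * φ t) = -(t * v * φ t) := by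
      rw [show Complex.I * (Complex.I * t * (v : ℂ) * φ t) =
        (Complex.I * Complex.I) * (t * v * φ t) by ring, Complex.I_mul_I]; ring
    rw [mul_sub, this, hφ]; push_cast; ring
  have hb := norm_image_sub_le_of_norm_deriv_le_segment_01'
    (f := fun s : ℝ => φ s * Complex.exp ((v * s ^ 2 / 2 : ℝ) : ℂ)) (C := R * Real.exp (v / 2))
    (fun t _ => (hd t).hasDerivWithinAt) (fun t ht => by
      rw [norm_mul, norm_mul, Complex.norm_I, one_mul, Complex.norm_exp_ofReal]
      have h1 := h t ⟨ht.1, ht.2.le⟩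
      have h2 : v * t ^ 2 / 2 ≤ v / 2 := by
        have : t ^ 2 ≤ 1 := pow_le_one₀ ht.1 ht.2.le
        nlinarith
      gcongr)
  have e0 : φ 0 = 1 := by simp [hφ]
  have e1 : φ 1 = ∫ ω, cis (U ω) ∂μ := by simp [hφ]
  simp only [e0, e1, one_pow, mul_one] at hb
  have e2 : (∫ ω, cis (U ω) ∂μ) - Complex.exp (-(v / 2 : ℝ)) =
      ((∫ ω, cis (U ω) ∂μ) * Complex.exp ((v / 2 : ℝ) : ℂ) -
        1 * Complex.exp ((v * 0 ^ 2 / 2 : ℝ) : ℂ)) * Complex.exp (-((v / 2 : ℝ) : ℂ)) := by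
    rw [sub_mul, mul_assoc, ← Complex.exp_add]; simp
  rw [e2, norm_mul, ← Complex.ofReal_neg, Complex.norm_exp_ofReal]
  calc _ ≤ R * Real.exp (v / 2) * Real.exp (-(v / 2)) := by gcongr
    _ = R := by rw [mul_assoc, ← Real.exp_add]; simp

end CharFun

/-! ### Central limit theorem under local dependence -/

section LocalDependence

/-- The indices at distance less than `r` from `l`. -/
def nearby {n : ℕ} (r : ℕ) (l : Fin n) : Finset (Fin n) :=
  Finset.univ.filter fun k => (k : ℤ) - l < r ∧ (l : ℤ) - k < r

lemma mem_nearby {n r : ℕ} {l k : Fin n} :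
    k ∈ nearby r l ↔ (k : ℤ) - l < r ∧ (l : ℤ) - k < r := by simp [nearby]

lemma mem_nearby_comm {n r : ℕ} {l k : Fin n} : k ∈ nearby r l ↔ l ∈ nearby r k := by
  rw [mem_nearby, mem_nearby, and_comm]

lemma card_nearby_le {n r : ℕ} (l : Fin n) : (nearby r l).card ≤ 2 * r := by
  have h : (nearby r l).card ≤ (Finset.Ioo ((l : ℤ) - r) (l + r)).card := by
    refine Finset.card_le_card_of_injOn (fun k : Fin n => (k : ℤ)) (fun k hk => ?_)
      (fun a _ b _ hab => Fin.ext (by simpa using hab))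
    have := mem_nearby.1 (Finset.mem_coe.1 hk)
    simp only [Finset.coe_Ioo, Set.mem_Ioo]
    omega
  rw [Int.card_Ioo] at h
  omega

variable {Ω : Type*} [MeasurableSpace Ω] {μ : Measure Ω} [IsProbabilityMeasure μ]

/-- A quantitative central limit theorem, in terms of characteristic functions, for sums of centred
`L`-dependent random variables. -/
theorem norm_integral_cis_sum_sub_le {n : ℕ} {X : Fin n → Ω → ℝ} {L : ℕ} (hL : 1 ≤ L)
    (hXm : ∀ i, Measurable (X i)) (hX3 : ∀ i, Integrable (fun ω => |X i ω| ^ 3) μ)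
    (hX0 : ∀ i, ∫ ω, X i ω ∂μ = 0)
    (hind : ∀ A B : Finset (Fin n), (∀ a ∈ A, ∀ b ∈ B, a ∉ nearby L b) →
      IndepFun (fun ω (i : A) => X i ω) (fun ω (i : B) => X i ω) μ) :
    ‖(∫ ω, cis (∑ i, X i ω) ∂μ) - Complex.exp (-((∫ ω, (∑ i, X i ω) ^ 2 ∂μ) / 2 : ℝ))‖
      ≤ 6 * (4 * L) ^ 3 * ∑ i, ∫ ω, |X i ω| ^ 3 ∂μ := by
  set U : Ω → ℝ := fun ω => ∑ i, X i ω with hUdef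
  set S : Finset (Fin n) → Ω → ℝ := fun s ω => ∑ i ∈ s, X i ω with hS
  -- `T l` dominates `X l` and its neighbourhood sums of radii `L` and `2 L`, which are the `A` and
  -- `B` of the Stein–Tikhomirov step.
  set T : Fin n → Ω → ℝ := fun l ω => ∑ k ∈ nearby (2 * L) l, |X k ω| with hT
  have hSm : ∀ s, Measurable (S s) := fun s => Finset.measurable_fun_sum s fun i _ => hXm i
  have hUm : Measurable U := hSm Finset.univ
  have hTm : ∀ l, Measurable (T l) := fun l =>
    Finset.measurable_fun_sum _ fun i _ => (hXm i).abs
  have hT0 : ∀ l ω, 0 ≤ T l ω := fun l ω => Finset.sum_nonneg fun _ _ => abs_nonneg _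
  have hsub : ∀ l : Fin n, nearby L l ⊆ nearby (2 * L) l := fun l k hk => by
    rw [mem_nearby] at hk ⊢; push_cast; omega
  have hself : ∀ l : Fin n, l ∈ nearby L l := fun l => by rw [mem_nearby]; omega
  have hST : ∀ l, ∀ s ⊆ nearby (2 * L) l, ∀ ω, |S s ω| ≤ T l ω := fun l s hs ω =>
    (Finset.abs_sum_le_sum_abs _ _).trans
      (Finset.sum_le_sum_of_subset_of_nonneg hs fun _ _ _ => abs_nonneg _)
  have hXT : ∀ l ω, |X l ω| ≤ T l ω := fun l ω => by
    simpa [hS] using hST l {l} (Finset.singleton_subset_iff.2 (hsub l (hself l))) ω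
  have hTle : ∀ l ω, T l ω ^ 3 ≤ (4 * L) ^ 2 * ∑ k ∈ nearby (2 * L) l, |X k ω| ^ 3 := by
    intro l ω
    have h := pow_sum_div_card_le_sum_pow (s := nearby (2 * L) l) (f := fun k => |X k ω|)
      (fun _ _ => abs_nonneg _) 2
    have hc : ((nearby (2 * L) l).card : ℝ) ≤ 4 * L := by
      have := card_nearby_le (r := 2 * L) l
      have h4 : (nearby (2 * L) l).card ≤ 4 * L := by omega
      exact_mod_cast h4
    have hpos : (0 : ℝ) < (nearby (2 * L) l).card := by
      exact_mod_cast Finset.card_pos.2 ⟨l, hsub l (hself l)⟩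
    rw [div_le_iff₀ (by positivity)] at h
    refine h.trans ?_
    rw [mul_comm]
    have : 0 ≤ ∑ k ∈ nearby (2 * L) l, |X k ω| ^ 3 := Finset.sum_nonneg fun _ _ => by positivity
    gcongr
  have hT3 : ∀ l, Integrable (fun ω => T l ω ^ 3) μ := fun l =>
    Integrable.mono' ((integrable_finsetSum (nearby (2 * L) l) fun k _ => hX3 k).const_mul
      ((4 * L : ℝ) ^ 2)) ((hTm l).pow_const 3).aestronglyMeasurable (ae_of_all _ fun ω => by
        rw [Real.norm_of_nonneg (pow_nonneg (hT0 l ω) 3)]; exact hTle l ω)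
  have hT1 : ∀ l, Integrable (T l) μ := fun l => by
    simpa using integrable_pow_of_integrable_pow_three (hTm l) (hT0 l) (hT3 l) (k := 1)
      (by norm_num)
  have hXi : ∀ l, Integrable (X l) μ := fun l =>
    (hT1 l).mono' (hXm l).aestronglyMeasurable (ae_of_all _ (hXT l))
  have hX2 : ∀ l, MemLp (X l) 2 μ := fun l => by
    rw [memLp_two_iff_integrable_sq (hXm l).aestronglyMeasurable]
    simpa using integrable_pow_of_integrable_pow_three (hXm l).abs (fun ω => abs_nonneg _)
      (hX3 l) (k := 2) (by norm_num)
  have hSi : ∀ s, Integrable (S s) μ := fun s => integrable_finsetSum s fun i _ => hXi i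
  have hS2 : ∀ s, MemLp (S s) 2 μ := fun s => memLp_finsetSum s fun i _ => hX2 i
  have hcompl : ∀ s ω, U ω - S s ω = S sᶜ ω := fun s ω => by
    rw [sub_eq_iff_eq_add, hUdef, hS]
    exact (Finset.sum_compl_add_sum s _).symm
  have hind1 : ∀ l, IndepFun (X l) (fun ω => U ω - S (nearby L l) ω) μ := by
    intro l
    have h := hind {l} (nearby L l)ᶜ fun a ha b hb => by
      rw [Finset.mem_singleton] at ha
      rw [Finset.mem_compl, mem_nearby_comm] at hb
      rwa [ha]
    have h2 := h.comp
      (φ := fun x : ({l} : Finset (Fin n)) → ℝ => ∑ i, x i)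
      (ψ := fun x : ((nearby L l)ᶜ : Finset (Fin n)) → ℝ => ∑ i, x i) (by fun_prop) (by fun_prop)
    refine h2.congr (ae_of_all _ fun ω => by simp) (ae_of_all _ fun ω => ?_)
    simp only [hcompl]
    exact Finset.sum_coe_sort (nearby L l)ᶜ fun i => X i ω
  have hind2 : ∀ l, IndepFun (fun ω => X l ω * S (nearby L l) ω)
      (fun ω => U ω - S (nearby (2 * L) l) ω) μ := by
    intro l
    have h := hind (nearby L l) (nearby (2 * L) l)ᶜ fun a ha b hb => by
      rw [Finset.mem_compl] at hb
      rw [mem_nearby] at ha hb ⊢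
      push_cast at hb
      omega
    have h2 := h.comp (φ := fun x : nearby L l → ℝ => x ⟨l, hself l⟩ * ∑ i, x i)
      (ψ := fun x : ((nearby (2 * L) l)ᶜ : Finset (Fin n)) → ℝ => ∑ i, x i)
      (by fun_prop) (by fun_prop)
    refine h2.congr (ae_of_all _ fun ω => ?_) (ae_of_all _ fun ω => ?_)
    · simp only [Function.comp_apply, hS]
      rw [Finset.sum_coe_sort (nearby L l) fun i => X i ω]
    · simp only [hcompl]
      exact Finset.sum_coe_sort (nearby (2 * L) l)ᶜ fun i => X i ω
  have hXS : ∀ l s, Integrable (fun ω => X l ω * S s ω) μ := fun l s =>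
    (hX2 l).integrable_mul (hS2 s)
  -- `X l` is centred and independent of `U` minus its neighbourhood sum, so only products of nearby
  -- terms contribute to the variance.
  have hvar : ∫ ω, U ω ^ 2 ∂μ = ∑ l, ∫ ω, X l ω * S (nearby L l) ω ∂μ := by
    have h1 : ∫ ω, U ω ^ 2 ∂μ = ∑ l, ∫ ω, X l ω * U ω ∂μ := by
      rw [← integral_finsetSum _ fun l _ => hXS l Finset.univ]
      congr with ω
      rw [← Finset.sum_mul, sq]
    rw [h1]
    refine Finset.sum_congr rfl fun l _ => ?_
    have h2 := (hind1 l).integral_fun_mul_eq_mul_integral (hXm l).aestronglyMeasurable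
      (hUm.sub (hSm _)).aestronglyMeasurable
    rw [hX0 l, zero_mul] at h2
    rw [← sub_eq_zero, ← integral_sub (hXS l Finset.univ) (hXS l _), ← h2]
    congr with ω
    ring
  -- Each index lies in at most `4 L` neighbourhoods of radius `2 L`; this third factor `4 L` joins
  -- the two from the power mean inequality in `hTle`.
  have hsum : ∑ l, ∫ ω, T l ω ^ 3 ∂μ ≤ (4 * L) ^ 3 * ∑ i, ∫ ω, |X i ω| ^ 3 ∂μ := by
    have hc0 : ∀ k, 0 ≤ ∫ ω, |X k ω| ^ 3 ∂μ := fun k => integral_nonneg fun ω => by positivity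
    calc ∑ l, ∫ ω, T l ω ^ 3 ∂μ
        ≤ ∑ l, (4 * L : ℝ) ^ 2 * ∑ k ∈ nearby (2 * L) l, ∫ ω, |X k ω| ^ 3 ∂μ := by
          refine Finset.sum_le_sum fun l _ => ?_
          rw [← integral_finsetSum _ fun k _ => hX3 k, ← integral_const_mul]
          exact integral_mono (hT3 l)
            ((integrable_finsetSum (nearby (2 * L) l) fun k _ => hX3 k).const_mul _) (hTle l)
      _ = (4 * L : ℝ) ^ 2 * ∑ k, (nearby (2 * L) k).card * ∫ ω, |X k ω| ^ 3 ∂μ := by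
          rw [← Finset.mul_sum]
          congr 1
          rw [Finset.sum_comm' (t' := Finset.univ) (s' := fun k => nearby (2 * L) k)
            (fun x y => by simp [mem_nearby_comm])]
          simp
      _ ≤ (4 * L : ℝ) ^ 2 * ∑ k, (4 * L) * ∫ ω, |X k ω| ^ 3 ∂μ := by
          gcongr with k _
          have := card_nearby_le (r := 2 * L) k
          have h4 : (nearby (2 * L) k).card ≤ 4 * L := by omega
          exact_mod_cast h4
      _ = _ := by rw [← Finset.mul_sum]; ring
  refine norm_integral_cis_sub_exp_le hUm (hSi Finset.univ) (integral_nonneg fun ω => sq_nonneg _)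
    fun t ht => ?_
  have hXc : ∀ l, Integrable (fun ω => (X l ω : ℂ) * cis (t * U ω)) μ := fun l =>
    ((hXi l).ofReal (𝕜 := ℂ)).mul_bdd (c := 1)
      (measurable_cis.comp (hUm.const_mul t)).aestronglyMeasurable (ae_of_all _ fun ω => by simp)
  have hdecomp : (∫ ω, (U ω : ℂ) * cis (t * U ω) ∂μ) -
      Complex.I * t * ((∫ ω, U ω ^ 2 ∂μ : ℝ) : ℂ) * ∫ ω, cis (t * U ω) ∂μ =
      ∑ l, ((∫ ω, (X l ω : ℂ) * cis (t * U ω) ∂μ) -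
        Complex.I * t * ((∫ ω, X l ω * S (nearby L l) ω ∂μ : ℝ) : ℂ) *
          ∫ ω, cis (t * U ω) ∂μ) := by
    rw [Finset.sum_sub_distrib, ← integral_finsetSum _ fun l _ => hXc l, hvar, Complex.ofReal_sum,
      Finset.mul_sum, Finset.sum_mul]
    congr 2 with ω
    rw [← Finset.sum_mul, hUdef, Complex.ofReal_sum]
  rw [hdecomp]
  refine (norm_sum_le _ _).trans ?_
  calc _ ≤ ∑ l, 6 * t ^ 2 * ∫ ω, T l ω ^ 3 ∂μ := Finset.sum_le_sum fun l _ =>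
        norm_integral_mul_cis_sub_le (hXm l) (hSm _) (hSm _) hUm (hTm l) (hXT l)
          (hST l _ (hsub l)) (hST l _ subset_rfl) (hT3 l) (hX0 l) (hind1 l) (hind2 l) t
    _ ≤ ∑ l, 6 * ∫ ω, T l ω ^ 3 ∂μ := by
        refine Finset.sum_le_sum fun l _ => ?_
        have h1 : t ^ 2 ≤ 1 := pow_le_one₀ ht.1 ht.2
        have h2 : 0 ≤ ∫ ω, T l ω ^ 3 ∂μ := integral_nonneg fun ω => pow_nonneg (hT0 l ω) 3
        nlinarith
    _ ≤ _ := by rw [← Finset.mul_sum, mul_assoc]; gcongr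

end LocalDependence

/-! ### Coupling the errors with independent copies -/

namespace ErrorProcess

variable {n : ℕ} {Ω : Type*} [MeasurableSpace Ω] {μ : Measure Ω} [IsProbabilityMeasure μ]
  (E : ErrorProcess n μ)

/-- The product space carrying the innovations (at the indices `(none, t)`) and, for every time
index `l`, a further independent copy of all of them (at the indices `(some l, t)`). -/
noncomputable def copyMeasure : Measure (Option (Fin n) × ℤ → ℝ) :=
  Measure.infinitePi fun i => μ.map (E.e i.2)

lemma isProbabilityMeasure_map_e (t : ℤ) : IsProbabilityMeasure (μ.map (E.e t)) :=
  Measure.isProbabilityMeasure_map (E.measurable_e t).aemeasurable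

instance : IsProbabilityMeasure E.copyMeasure :=
  have := E.isProbabilityMeasure_map_e
  inferInstanceAs (IsProbabilityMeasure (Measure.infinitePi _))

omit [IsProbabilityMeasure μ] in
lemma measurable_elim (s : ℤ ⊕ ℤ) : Measurable (Sum.elim E.e E.e' s) := by
  cases s with
  | inl t => exact E.measurable_e t
  | inr t => exact E.measurable_e' t

omit [IsProbabilityMeasure μ] in
lemma map_elim (s : ℤ ⊕ ℤ) :
    μ.map (Sum.elim E.e E.e' s) = μ.map (E.e (Sum.elim id id s)) := by
  cases s with
  | inl t => rfl
  | inr t => exact (E.identDistrib t).map_eq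

/-- Functions of reindexed innovations have the same law on the original space and on the space
of copies. -/
lemma identDistrib_reindex {J β : Type*} [MeasurableSpace β] {f₁ : J → ℤ ⊕ ℤ}
    {f₂ : J → Option (Fin n) × ℤ} (h₁ : Function.Injective f₁) (h₂ : Function.Injective f₂)
    (h : ∀ j, Sum.elim id id (f₁ j) = (f₂ j).2) {F : (J → ℝ) → β} (hF : Measurable F) :
    IdentDistrib (fun ω => F fun j => Sum.elim E.e E.e' (f₁ j) ω) (fun z => F fun j => z (f₂ j))
      μ E.copyMeasure := by
  have := E.isProbabilityMeasure_map_e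
  have m1 : Measurable fun ω => fun j => Sum.elim E.e E.e' (f₁ j) ω :=
    measurable_pi_lambda _ fun j => E.measurable_elim _
  have m2 : Measurable fun z : Option (Fin n) × ℤ → ℝ => fun j => z (f₂ j) :=
    measurable_pi_lambda _ fun j => measurable_pi_apply _
  have key : IdentDistrib (fun ω => fun j => Sum.elim E.e E.e' (f₁ j) ω) (fun z => fun j => z (f₂ j))
      μ E.copyMeasure := by
    refine ⟨m1.aemeasurable, m2.aemeasurable, ?_⟩
    rw [(E.indep.precomp h₁).map_fun_eq_infinitePi_map fun j => E.measurable_elim _, copyMeasure,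
      Measure.map_infinitePi_infinitePi_of_inj h₂]
    congr with j : 1
    rw [map_elim, h]
  exact key.comp hF

lemma measurePreserving_reindex {f : Option (Fin n) × ℤ → Option (Fin n) × ℤ}
    (hf : Function.Injective f) (h : ∀ i, (f i).2 = i.2) :
    MeasurePreserving (fun (z : Option (Fin n) × ℤ → ℝ) i => z (f i)) E.copyMeasure
      E.copyMeasure := by
  have := E.isProbabilityMeasure_map_e
  refine ⟨measurable_pi_lambda _ fun j => measurable_pi_apply _, ?_⟩
  rw [copyMeasure, Measure.map_infinitePi_infinitePi_of_inj hf]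
  simp only [h]

/-- The error process on the space of copies. -/
def full (z : Option (Fin n) × ℤ → ℝ) (l : Fin n) : ℝ := E.g l fun k => z (none, time l - k)

/-- The `l`-th error with all but the last `j` innovations taken from the `l`-th copy. -/
def coupled (j : ℕ) (l : Fin n) (z : Option (Fin n) × ℤ → ℝ) : ℝ :=
  E.g l fun k => z (if k < j then none else some l, time l - k)

omit [IsProbabilityMeasure μ] in
lemma measurable_coupled (j : ℕ) (l : Fin n) : Measurable (E.coupled j l) :=
  (E.measurable_g l).comp (measurable_pi_lambda _ fun _ => measurable_pi_apply _)

omit [IsProbabilityMeasure μ] in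
lemma measurable_full (l : Fin n) : Measurable fun z => E.full z l :=
  (E.measurable_g l).comp (measurable_pi_lambda _ fun _ => measurable_pi_apply _)

lemma identDistrib_full : IdentDistrib E.err E.full μ E.copyMeasure := by
  refine E.identDistrib_reindex (f₁ := Sum.inl) (f₂ := fun t : ℤ => (none, t))
    (F := fun x l => E.g l fun k => x (time l - k)) Sum.inl_injective (fun a b h => by simpa using h)
    (fun j => rfl) (measurable_pi_lambda _ fun l => ?_)
  exact (E.measurable_g l).comp (measurable_pi_lambda _ fun _ => measurable_pi_apply _)

lemma identDistrib_coupled (j : ℕ) (l : Fin n) :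
    IdentDistrib (fun ω => E.err ω l) (E.coupled j l) μ E.copyMeasure :=
  E.identDistrib_reindex (f₁ := fun k : ℕ => Sum.inl (time l - k))
    (f₂ := fun k : ℕ => (if k < j then none else some l, time l - k)) (F := E.g l)
    (fun a b h => by simpa using h) (fun a b h => by simpa using (Prod.ext_iff.1 h).2)
    (fun j => rfl) (E.measurable_g l)

/-- The effect on the `l`-th error of replacing the innovation `j` steps back. -/
def increment (j : ℕ) (l : Fin n) (z : Option (Fin n) × ℤ → ℝ) : ℝ :=
  E.coupled (j + 1) l z - E.coupled j l z

omit [IsProbabilityMeasure μ] in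
lemma measurable_increment (j : ℕ) (l : Fin n) : Measurable (E.increment j l) :=
  (E.measurable_coupled _ _).sub (E.measurable_coupled _ _)

lemma identDistrib_increment (j : ℕ) (l : Fin n) :
    IdentDistrib (fun ω => E.err ω l - E.errCoupled j ω l) (E.increment j l) μ E.copyMeasure := by
  have h := E.identDistrib_reindex
    -- The index `none` stands for the replacement at lag `j`, and `some k` for the innovation at
    -- lag `k` before replacement. The lags beyond `j` come from the process on one side and from
    -- the copy on the other; the laws agree because both index maps are injective and respect
    -- times.
    (f₁ := fun k : Option ℕ => k.elim (Sum.inr (time l - j)) fun k => Sum.inl (time l - k))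
    (f₂ := fun k : Option ℕ => k.elim (some l, time l - j) fun k =>
      (if k < j + 1 then none else some l, time l - k))
    (F := fun x => E.g l (fun k => x (some k)) - E.g l fun k => if k = j then x none else x (some k))
    ?_ ?_ ?_ ?_
  · convert h using 1
    · ext ω
      simp only [err, errCoupled, Option.elim, Sum.elim_inl, Sum.elim_inr]
      congr 2 with k
      by_cases hk : k = j <;> simp [hk]
    · ext z
      simp only [increment, coupled, Option.elim]
      congr 2 with k
      by_cases hk : k = j
      · simp [hk]
      · rw [if_neg hk]
        have : k < j ↔ k < j + 1 := by omega
        simp [this]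
  · rintro (_ | a) (_ | b) hab <;> simp_all
  · rintro (_ | a) (_ | b) hab
    · rfl
    · simp only [Option.elim, Prod.mk.injEq, sub_right_inj, Nat.cast_inj] at hab
      obtain ⟨h1, rfl⟩ := hab
      simp at h1
    · simp only [Option.elim, Prod.mk.injEq, sub_right_inj, Nat.cast_inj] at hab
      obtain ⟨h1, rfl⟩ := hab
      simp at h1
    · simpa using (Prod.ext_iff.1 hab).2
  · rintro (_ | a) <;> rfl
  · refine ((E.measurable_g l).comp (measurable_pi_lambda _ fun _ => measurable_pi_apply _)).sub
      ((E.measurable_g l).comp (measurable_pi_lambda _ fun k => ?_))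
    by_cases hk : k = j
    · simpa only [hk, if_true] using measurable_pi_apply _
    · simpa only [hk, if_false] using measurable_pi_apply _

omit [IsProbabilityMeasure μ] in
-- Neither swapped coordinate is read: with at most `j + 1` true innovations, the later error `l`
-- uses none older than `time l - j > time a - j`, and its copy is not that of `a`.
lemma coupled_swap_of_lt {a l : Fin n} (hal : a < l) (i j : ℕ) (hij : i ≤ j + 1)
    (z : Option (Fin n) × ℤ → ℝ) :
    E.coupled i l (fun s => z (Equiv.swap (none, time a - j) (some a, time a - j) s)) =
      E.coupled i l z := by
  have hlt : time a < time l := by simpa [time] using hal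
  unfold coupled
  congr with k
  beta_reduce
  split_ifs with hk
  · rw [Equiv.swap_apply_of_ne_of_ne]
    · intro h
      have := (Prod.ext_iff.1 h).2
      simp only at this
      omega
    · simp
  · rw [Equiv.swap_apply_of_ne_of_ne]
    · simp
    · intro h
      have := (Prod.ext_iff.1 h).1
      simp only [Option.some.injEq] at this
      exact hal.ne' this

omit [IsProbabilityMeasure μ] in
lemma increment_swap_of_lt {a l : Fin n} (hal : a < l) (j : ℕ) (z : Option (Fin n) × ℤ → ℝ) :
    E.increment j l (fun s => z (Equiv.swap (none, time a - j) (some a, time a - j) s)) =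
      E.increment j l z := by
  simp only [increment]
  rw [E.coupled_swap_of_lt hal _ _ le_rfl, E.coupled_swap_of_lt hal _ _ (Nat.le_succ j)]

omit [IsProbabilityMeasure μ] in
-- The two terms of the increment differ only in which of the two swapped coordinates supplies the
-- innovation at lag `j`, so the swap interchanges them.
lemma increment_swap_self (a : Fin n) (j : ℕ) (z : Option (Fin n) × ℤ → ℝ) :
    E.increment j a (fun s => z (Equiv.swap (none, time a - j) (some a, time a - j) s)) =
      -E.increment j a z := by
  have h : ∀ i k : ℕ, k ≠ j →
      Equiv.swap ((none : Option (Fin n)), time a - (j : ℤ)) (some a, time a - j)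
        (if k < i then none else some a, time a - k) =
        (if k < i then none else some a, time a - k) := by
    intro i k hk
    rw [Equiv.swap_apply_of_ne_of_ne] <;>
    · intro h
      have := (Prod.ext_iff.1 h).2
      simp only [sub_right_inj, Nat.cast_inj] at this
      exact hk this
  have h1 : E.coupled (j + 1) a
      (fun s => z (Equiv.swap (none, time a - j) (some a, time a - j) s)) = E.coupled j a z := by
    unfold coupled
    congr with k
    by_cases hk : k = j
    · subst hk; simp
    · beta_reduce
      rw [h _ _ hk]
      have : k < j ↔ k < j + 1 := by omega
      simp [this]
  have h2 : E.coupled j a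
      (fun s => z (Equiv.swap (none, time a - j) (some a, time a - j) s)) =
        E.coupled (j + 1) a z := by
    unfold coupled
    congr with k
    by_cases hk : k = j
    · subst hk; simp
    · beta_reduce
      rw [h _ _ hk]
      have : k < j ↔ k < j + 1 := by omega
      simp [this]
  simp only [increment, h1, h2]
  ring

/-- Antisymmetry: the swap preserves the measure, fixes the increments of all errors later than `a`
and reverses the sign of that of `a`, so the integral equals its own negative. This is the
orthogonality required by the even-moment inequality. -/
lemma integral_sum_increment_pow_mul_increment (j r : ℕ) (w : Fin n → ℝ) (a : Fin n)
    (s : Finset (Fin n)) (hs : ∀ x ∈ s, a < x) :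
    ∫ z, (∑ l ∈ s, w l * E.increment j l z) ^ r * (w a * E.increment j a z) ∂E.copyMeasure = 0 := by
  set σ := Equiv.swap ((none : Option (Fin n)), time a - (j : ℤ)) (some a, time a - (j : ℤ)) with hσ
  have hmp := E.measurePreserving_reindex (f := σ) σ.injective fun i => by
    rw [hσ, Equiv.swap_apply_def]
    split_ifs with h1 h2
    · rw [h1]
    · rw [h2]
    · rfl
  set F : (Option (Fin n) × ℤ → ℝ) → ℝ := fun z =>
    (∑ l ∈ s, w l * E.increment j l z) ^ r * (w a * E.increment j a z) with hF
  have hFm : Measurable F :=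
    ((Finset.measurable_fun_sum s fun l _ => (E.measurable_increment j l).const_mul _).pow_const
      r).mul ((E.measurable_increment j a).const_mul _)
  have h1 : ∫ z, F z ∂E.copyMeasure = ∫ z, F (fun i => z (σ i)) ∂E.copyMeasure := by
    conv_lhs => rw [← hmp.map_eq]
    rw [integral_map hmp.measurable.aemeasurable hFm.aestronglyMeasurable]
  have h2 : ∀ z, F (fun i => z (σ i)) = -F z := by
    intro z
    simp only [hF]
    rw [hσ, E.increment_swap_self, Finset.sum_congr rfl fun l hl => by
      rw [E.increment_swap_of_lt (hs l hl)]]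
    ring
  simp only [h2, integral_neg] at h1
  linarith

end ErrorProcess

/-! ### Approximation by errors of finite range -/

namespace ErrorProcess

variable {n : ℕ} {Ω : Type*} [MeasurableSpace Ω] {μ : Measure Ω} [IsProbabilityMeasure μ]
  (E : ErrorProcess n μ)

/-- Two coupled errors can share a coordinate only among the true innovations, which forces their
times to be closer than `L`, or in a copy, which forces the errors to be the same. The condition `a
≠ b` matters for `L = 0`, where `nearby` is empty. -/
lemma indepFun_coupled (L : ℕ) (A B : Finset (Fin n))
    (hAB : ∀ a ∈ A, ∀ b ∈ B, a ≠ b ∧ a ∉ nearby L b) :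
    IndepFun (fun z (i : A) => E.coupled L i z) (fun z (i : B) => E.coupled L i z)
      E.copyMeasure := by
  have := E.isProbabilityMeasure_map_e
  set c : Fin n → ℕ → Option (Fin n) × ℤ := fun l k => (if k < L then none else some l, time l - k)
    with hc
  set C : Finset (Fin n) → Set (Option (Fin n) × ℤ) := fun A => {i | ∃ l ∈ A, ∃ k, c l k = i}
  have hdisj : Disjoint (C A) (C B) := by
    rw [Set.disjoint_left]
    rintro _ ⟨a, ha, k, rfl⟩ ⟨b, hb, k', h⟩
    obtain ⟨hne, hfar⟩ := hAB a ha b hb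
    simp only [hc, Prod.mk.injEq] at h
    obtain ⟨h1, h2⟩ := h
    split_ifs at h1 with hk' hk
    · refine hfar (mem_nearby.2 ?_)
      simp only [time] at h2
      constructor <;> omega
    · exact hne (Option.some.inj h1).symm
  have hiI : iIndepFun (fun (i : Option (Fin n) × ℤ) (z : Option (Fin n) × ℤ → ℝ) => z i)
      E.copyMeasure :=
    iIndepFun_infinitePi (X := fun _ x => x) (fun _ => measurable_id)
  have hI := indep_iSup_of_disjoint (fun i => (measurable_pi_apply i).comap_le)
    ((iIndepFun_iff_iIndep _ _ _).1 hiI) hdisj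
  rw [IndepFun_iff_Indep]
  have hle : ∀ A : Finset (Fin n), MeasurableSpace.comap (fun z (i : A) => E.coupled L i z)
      MeasurableSpace.pi ≤ ⨆ i ∈ C A, MeasurableSpace.comap
        (fun z : Option (Fin n) × ℤ → ℝ => z i) inferInstance := by
    intro A
    refine Measurable.comap_le ?_
    refine @measurable_pi_lambda _ _ _ (⨆ i ∈ C A, MeasurableSpace.comap
        (fun z : Option (Fin n) × ℤ → ℝ => z i) inferInstance) _ _ fun l => ?_
    refine (E.measurable_g l).comp ?_
    refine @measurable_pi_lambda _ _ _ (⨆ i ∈ C A, MeasurableSpace.comap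
        (fun z : Option (Fin n) × ℤ → ℝ => z i) inferInstance) _ _ fun k => ?_
    refine Measurable.mono (comap_measurable fun z : Option (Fin n) × ℤ → ℝ => z (c l k)) ?_ le_rfl
    exact le_iSup₂_of_le (c l k) ⟨l, l.2, k, rfl⟩ le_rfl
  exact indep_of_indep_of_le_left (indep_of_indep_of_le_right hI (hle B)) (hle A)

omit [IsProbabilityMeasure μ] in
lemma coupled_add_sub (L N : ℕ) (l : Fin n) (z : Option (Fin n) × ℤ → ℝ) :
    E.coupled (L + N) l z - E.coupled L l z = ∑ j ∈ Finset.range N, E.increment (L + j) l z := by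
  simp only [increment, add_assoc]
  exact (Finset.sum_range_sub (fun j => E.coupled (L + j) l z) N).symm

lemma measurePreserving_coupling (l : Fin n) (p : ℕ → Option (Fin n)) :
    MeasurePreserving (fun (z : Option (Fin n) × ℤ → ℝ) (k : ℕ) => z (p k, time l - k))
      E.copyMeasure (Measure.infinitePi fun k : ℕ => μ.map (E.e (time l - k))) := by
  have := E.isProbabilityMeasure_map_e
  refine ⟨measurable_pi_lambda _ fun _ => measurable_pi_apply _, ?_⟩
  rw [copyMeasure, Measure.map_infinitePi_infinitePi_of_inj
    (f := fun k : ℕ => (p k, time l - (k : ℤ))) fun a b h => by simpa using (Prod.ext_iff.1 h).2]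

/-- Both variables are `g l` of sequences with the same law that agree in the recent lags. The
conditional expectation of `g l` given those lags takes the same value on both, so the distance is
at most twice its `L¹` distance from `g l`, which tends to zero by martingale convergence. -/
lemma tendsto_eLpNorm_coupled_sub_full (l : Fin n) (hint : Integrable (fun ω => E.err ω l) μ) :
    Tendsto (fun N => eLpNorm (fun z => E.coupled N l z - E.full z l) 1 E.copyMeasure)
      atTop (𝓝 0) := by
  have := E.isProbabilityMeasure_map_e
  set m : Measure (ℕ → ℝ) := Measure.infinitePi fun k : ℕ => μ.map (E.e (time l - k)) with hm
  set ℱ := Filtration.piLE (X := fun _ : ℕ => ℝ) with hℱ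
  have hf : Integrable (E.g l) m := by
    have h1 : Integrable (E.g l ∘ fun (z : Option (Fin n) × ℤ → ℝ) (k : ℕ) =>
        z (none, time l - k)) E.copyMeasure :=
      ((E.identDistrib_full.comp (measurable_pi_apply l)).integrable_iff).1 hint
    exact ((E.measurePreserving_coupling l fun _ => none).integrable_comp
      (E.measurable_g l).aestronglyMeasurable).1 h1
  have hfm : StronglyMeasurable[⨆ N, ℱ N] (E.g l) := by
    refine (Measurable.mono (E.measurable_g l) ?_ le_rfl).stronglyMeasurable
    refine iSup_le fun k => ?_
    refine le_trans ?_ (le_iSup (fun N => (ℱ N : MeasurableSpace (ℕ → ℝ))) k)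
    have h1 : (fun x : ℕ → ℝ => x k) = (fun y : Set.Iic k → ℝ => y ⟨k, Set.mem_Iic.2 le_rfl⟩) ∘
        Preorder.restrictLe k := rfl
    change MeasurableSpace.comap (fun x : ℕ → ℝ => x k) _ ≤
      MeasurableSpace.comap (Preorder.restrictLe k) MeasurableSpace.pi
    rw [h1, ← MeasurableSpace.comap_comp]
    exact MeasurableSpace.comap_mono (measurable_pi_apply _).comap_le
  have hL := hf.tendsto_eLpNorm_condExp (ℱ := ℱ) hfm
  -- `ℱ N` is generated by the lags `0, …, N`, which are `N + 1` in number; hence the shift by one.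
  rw [← tendsto_add_atTop_iff_nat 1]
  have hL2 : Tendsto (fun N => eLpNorm (m[E.g l | ℱ N] - E.g l) 1 m +
      eLpNorm (m[E.g l | ℱ N] - E.g l) 1 m) atTop (𝓝 0) := by simpa using hL.add hL
  refine tendsto_of_tendsto_of_tendsto_of_le_of_le tendsto_const_nhds hL2 (fun _ => zero_le)
    fun N => ?_
  set h : (ℕ → ℝ) → ℝ := m[E.g l | ℱ N] with hh
  have hhm : StronglyMeasurable[ℱ N] h := stronglyMeasurable_condExp
  have hdep : DependsOn h (Set.Iic N) := hhm.dependsOn_of_piLE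
  have hdm : Measurable (h - E.g l) :=
    (hhm.measurable.mono (ℱ.le N) le_rfl).sub (E.measurable_g l)
  set c1 : (Option (Fin n) × ℤ → ℝ) → ℕ → ℝ := fun z k =>
    z (if k < N + 1 then none else some l, time l - k) with hc1
  set c2 : (Option (Fin n) × ℤ → ℝ) → ℕ → ℝ := fun z k => z (none, time l - k) with hc2
  have hc1m : MeasurePreserving c1 E.copyMeasure m :=
    E.measurePreserving_coupling l fun k => if k < N + 1 then none else some l
  have hc2m : MeasurePreserving c2 E.copyMeasure m := E.measurePreserving_coupling l fun _ => none
  have e : (fun z => E.coupled (N + 1) l z - E.full z l) =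
      ((h - E.g l) ∘ c2) - ((h - E.g l) ∘ c1) := by
    ext z
    have : h (c1 z) = h (c2 z) := hdep fun k hk => by
      have : k ≤ N := hk
      simp [hc1, hc2, this]
    simp only [Pi.sub_apply, Function.comp_apply, this]
    simp only [coupled, full, hc1, hc2]
    ring
  rw [e]
  refine (eLpNorm_sub_le (hdm.comp hc2m.measurable).aestronglyMeasurable
    (hdm.comp hc1m.measurable).aestronglyMeasurable le_rfl).trans ?_
  rw [eLpNorm_comp_measurePreserving hdm.aestronglyMeasurable hc1m,
    eLpNorm_comp_measurePreserving hdm.aestronglyMeasurable hc2m]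

section Bounds

variable {m : ℝ} {k : ℕ}

/-- The largest dependence measure at lag `j`. -/
noncomputable def maxDelta (m : ℝ) (j : ℕ) : ℝ≥0∞ := ⨆ i : Fin n, E.delta m i j

lemma natCast_le_ofReal (hkm : ((2 * k + 2 : ℕ) : ℝ) ≤ m) :
    ((2 * k + 2 : ℕ) : ℝ≥0∞) ≤ ENNReal.ofReal m := by
  rw [← ENNReal.ofReal_natCast]
  exact ENNReal.ofReal_le_ofReal hkm

lemma eLpNorm_increment_le (hkm : ((2 * k + 2 : ℕ) : ℝ) ≤ m) (j : ℕ) (l : Fin n) :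
    eLpNorm (E.increment j l) ((2 * k + 2 : ℕ) : ℝ≥0∞) E.copyMeasure ≤ E.maxDelta m j := by
  calc eLpNorm (E.increment j l) ((2 * k + 2 : ℕ) : ℝ≥0∞) E.copyMeasure
      ≤ eLpNorm (E.increment j l) (ENNReal.ofReal m) E.copyMeasure :=
        eLpNorm_le_eLpNorm_of_exponent_le (natCast_le_ofReal hkm)
          (E.measurable_increment j l).aestronglyMeasurable
    _ = E.delta m l j := ((E.identDistrib_increment j l).eLpNorm_eq _).symm
    _ ≤ E.maxDelta m j := le_iSup (fun i => E.delta m i j) l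

lemma memLp_coupled {p : ℝ≥0∞} {l : Fin n} (h : MemLp (fun ω => E.err ω l) p μ) (j : ℕ) :
    MemLp (E.coupled j l) p E.copyMeasure := (E.identDistrib_coupled j l).memLp_iff.1 h

lemma memLp_full {p : ℝ≥0∞} {l : Fin n} (h : MemLp (fun ω => E.err ω l) p μ) :
    MemLp (fun z => E.full z l) p E.copyMeasure :=
  (E.identDistrib_full.comp (measurable_pi_apply l)).memLp_iff.1 h

lemma eLpNorm_sum_mul_increment_le (hkm : ((2 * k + 2 : ℕ) : ℝ) ≤ m)
    (hL : ∀ l, MemLp (fun ω => E.err ω l) ((2 * k + 2 : ℕ) : ℝ≥0∞) μ) (w : Fin n → ℝ) (j : ℕ)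
    (hj : E.maxDelta m j ≠ ∞) :
    eLpNorm (fun z => ∑ l, w l * E.increment j l z) ((2 * k + 2 : ℕ) : ℝ≥0∞) E.copyMeasure ≤
      ENNReal.ofReal (momentConst k * Real.sqrt (∑ l, w l ^ 2)) * E.maxDelta m j := by
  have h := eLpNorm_sum_le_of_orthogonal (μ := E.copyMeasure) (k := k) (Z := fun l z => w l * E.increment j l z)
    (d := fun l => |w l| * (E.maxDelta m j).toReal)
    (fun l => (((memLp_coupled E (hL l) (j + 1)).sub (memLp_coupled E (hL l) j))).const_mul _)
    (fun l => by positivity) (fun l => ?_)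
    (fun a s hs => E.integral_sum_increment_pow_mul_increment j _ w a s hs) Finset.univ
  · refine h.trans_eq ?_
    have e : ∑ l, (|w l| * (E.maxDelta m j).toReal) ^ 2 =
        (∑ l, w l ^ 2) * (E.maxDelta m j).toReal ^ 2 := by
      rw [Finset.sum_mul]
      exact Finset.sum_congr rfl fun l _ => by rw [mul_pow, sq_abs]
    rw [e, Real.sqrt_mul (Finset.sum_nonneg fun _ _ => sq_nonneg _),
      Real.sqrt_sq ENNReal.toReal_nonneg, ← mul_assoc,
      ENNReal.ofReal_mul (mul_nonneg (momentConst_pos k).le (Real.sqrt_nonneg _)),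
      ENNReal.ofReal_toReal hj]
  · have : (fun z => w l * E.increment j l z) = w l • E.increment j l := rfl
    rw [this, eLpNorm_const_smul, ENNReal.ofReal_mul (abs_nonneg _), ENNReal.ofReal_toReal hj,
      ← Real.norm_eq_abs, ofReal_norm]
    gcongr
    exact E.eLpNorm_increment_le hkm j l

/-- The difference telescopes into increments at the lags `L, L + 1, …`. Orthogonality at each lag
gives the `ℓ²` norm of the weights, and Minkowski's inequality adds the lags. Infinitely many lags
are reached by convergence in measure, under which the norm is lower semicontinuous. -/
lemma eLpNorm_sum_mul_full_sub_coupled_le (hkm : ((2 * k + 2 : ℕ) : ℝ) ≤ m)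
    (hL : ∀ l, MemLp (fun ω => E.err ω l) ((2 * k + 2 : ℕ) : ℝ≥0∞) μ) (w : Fin n → ℝ) (L : ℕ) :
    eLpNorm (fun z => ∑ l, w l * (E.full z l - E.coupled L l z)) ((2 * k + 2 : ℕ) : ℝ≥0∞)
      E.copyMeasure ≤
      ENNReal.ofReal (momentConst k * Real.sqrt (∑ l, w l ^ 2)) * ∑' j, E.maxDelta m (L + j) := by
  have hK : 0 < momentConst k := momentConst_pos k
  have hone : (1 : ℝ≥0∞) ≤ ((2 * k + 2 : ℕ) : ℝ≥0∞) := by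
    exact_mod_cast (by omega : 1 ≤ 2 * k + 2)
  -- For zero weights the right-hand side is `0` even if the sum over the lags is infinite, so this
  -- case is separate; for other weights an infinite sum makes the bound trivial.
  rcases (Real.sqrt_nonneg (∑ l, w l ^ 2)).eq_or_lt with h0 | hpos
  · have hw : ∀ l, w l = 0 := by
      have := (Real.sqrt_eq_zero (Finset.sum_nonneg fun _ _ => sq_nonneg _)).1 h0.symm
      intro l
      have := (Finset.sum_eq_zero_iff_of_nonneg fun _ _ => sq_nonneg _).1 this l (Finset.mem_univ l)
      exact pow_eq_zero_iff (two_ne_zero) |>.1 this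
    simp [hw]
  by_cases htop : ∑' j, E.maxDelta m (L + j) = ∞
  · rw [htop, ENNReal.mul_top]
    · exact le_top
    · simpa using mul_pos hK hpos
  have hfin : ∀ j, E.maxDelta m (L + j) ≠ ∞ := fun j => ENNReal.ne_top_of_tsum_ne_top htop j
  have hcm : ∀ N, Measurable fun z => ∑ l, w l * (E.coupled (L + N) l z - E.coupled L l z) :=
    fun N => Finset.measurable_fun_sum _ fun l _ =>
      ((E.measurable_coupled _ l).sub (E.measurable_coupled _ l)).const_mul _
  have hfm : Measurable fun z => ∑ l, w l * (E.full z l - E.coupled L l z) :=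
    Finset.measurable_fun_sum _ fun l _ =>
      ((E.measurable_full l).sub (E.measurable_coupled _ l)).const_mul _
  refine eLpNorm_le_of_tendstoInMeasure (u := atTop)
    (f := fun N z => ∑ l, w l * (E.coupled (L + N) l z - E.coupled L l z))
    (Eventually.of_forall fun N => ?_)
    (tendstoInMeasure_of_tendsto_eLpNorm one_ne_zero (fun N => (hcm N).aestronglyMeasurable)
      hfm.aestronglyMeasurable ?_) fun N => (hcm N).aestronglyMeasurable
  · have e : (fun z => ∑ l, w l * (E.coupled (L + N) l z - E.coupled L l z)) =
        ∑ j ∈ Finset.range N, fun z => ∑ l, w l * E.increment (L + j) l z := by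
      ext z
      simp only [coupled_add_sub, Finset.sum_apply, Finset.mul_sum]
      exact Finset.sum_comm
    rw [e]
    calc _ ≤ ∑ j ∈ Finset.range N, eLpNorm (fun z => ∑ l, w l * E.increment (L + j) l z)
          ((2 * k + 2 : ℕ) : ℝ≥0∞) E.copyMeasure :=
          eLpNorm_sum_le (fun j _ => (Finset.measurable_fun_sum _ fun l _ =>
            (E.measurable_increment _ l).const_mul _).aestronglyMeasurable) hone
      _ ≤ ∑ j ∈ Finset.range N, ENNReal.ofReal (momentConst k * Real.sqrt (∑ l, w l ^ 2)) *
          E.maxDelta m (L + j) := Finset.sum_le_sum fun j _ =>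
            E.eLpNorm_sum_mul_increment_le hkm hL w _ (hfin j)
      _ ≤ _ := by
          rw [← Finset.mul_sum]
          gcongr
          exact ENNReal.sum_le_tsum _
  · have hbound : ∀ N, eLpNorm ((fun z => ∑ l, w l * (E.coupled (L + N) l z - E.coupled L l z)) -
        fun z => ∑ l, w l * (E.full z l - E.coupled L l z)) 1 E.copyMeasure ≤
        ∑ l, ‖w l‖ₑ * eLpNorm (fun z => E.coupled (L + N) l z - E.full z l) 1 E.copyMeasure := by
      intro N
      have e : ((fun z => ∑ l, w l * (E.coupled (L + N) l z - E.coupled L l z)) -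
        fun z => ∑ l, w l * (E.full z l - E.coupled L l z)) =
          ∑ l, w l • fun z => E.coupled (L + N) l z - E.full z l := by
        ext z
        simp only [Pi.sub_apply, Finset.sum_apply, Pi.smul_apply, smul_eq_mul,
          ← Finset.sum_sub_distrib]
        exact Finset.sum_congr rfl fun l _ => by ring
      rw [e]
      refine (eLpNorm_sum_le (fun l _ => (((E.measurable_coupled _ l).sub
        (E.measurable_full l)).const_smul _).aestronglyMeasurable) le_rfl).trans_eq ?_
      exact Finset.sum_congr rfl fun l _ => by rw [eLpNorm_const_smul]; rfl
    refine tendsto_of_tendsto_of_tendsto_of_le_of_le tendsto_const_nhds ?_ (fun _ => zero_le) hbound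
    have : Tendsto (fun N => ∑ l, ‖w l‖ₑ *
        eLpNorm (fun z => E.coupled (L + N) l z - E.full z l) 1 E.copyMeasure) atTop
        (𝓝 (∑ l, ‖w l‖ₑ * 0)) := by
      refine tendsto_finsetSum _ fun l _ => ENNReal.Tendsto.const_mul ?_ (Or.inr (by simp))
      have h1 := E.tendsto_eLpNorm_coupled_sub_full l ((hL l).integrable hone)
      exact h1.comp (tendsto_atTop_mono (fun N => Nat.le_add_left N L) tendsto_id)
    simpa using this

end Bounds

end ErrorProcess

/-! ### Second-moment inequalities -/

section SecondMoments

variable {Ω : Type*} [MeasurableSpace Ω] {μ : Measure Ω}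

/-- Cauchy–Schwarz from the weighted inequality between arithmetic and geometric means. The bounds
are enlarged by `ε`, which then tends to zero, because `a` or `b` may vanish and both occur in
denominators. -/
lemma integral_abs_mul_abs_le {f g : Ω → ℝ} (hf : MemLp f 2 μ) (hg : MemLp g 2 μ) {a b : ℝ}
    (ha : 0 ≤ a) (hb : 0 ≤ b) (hfa : ∫ ω, f ω ^ 2 ∂μ ≤ a ^ 2) (hgb : ∫ ω, g ω ^ 2 ∂μ ≤ b ^ 2) :
    ∫ ω, |f ω| * |g ω| ∂μ ≤ a * b := by
  have key : ∀ ε : ℝ, 0 < ε → ∫ ω, |f ω| * |g ω| ∂μ ≤ (a + ε) * (b + ε) := by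
    intro ε hε
    have hA : 0 < a + ε := by linarith
    have hB : 0 < b + ε := by linarith
    have h1 : ∫ ω, |f ω| * |g ω| ∂μ ≤
        ∫ ω, ((b + ε) / (2 * (a + ε)) * f ω ^ 2 + (a + ε) / (2 * (b + ε)) * g ω ^ 2) ∂μ := by
      refine integral_mono (hf.abs.integrable_mul hg.abs)
        ((hf.integrable_sq.const_mul _).add (hg.integrable_sq.const_mul _)) fun ω => ?_
      have : (b + ε) / (2 * (a + ε)) * f ω ^ 2 + (a + ε) / (2 * (b + ε)) * g ω ^ 2 -
          |f ω| * |g ω| = ((b + ε) * |f ω| - (a + ε) * |g ω|) ^ 2 / (2 * (a + ε) * (b + ε)) := by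
        rw [← sq_abs (f ω), ← sq_abs (g ω)]
        field_simp
        ring
      have h2 : 0 ≤ ((b + ε) * |f ω| - (a + ε) * |g ω|) ^ 2 / (2 * (a + ε) * (b + ε)) := by
        positivity
      dsimp only
      linarith
    rw [integral_add (hf.integrable_sq.const_mul _) (hg.integrable_sq.const_mul _),
      integral_const_mul, integral_const_mul] at h1
    calc _ ≤ _ := h1
      _ ≤ (b + ε) / (2 * (a + ε)) * (a + ε) ^ 2 + (a + ε) / (2 * (b + ε)) * (b + ε) ^ 2 := by
          gcongr
          · exact hfa.trans (by gcongr; linarith)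
          · exact hgb.trans (by gcongr; linarith)
      _ = _ := by field_simp; ring
  have hlim : Tendsto (fun ε : ℝ => (a + ε) * (b + ε)) (𝓝[>] 0) (𝓝 ((a + 0) * (b + 0))) :=
    (Continuous.tendsto (by fun_prop) 0).mono_left nhdsWithin_le_nhds
  have := ge_of_tendsto hlim (by filter_upwards [self_mem_nhdsWithin] with ε hε using key ε hε)
  simpa using this

lemma integral_abs_le_of_integral_sq_le [IsProbabilityMeasure μ] {f : Ω → ℝ} (hf : MemLp f 2 μ)
    {a : ℝ} (ha : 0 ≤ a) (hfa : ∫ ω, f ω ^ 2 ∂μ ≤ a ^ 2) : ∫ ω, |f ω| ∂μ ≤ a := by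
  have := integral_abs_mul_abs_le hf (memLp_const (1 : ℝ)) ha zero_le_one hfa (by simp)
  simpa using this

lemma abs_exp_neg_sub_exp_neg_le {u v : ℝ} (hu : 0 ≤ u) (hv : 0 ≤ v) :
    |Real.exp (-u) - Real.exp (-v)| ≤ |u - v| := by
  wlog h : u ≤ v generalizing u v
  · rw [abs_sub_comm, abs_sub_comm u]
    exact this hv hu (le_of_not_ge h)
  have h1 : Real.exp (-v) ≤ Real.exp (-u) := Real.exp_le_exp.2 (by linarith)
  rw [abs_of_nonneg (by linarith), abs_of_nonpos (by linarith)]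
  have h2 : Real.exp (-v) = Real.exp (-u) * Real.exp (u - v) := by
    rw [← Real.exp_add]; ring_nf
  have h3 := Real.add_one_le_exp (u - v)
  have h4 : Real.exp (-u) ≤ 1 := Real.exp_le_one_iff.2 (by linarith)
  have h5 := Real.exp_pos (-u)
  have h6 : Real.exp (-u) * (u - v + 1) ≤ Real.exp (-v) := by
    rw [h2]; exact mul_le_mul_of_nonneg_left h3 h5.le
  nlinarith

end SecondMoments

/-! ### Moment inequality and central limit theorem for weighted sums of errors -/

namespace ErrorProcess

variable {n : ℕ} {Ω : Type*} [MeasurableSpace Ω] {μ : Measure Ω} [IsProbabilityMeasure μ]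
  (E : ErrorProcess n μ) {m : ℝ} {k : ℕ}

omit [IsProbabilityMeasure μ] in
lemma measurable_err (l : Fin n) : Measurable fun ω => E.err ω l :=
  (E.measurable_g l).comp (measurable_pi_lambda _ fun _ => E.measurable_e _)

lemma memLp_err {B : ℝ≥0} (hB : ∀ l, eLpNorm (fun ω => E.err ω l) (ENNReal.ofReal m) μ ≤ B)
    {p : ℝ≥0∞} (hp : p ≤ ENNReal.ofReal m) (l : Fin n) : MemLp (fun ω => E.err ω l) p μ :=
  MemLp.mono_exponent ⟨(E.measurable_err l).aestronglyMeasurable,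
    (hB l).trans_lt ENNReal.coe_lt_top⟩ hp

/-- At range 0 every error is computed from its own copy alone. The terms are independent and
centred, so the orthogonality hypothesis holds by factorizing the expectation. -/
lemma eLpNorm_sum_mul_coupled_zero_le (hkm : ((2 * k + 2 : ℕ) : ℝ) ≤ m)
    (hmean : ∀ l, ∫ ω, E.err ω l ∂μ = 0) {B : ℝ≥0}
    (hB : ∀ l, eLpNorm (fun ω => E.err ω l) (ENNReal.ofReal m) μ ≤ B) (w : Fin n → ℝ) :
    eLpNorm (fun z => ∑ l, w l * E.coupled 0 l z) ((2 * k + 2 : ℕ) : ℝ≥0∞) E.copyMeasure ≤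
      ENNReal.ofReal (momentConst k * Real.sqrt (∑ l, w l ^ 2)) * B := by
  have hq := natCast_le_ofReal hkm
  have h := eLpNorm_sum_le_of_orthogonal (μ := E.copyMeasure) (k := k)
    (Z := fun l z => w l * E.coupled 0 l z) (d := fun l => |w l| * (B : ℝ))
    (fun l => (E.memLp_coupled (E.memLp_err hB hq l) 0).const_mul _)
    (fun l => by positivity) (fun l => ?_) (fun a s hs => ?_) Finset.univ
  · refine h.trans_eq ?_
    have e : ∑ l, (|w l| * (B : ℝ)) ^ 2 = (∑ l, w l ^ 2) * (B : ℝ) ^ 2 := by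
      rw [Finset.sum_mul]
      exact Finset.sum_congr rfl fun l _ => by rw [mul_pow, sq_abs]
    rw [e, Real.sqrt_mul (Finset.sum_nonneg fun _ _ => sq_nonneg _),
      Real.sqrt_sq B.coe_nonneg, ← mul_assoc,
      ENNReal.ofReal_mul (mul_nonneg (momentConst_pos k).le (Real.sqrt_nonneg _)),
      ENNReal.ofReal_coe_nnreal]
  · have : (fun z => w l * E.coupled 0 l z) = w l • E.coupled 0 l := rfl
    rw [this, eLpNorm_const_smul, ENNReal.ofReal_mul (abs_nonneg _), ENNReal.ofReal_coe_nnreal,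
      ← Real.norm_eq_abs, ofReal_norm, ← (E.identDistrib_coupled 0 l).eLpNorm_eq]
    gcongr
    exact (eLpNorm_le_eLpNorm_of_exponent_le hq (E.measurable_err l).aestronglyMeasurable).trans
      (hB l)
  · have hi := E.indepFun_coupled 0 s {a} fun x hx b hb => by
      rw [Finset.mem_singleton] at hb
      refine ⟨(hb ▸ hs x hx).ne', fun h => ?_⟩
      rw [mem_nearby] at h
      omega
    have h2 := hi.comp (φ := fun x : s → ℝ => (∑ l : s, w l * x l) ^ (2 * k + 1))
      (ψ := fun x : ({a} : Finset (Fin n)) → ℝ => ∑ l : ({a} : Finset (Fin n)), w l * x l) (by fun_prop) (by fun_prop)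
    have e1 : ∀ z, ((fun x : s → ℝ => (∑ l : s, w l * x l) ^ (2 * k + 1)) ∘
        fun z (i : s) => E.coupled 0 i z) z = (∑ l ∈ s, w l * E.coupled 0 l z) ^ (2 * k + 1) :=
      fun z => congrArg (· ^ (2 * k + 1)) (Finset.sum_coe_sort s fun l => w l * E.coupled 0 l z)
    have e2 : ∀ z, ((fun x : ({a} : Finset (Fin n)) → ℝ => ∑ l : ({a} : Finset (Fin n)), w l * x l) ∘
        fun z (i : ({a} : Finset (Fin n))) => E.coupled 0 i z) z = w a * E.coupled 0 a z :=
      fun z => by simp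
    have h3 := (h2.congr (ae_of_all _ e1) (ae_of_all _ e2)).integral_fun_mul_eq_mul_integral
      ((Finset.measurable_fun_sum s fun l _ =>
        (E.measurable_coupled 0 l).const_mul _).pow_const _).aestronglyMeasurable
      ((E.measurable_coupled 0 a).const_mul _).aestronglyMeasurable
    rw [h3, integral_const_mul, ← (E.identDistrib_coupled 0 a).integral_eq, hmean]
    simp

/-- Moment inequality for weighted sums of the errors. -/
theorem eLpNorm_sum_mul_err_le (hkm : ((2 * k + 2 : ℕ) : ℝ) ≤ m)
    (hmean : ∀ l, ∫ ω, E.err ω l ∂μ = 0) {B : ℝ≥0}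
    (hB : ∀ l, eLpNorm (fun ω => E.err ω l) (ENNReal.ofReal m) μ ≤ B) (w : Fin n → ℝ) :
    eLpNorm (fun ω => ∑ l, w l * E.err ω l) ((2 * k + 2 : ℕ) : ℝ≥0∞) μ ≤
      ENNReal.ofReal (momentConst k * Real.sqrt (∑ l, w l ^ 2)) *
        (B + ∑' j, E.maxDelta m j) := by
  have hq := natCast_le_ofReal hkm
  have hid : IdentDistrib (fun ω => ∑ l, w l * E.err ω l) (fun z => ∑ l, w l * E.full z l) μ
      E.copyMeasure :=
    E.identDistrib_full.comp (u := fun x : Fin n → ℝ => ∑ l, w l * x l) (by fun_prop)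
  have hone : (1 : ℝ≥0∞) ≤ ((2 * k + 2 : ℕ) : ℝ≥0∞) := by
    exact_mod_cast (by omega : 1 ≤ 2 * k + 2)
  have e : (fun z => ∑ l, w l * E.full z l) = (fun z => ∑ l, w l * E.coupled 0 l z) +
      fun z => ∑ l, w l * (E.full z l - E.coupled 0 l z) := by
    ext z
    rw [Pi.add_apply, ← Finset.sum_add_distrib]
    exact Finset.sum_congr rfl fun l _ => by ring
  rw [hid.eLpNorm_eq, e, mul_add]
  refine (eLpNorm_add_le (Finset.measurable_fun_sum _ fun l _ =>
    (E.measurable_coupled 0 l).const_mul _).aestronglyMeasurable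
    (Finset.measurable_fun_sum _ fun l _ => ((E.measurable_full l).sub
      (E.measurable_coupled 0 l)).const_mul _).aestronglyMeasurable hone).trans (add_le_add ?_ ?_)
  · exact E.eLpNorm_sum_mul_coupled_zero_le hkm hmean hB w
  · simpa using E.eLpNorm_sum_mul_full_sub_coupled_le hkm (E.memLp_err hB hq) w 0

/-- Quantitative central limit theorem for weighted sums of the errors. -/
theorem norm_integral_cis_sum_mul_err_sub_le (hm : 3 ≤ m)
    (hmean : ∀ l, ∫ ω, E.err ω l ∂μ = 0) {B : ℝ≥0}
    (hB : ∀ l, eLpNorm (fun ω => E.err ω l) (ENNReal.ofReal m) μ ≤ B) {D τ : ℝ≥0}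
    (hD : B + ∑' j, E.maxDelta m j ≤ D) {L : ℕ} (hL : 1 ≤ L)
    (hτ : ∑' j, E.maxDelta m (L + j) ≤ τ) (w : Fin n → ℝ) {W c : ℝ} (hW : 0 ≤ W)
    (hwW : Real.sqrt (∑ l, w l ^ 2) ≤ W) (hc : 0 ≤ c) (hwc : ∀ l, |w l| ≤ c) (hτD : τ ≤ D) :
    ‖(∫ ω, cis (∑ l, w l * E.err ω l) ∂μ) -
        Complex.exp (-((∫ ω, (∑ l, w l * E.err ω l) ^ 2 ∂μ) / 2 : ℝ))‖ ≤
      (momentConst 0 * W + 3 / 2 * (momentConst 0 * W) ^ 2 * D) * τ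
        + 6 * (4 * L) ^ 3 * (c * W ^ 2 * B ^ 3) := by
  have hK := momentConst_pos 0
  have hkm : ((2 * 0 + 2 : ℕ) : ℝ) ≤ m := by norm_num; linarith
  have hq := natCast_le_ofReal hkm
  have h2e : ((2 * 0 + 2 : ℕ) : ℝ≥0∞) = 2 := by norm_num
  have hwW2 : ∑ l, w l ^ 2 ≤ W ^ 2 := by
    rw [← Real.sq_sqrt (Finset.sum_nonneg fun l _ => sq_nonneg (w l))]
    gcongr
  set R : ℝ := momentConst 0 * W with hR
  have hR0 : 0 ≤ R := by positivity
  set ν := E.copyMeasure with hν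
  set U : (Option (Fin n) × ℤ → ℝ) → ℝ := fun z => ∑ l, w l * E.full z l with hU
  set V : (Option (Fin n) × ℤ → ℝ) → ℝ := fun z => ∑ l, w l * E.coupled L l z with hV
  have hUm : Measurable U := Finset.measurable_fun_sum _ fun l _ => (E.measurable_full l).const_mul _
  have hVm : Measurable V :=
    Finset.measurable_fun_sum _ fun l _ => (E.measurable_coupled L l).const_mul _
  have hid : IdentDistrib (fun ω => ∑ l, w l * E.err ω l) U μ ν :=
    E.identDistrib_full.comp (u := fun x : Fin n → ℝ => ∑ l, w l * x l) (by fun_prop)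
  have herr2 := E.memLp_err hB hq
  have hU2 : MemLp U 2 ν := by
    rw [← h2e]; exact memLp_finsetSum _ fun l _ => (E.memLp_full (herr2 l)).const_mul _
  have hV2 : MemLp V 2 ν := by
    rw [← h2e]; exact memLp_finsetSum _ fun l _ => (E.memLp_coupled (herr2 l) L).const_mul _
  -- second moments of `U` and of `U - V`
  have hofR : ENNReal.ofReal (momentConst 0 * Real.sqrt (∑ l, w l ^ 2)) ≤ ENNReal.ofReal R := by
    refine ENNReal.ofReal_le_ofReal ?_
    rw [hR]; gcongr
  have hUsq : ∫ z, U z ^ 2 ∂ν ≤ (R * D) ^ 2 := by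
    refine integral_pow_even_le_of_eLpNorm_le (k := 0) (by positivity) (by rwa [h2e]) ?_
    rw [← hid.eLpNorm_eq, ENNReal.ofReal_mul hR0, ENNReal.ofReal_coe_nnreal]
    exact (E.eLpNorm_sum_mul_err_le hkm hmean hB w).trans (mul_le_mul' hofR hD)
  have hUVsq : ∫ z, (U - V) z ^ 2 ∂ν ≤ (R * τ) ^ 2 := by
    refine integral_pow_even_le_of_eLpNorm_le (k := 0) (by positivity)
      (by rw [h2e]; exact hU2.sub hV2) ?_
    rw [ENNReal.ofReal_mul hR0, ENNReal.ofReal_coe_nnreal]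
    have e : U - V = fun z => ∑ l, w l * (E.full z l - E.coupled L l z) := by
      ext z
      simp only [hU, hV, Pi.sub_apply, ← Finset.sum_sub_distrib]
      exact Finset.sum_congr rfl fun l _ => by ring
    rw [e]
    exact (E.eLpNorm_sum_mul_full_sub_coupled_le hkm herr2 w L).trans (mul_le_mul' hofR hτ)
  have h1 : ‖(∫ z, cis (U z) ∂ν) - ∫ z, cis (V z) ∂ν‖ ≤ R * τ := by
    have hci : ∀ {T : (Option (Fin n) × ℤ → ℝ) → ℝ}, Measurable T →
        Integrable (fun z => cis (T z)) ν := fun hT =>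
      Integrable.of_bound (measurable_cis.comp hT).aestronglyMeasurable 1
        (ae_of_all _ fun z => by simp)
    rw [← integral_sub (hci hUm) (hci hVm)]
    refine (norm_integral_le_of_norm_le ((hU2.sub hV2).integrable one_le_two).abs
      (ae_of_all _ fun z => norm_cis_sub_cis_le _ _)).trans ?_
    exact integral_abs_le_of_integral_sq_le (hU2.sub hV2) (by positivity) hUVsq
  -- From `U² - V² = 2 (U - V) U - (U - V)²` the second moments differ by at most `2 (R τ) (R D) +
  -- (R τ)²`, and `τ ≤ D` makes this linear in `τ`.
  have h2 : |(∫ z, U z ^ 2 ∂ν) - ∫ z, V z ^ 2 ∂ν| ≤ 3 * R ^ 2 * D * τ := by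
    have hUV := hU2.sub hV2
    have i1 : Integrable (fun z => |(U - V) z| * |U z|) ν := hUV.abs.integrable_mul hU2.abs
    have i2 : Integrable (fun z => |(U - V) z| * |(U - V) z|) ν := hUV.abs.integrable_mul hUV.abs
    rw [← integral_sub hU2.integrable_sq hV2.integrable_sq]
    calc |∫ z, (U z ^ 2 - V z ^ 2) ∂ν|
        ≤ ∫ z, (2 * (|(U - V) z| * |U z|) + |(U - V) z| * |(U - V) z|) ∂ν := by
          rw [← Real.norm_eq_abs]
          refine norm_integral_le_of_norm_le ((i1.const_mul 2).add i2) (ae_of_all _ fun z => ?_)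
          have e : U z ^ 2 - V z ^ 2 = 2 * ((U - V) z * U z) - (U - V) z * (U - V) z := by
            simp only [Pi.sub_apply]; ring
          rw [e, Real.norm_eq_abs]
          refine (abs_sub _ _).trans_eq ?_
          rw [abs_mul, abs_mul, abs_mul, abs_two]
      _ ≤ 2 * (R * τ * (R * D)) + R * τ * (R * τ) := by
          rw [integral_add (i1.const_mul 2) i2, integral_const_mul]
          gcongr
          · exact integral_abs_mul_abs_le hUV hU2 (by positivity) (by positivity) hUVsq hUsq
          · exact integral_abs_mul_abs_le hUV hUV (by positivity) (by positivity) hUVsq hUVsq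
      _ ≤ 2 * (R * τ * (R * D)) + R * τ * (R * D) := by gcongr
      _ = _ := by ring
  have h3 : ‖(∫ z, cis (V z) ∂ν) - Complex.exp (-((∫ z, V z ^ 2 ∂ν) / 2 : ℝ))‖ ≤
      6 * (4 * L) ^ 3 * (c * W ^ 2 * B ^ 3) := by
    have hthree : ∀ l, MemLp (E.coupled L l) 3 ν ∧ ∫ z, |E.coupled L l z| ^ 3 ∂ν ≤ B ^ 3 := by
      intro l
      have h3m : (3 : ℝ≥0∞) ≤ ENNReal.ofReal m := by
        rw [show (3 : ℝ≥0∞) = ENNReal.ofReal 3 by simp]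
        exact ENNReal.ofReal_le_ofReal hm
      have hmem := E.memLp_coupled (E.memLp_err hB h3m l) L
      refine ⟨hmem, ?_⟩
      have hn : eLpNorm (E.coupled L l) 3 ν ≤ B := by
        rw [← (E.identDistrib_coupled L l).eLpNorm_eq]
        exact (eLpNorm_le_eLpNorm_of_exponent_le h3m
          (E.measurable_err l).aestronglyMeasurable).trans (hB l)
      rw [hmem.eLpNorm_eq_integral_rpow_norm (by simp) (by simp)] at hn
      rw [← ENNReal.ofReal_coe_nnreal, ENNReal.ofReal_le_ofReal_iff B.coe_nonneg] at hn
      have h0 : 0 ≤ ∫ z, ‖E.coupled L l z‖ ^ 3 ∂ν := integral_nonneg fun z => by positivity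
      have e3 : ((3 : ℝ≥0∞).toReal) = ((3 : ℕ) : ℝ) := by simp
      rw [e3] at hn
      simp only [Real.rpow_natCast] at hn
      calc ∫ z, |E.coupled L l z| ^ 3 ∂ν
          = ((∫ z, ‖E.coupled L l z‖ ^ 3 ∂ν) ^ (((3 : ℕ) : ℝ)⁻¹)) ^ 3 := by
            rw [Real.rpow_inv_natCast_pow h0 (by norm_num)]; rfl
        _ ≤ (B : ℝ) ^ 3 := by gcongr
    have e3 : ∀ l z, |w l * E.coupled L l z| ^ 3 = |w l| ^ 3 * |E.coupled L l z| ^ 3 := fun l z => by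
      rw [abs_mul, mul_pow]
    have hmain := norm_integral_cis_sum_sub_le (μ := ν) (X := fun l z => w l * E.coupled L l z) hL
      (fun l => (E.measurable_coupled L l).const_mul _) (fun l => by
        simp only [e3]
        exact ((hthree l).1.integrable_norm_pow (p := 3) (by norm_num)).const_mul _)
      (fun l => by rw [integral_const_mul, ← (E.identDistrib_coupled L l).integral_eq, hmean,
        mul_zero])
      (fun A A' hAA => by
        have h := E.indepFun_coupled L A A' fun a ha b hb => ⟨fun hab => by
          refine hAA a ha b hb ?_
          rw [hab, mem_nearby]; omega, hAA a ha b hb⟩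
        exact h.comp (φ := fun (x : A → ℝ) (i : A) => w i * x i) (ψ := fun (x : A' → ℝ) (i : A') => w i * x i)
          (by fun_prop) (by fun_prop))
    refine hmain.trans ?_
    gcongr
    calc ∑ l, ∫ z, |w l * E.coupled L l z| ^ 3 ∂ν
        ≤ ∑ l, (c * w l ^ 2) * (B : ℝ) ^ 3 := by
          refine Finset.sum_le_sum fun l _ => ?_
          simp only [e3]
          rw [integral_const_mul]
          -- The largest weight enters here: the sum of the cubes is at most the maximum times the
          -- sum of the squares.
          have : |w l| ^ 3 ≤ c * w l ^ 2 := by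
            rw [pow_succ, sq_abs, mul_comm]
            exact mul_le_mul_of_nonneg_right (hwc l) (sq_nonneg _)
          exact mul_le_mul this (hthree l).2 (integral_nonneg fun z => by positivity)
            ((by positivity : (0 : ℝ) ≤ |w l| ^ 3).trans this)
      _ = c * (∑ l, w l ^ 2) * (B : ℝ) ^ 3 := by rw [← Finset.sum_mul, Finset.mul_sum]
      _ ≤ c * W ^ 2 * (B : ℝ) ^ 3 := by
          gcongr
  have e1 : ∫ ω, cis (∑ l, w l * E.err ω l) ∂μ = ∫ z, cis (U z) ∂ν :=
    (hid.comp measurable_cis).integral_eq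
  have e2 : ∫ ω, (∑ l, w l * E.err ω l) ^ 2 ∂μ = ∫ z, U z ^ 2 ∂ν := hid.sq.integral_eq
  rw [e1, e2]
  have h4 : ‖Complex.exp (-((∫ z, V z ^ 2 ∂ν) / 2 : ℝ)) -
      Complex.exp (-((∫ z, U z ^ 2 ∂ν) / 2 : ℝ))‖ ≤ 3 / 2 * R ^ 2 * D * τ := by
    rw [← Complex.ofReal_neg, ← Complex.ofReal_neg, ← Complex.ofReal_exp, ← Complex.ofReal_exp,
      ← Complex.ofReal_sub, Complex.norm_real, Real.norm_eq_abs]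
    refine (abs_exp_neg_sub_exp_neg_le (div_nonneg (integral_nonneg fun z => sq_nonneg _) two_pos.le)
      (div_nonneg (integral_nonneg fun z => sq_nonneg _) two_pos.le)).trans ?_
    rw [← sub_div, abs_div, abs_two, abs_sub_comm]
    linarith
  calc _ ≤ ‖(∫ z, cis (U z) ∂ν) - ∫ z, cis (V z) ∂ν‖ +
        ‖(∫ z, cis (V z) ∂ν) - Complex.exp (-((∫ z, V z ^ 2 ∂ν) / 2 : ℝ))‖ +
        ‖Complex.exp (-((∫ z, V z ^ 2 ∂ν) / 2 : ℝ)) -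
          Complex.exp (-((∫ z, U z ^ 2 ∂ν) / 2 : ℝ))‖ := by
        refine le_trans (le_of_eq ?_) norm_add₃_le
        congr 1; ring
    _ ≤ R * τ + 6 * (4 * L) ^ 3 * (c * W ^ 2 * B ^ 3) + 3 / 2 * R ^ 2 * D * τ :=
        add_le_add (add_le_add h1 h3) h4
    _ = _ := by ring

end ErrorProcess

/-! ### Uniform convergence of distribution functions -/

section DistributionFunctions

/-- **Pólya's theorem**: pointwise convergence of monotone functions with values in `[0, 1]` to a
continuous distribution function is uniform. -/
lemma tendstoUniformly_of_tendsto_of_monotone {Fs : ℕ → ℝ → ℝ} {F : ℝ → ℝ} (hFs : ∀ k, Monotone (Fs k))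
    (h0 : ∀ k x, 0 ≤ Fs k x) (h1 : ∀ k x, Fs k x ≤ 1) (hF : Monotone F) (hFc : Continuous F)
    (hbot : Tendsto F atBot (𝓝 0)) (htop : Tendsto F atTop (𝓝 1))
    (hlim : ∀ x, Tendsto (fun k => Fs k x) atTop (𝓝 (F x))) : TendstoUniformly Fs F atTop := by
  have hF0 : ∀ x, 0 ≤ F x := fun x => ge_of_tendsto' (hlim x) fun k => h0 k x
  have hF1 : ∀ x, F x ≤ 1 := fun x => le_of_tendsto' (hlim x) fun k => h1 k x
  -- Near `x` all functions are squeezed, by monotonicity, between their values at two endpoints,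
  -- where they converge. Compactness extends this to an interval `[a, b]`; outside it `F` is within
  -- `ε / 2` of 0 or 1.
  have hloc : TendstoLocallyUniformly Fs F atTop := by
    rw [Metric.tendstoLocallyUniformly_iff]
    intro ε hε x
    obtain ⟨δ, hδ, hδF⟩ := Metric.continuousAt_iff.1 hFc.continuousAt (ε / 4) (by positivity)
    refine ⟨Set.Icc (x - δ / 2) (x + δ / 2), Icc_mem_nhds (by linarith) (by linarith), ?_⟩
    have hu := Metric.tendsto_nhds.1 (hlim (x - δ / 2)) (ε / 4) (by positivity)
    have hv := Metric.tendsto_nhds.1 (hlim (x + δ / 2)) (ε / 4) (by positivity)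
    have du : dist (F (x - δ / 2)) (F x) < ε / 4 := hδF (by
      rw [Real.dist_eq, abs_lt]; constructor <;> linarith)
    have dv : dist (F (x + δ / 2)) (F x) < ε / 4 := hδF (by
      rw [Real.dist_eq, abs_lt]; constructor <;> linarith)
    filter_upwards [hu, hv] with k hku hkv y hy
    rw [Real.dist_eq, abs_lt] at *
    have a1 := hFs k hy.1
    have a2 := hFs k hy.2
    have a3 := hF hy.1
    have a4 := hF hy.2
    constructor <;> linarith [hku.1, hku.2, hkv.1, hkv.2, du.1, du.2, dv.1, dv.2]
  rw [Metric.tendstoUniformly_iff]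
  intro ε hε
  obtain ⟨a, ha⟩ := (hbot.eventually (gt_mem_nhds (show (0 : ℝ) < ε / 2 by positivity))).exists
  obtain ⟨b, hb⟩ := (htop.eventually (lt_mem_nhds (show 1 - ε / 2 < 1 by linarith))).exists
  have hK := Metric.tendstoUniformlyOn_iff.1
    ((tendstoLocallyUniformlyOn_iff_tendstoUniformlyOn_of_compact isCompact_Icc).1
      (hloc.tendstoLocallyUniformlyOn (s := Set.Icc a b))) ε hε
  have hu := Metric.tendsto_nhds.1 (hlim a) (ε / 2) (by positivity)
  have hv := Metric.tendsto_nhds.1 (hlim b) (ε / 2) (by positivity)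
  filter_upwards [hK, hu, hv] with k hk hku hkv x
  rcases lt_or_ge x a with hxa | hxa
  · rw [Real.dist_eq, abs_lt] at *
    have := hFs k hxa.le
    have := hF hxa.le
    constructor <;> linarith [h0 k x, hF0 x, hku.1, hku.2]
  rcases lt_or_ge b x with hxb | hxb
  · rw [Real.dist_eq, abs_lt] at *
    have := hFs k hxb.le
    have := hF hxb.le
    constructor <;> linarith [h1 k x, hF1 x, hkv.1, hkv.2]
  · exact hk x ⟨hxa, hxb⟩

lemma continuous_cdf_of_noAtoms (P : Measure ℝ) [IsProbabilityMeasure P] (hP : ∀ x, P {x} = 0) :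
    Continuous (cdf P) := by
  rw [continuous_iff_continuousAt]
  intro x
  rw [(monotone_cdf P).continuousAt_iff_leftLim_eq_rightLim, (cdf P).rightLim_eq]
  have h := (cdf P).measure_singleton x
  rw [measure_cdf, hP, eq_comm, ENNReal.ofReal_eq_zero] at h
  exact le_antisymm ((monotone_cdf P).leftLim_le le_rfl) (by linarith)

lemma monotone_measureReal_le {Ω : Type*} [MeasurableSpace Ω] (P : Measure Ω)
    [IsFiniteMeasure P] (T : Ω → ℝ) : Monotone fun x => P.real {ω | T ω ≤ x} :=
  fun _ _ hab => measureReal_mono fun _ hω => le_trans hω hab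

lemma tendsto_iSup_abs_sub {F G : ℕ → ℝ → ℝ} {H : ℝ → ℝ} {l : Filter ℕ}
    (hF : TendstoUniformly F H l) (hG : TendstoUniformly G H l) :
    Tendsto (fun k => ⨆ x : ℝ, |F k x - G k x|) l (𝓝 0) := by
  rw [Metric.tendsto_nhds]
  intro ε hε
  filter_upwards [Metric.tendstoUniformly_iff.1 hF (ε / 4) (by positivity),
    Metric.tendstoUniformly_iff.1 hG (ε / 4) (by positivity)] with k h1 h2
  have h3 : ⨆ x : ℝ, |F k x - G k x| ≤ ε / 2 := by
    refine Real.iSup_le (fun x => ?_) (by positivity)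
    have a1 := h1 x
    have a2 := h2 x
    rw [Real.dist_eq, abs_lt] at a1 a2
    rw [abs_le]
    constructor <;> linarith [a1.1, a1.2, a2.1, a2.2]
  have h4 : 0 ≤ ⨆ x : ℝ, |F k x - G k x| := Real.iSup_nonneg fun x => abs_nonneg _
  rw [Real.dist_eq, sub_zero, abs_of_nonneg h4]
  linarith

end DistributionFunctions

/-! ### The maximum of a Gaussian vector has no atoms -/

section GaussianMaximum

variable {d : ℕ}

/-- The maximum norm on `EuclideanSpace ℝ (Fin d)`. -/
noncomputable def maxAbs (ξ : EuclideanSpace ℝ (Fin d)) : ℝ := ‖WithLp.ofLp ξ‖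

lemma continuous_maxAbs : Continuous (maxAbs (d := d)) := by unfold maxAbs; fun_prop

/-- `V` may be singular as long as one variance is positive. Then `ξ i ≠ 0` almost surely, so the
maximum is attained at a nonzero coordinate `j`; such a coordinate has positive variance outside a
null set, and `ξ j = ±x` is again a null event. -/
lemma multivariateGaussian_maxAbs_eq_null {V : Matrix (Fin d) (Fin d) ℝ} (hV : V.PosSemidef)
    {i : Fin d} (hi : 0 < V i i) (x : ℝ) :
    multivariateGaussian 0 V {ξ | maxAbs ξ = x} = 0 := by
  -- a coordinate with positive variance has no atoms, a coordinate with zero variance is zero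
  have hcoord : ∀ (j : Fin d) (y : ℝ), 0 < V j j → multivariateGaussian 0 V {ξ | ξ j = y} = 0 := by
    intro j y hj
    have h := (measurePreserving_eval_multivariateGaussian (μ := 0) hV (i := j)).measure_preimage
      (measurableSet_singleton y).nullMeasurableSet
    have : NullSingletonClass
        (gaussianReal ((0 : EuclideanSpace ℝ (Fin d)) j) (V j j).toNNReal) :=
      nullSingletonClass_gaussianReal (by simpa using hj)
    rw [measure_singleton] at h
    exact h
  have hzero : ∀ j : Fin d, V j j ≤ 0 → multivariateGaussian 0 V {ξ | ξ j ≠ 0} = 0 := by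
    intro j hj
    have h := (measurePreserving_eval_multivariateGaussian (μ := 0) hV (i := j)).measure_preimage
      (measurableSet_singleton (0 : ℝ)).compl.nullMeasurableSet
    rw [Real.toNNReal_of_nonpos hj, gaussianReal_zero_var] at h
    simpa [Set.preimage] using h
  have hsub : {ξ : EuclideanSpace ℝ (Fin d) | maxAbs ξ = x} ⊆
      {ξ | ξ i = 0} ∪ ⋃ j : Fin d, ({ξ | ξ j ≠ 0 ∧ ξ j = x} ∪ {ξ | ξ j ≠ 0 ∧ ξ j = -x}) := by
    intro ξ hξ
    by_cases h0 : ξ i = 0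
    · exact Or.inl h0
    right
    have hne : Nonempty (Fin d) := ⟨i⟩
    obtain ⟨j, hj⟩ := Finite.exists_max fun j => ‖ξ j‖
    have hξx : maxAbs ξ = x := hξ
    have hx : ‖ξ j‖ = x := by
      rw [← hξx]
      exact le_antisymm (norm_le_pi_norm (WithLp.ofLp ξ) j)
        ((pi_norm_le_iff_of_nonneg (norm_nonneg _)).2 hj)
    have hj0 : ξ j ≠ 0 := by
      intro h
      have := hj i
      rw [h, norm_zero] at this
      exact h0 (norm_le_zero_iff.1 this)
    rw [Set.mem_iUnion]
    refine ⟨j, ?_⟩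
    rw [Real.norm_eq_abs] at hx
    rcases abs_eq_abs.1 (hx.trans (abs_of_nonneg (hx ▸ abs_nonneg _)).symm) with h | h
    · exact Or.inl ⟨hj0, h⟩
    · exact Or.inr ⟨hj0, h⟩
  have hnull : ∀ (j : Fin d) (y : ℝ), multivariateGaussian 0 V {ξ | ξ j ≠ 0 ∧ ξ j = y} = 0 := by
    intro j y
    rcases lt_or_ge 0 (V j j) with h | h
    · exact measure_mono_null (fun ξ hξ => hξ.2) (hcoord j y h)
    · exact measure_mono_null (fun ξ hξ => hξ.1) (hzero j h)
  refine measure_mono_null hsub (measure_union_null (hcoord i 0 hi) (measure_iUnion_null fun j =>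
    measure_union_null (hnull j x) (hnull j (-x))))

lemma map_maxAbs_singleton {V : Matrix (Fin d) (Fin d) ℝ} (hV : V.PosSemidef)
    {i : Fin d} (hi : 0 < V i i) (x : ℝ) : (multivariateGaussian 0 V).map maxAbs {x} = 0 := by
  rw [Measure.map_apply continuous_maxAbs.measurable (measurableSet_singleton x)]
  exact multivariateGaussian_maxAbs_eq_null hV hi x

lemma cdf_map_maxAbs (P : Measure (EuclideanSpace ℝ (Fin d))) [IsProbabilityMeasure P] (x : ℝ) :
    cdf (P.map maxAbs) x = P.real {ξ | maxAbs ξ ≤ x} := by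
  have : IsProbabilityMeasure (P.map maxAbs) :=
    Measure.isProbabilityMeasure_map continuous_maxAbs.measurable.aemeasurable
  rw [cdf_eq_real, map_measureReal_apply continuous_maxAbs.measurable measurableSet_Iic]
  rfl

/-- Lévy's continuity theorem followed by the portmanteau theorem: the frontier of `{maxAbs ≤ x}`
lies in the null set `{maxAbs = x}`. -/
lemma tendsto_measureReal_maxAbs_le {P : ℕ → Measure (EuclideanSpace ℝ (Fin d))}
    [hP : ∀ k, IsProbabilityMeasure (P k)] {V : Matrix (Fin d) (Fin d) ℝ} (hV : V.PosSemidef)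
    {i : Fin d} (hi : 0 < V i i)
    (h : ∀ t, Tendsto (fun k => charFun (P k) t) atTop
      (𝓝 (charFun (multivariateGaussian 0 V) t))) (x : ℝ) :
    Tendsto (fun k => (P k).real {ξ | maxAbs ξ ≤ x}) atTop
      (𝓝 ((multivariateGaussian 0 V).real {ξ | maxAbs ξ ≤ x})) := by
  have hw := ProbabilityMeasure.tendsto_of_tendsto_charFun (μ := fun k => ⟨P k, hP k⟩)
    (μ₀ := ⟨multivariateGaussian 0 V, inferInstance⟩) h
  have h2 := ProbabilityMeasure.tendsto_measure_of_null_frontier_of_tendsto' hw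
    (E := {ξ | maxAbs ξ ≤ x}) (measure_mono_null
      (frontier_le_subset_eq continuous_maxAbs continuous_const)
      (multivariateGaussian_maxAbs_eq_null hV hi x))
  exact (ENNReal.tendsto_toReal (measure_ne_top _ _)).comp h2

end GaussianMaximum

/-! ### Gaussian approximation in fixed dimension -/

section GaussianApproximation

variable {d : ℕ}

lemma charFun_multivariateGaussian_zero {V : Matrix (Fin d) (Fin d) ℝ} (hV : V.PosSemidef)
    (t : EuclideanSpace ℝ (Fin d)) :
    charFun (multivariateGaussian 0 V) t =
      Complex.exp (-((∑ i, ∑ j, t i * t j * V i j) / 2 : ℝ)) := by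
  rw [charFun_multivariateGaussian hV]
  congr 1
  have : (WithLp.ofLp t) ⬝ᵥ V *ᵥ (WithLp.ofLp t) = ∑ i, ∑ j, t i * t j * V i j := by
    simp only [dotProduct, mulVec, Finset.mul_sum]
    exact Finset.sum_congr rfl fun i _ => Finset.sum_congr rfl fun j _ => by ring
  rw [this]
  simp

lemma charFun_map_toLp {Ω : Type*} [MeasurableSpace Ω] {μ : Measure Ω} {W : Ω → Fin d → ℝ}
    (hW : Measurable W) (t : EuclideanSpace ℝ (Fin d)) :
    charFun (μ.map fun ω => WithLp.toLp 2 (W ω)) t = ∫ ω, cis (∑ i, t i * W ω i) ∂μ := by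
  have hm : Measurable fun ω => (WithLp.toLp 2 (W ω) : EuclideanSpace ℝ (Fin d)) :=
    (WithLp.measurable_toLp 2 _).comp hW
  rw [charFun_apply, integral_map hm.aemeasurable (by fun_prop)]
  congr with ω
  rw [cis, mul_comm]
  congr 2

lemma posSemidef_of_tendsto {V : ℕ → Matrix (Fin d) (Fin d) ℝ} {V' : Matrix (Fin d) (Fin d) ℝ}
    (hV : ∀ᶠ k in atTop, (V k).PosSemidef)
    (hlim : ∀ i j, Tendsto (fun k => V k i j) atTop (𝓝 (V' i j))) : V'.PosSemidef := by
  refine PosSemidef.of_dotProduct_mulVec_nonneg ?_ fun x => ?_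
  · ext i j
    refine tendsto_nhds_unique (hlim j i) ((hlim i j).congr' ?_)
    filter_upwards [hV] with k hk
    have := congrFun (congrFun hk.1 j) i
    simpa using this
  · have h : Tendsto (fun k => star x ⬝ᵥ (V k *ᵥ x)) atTop (𝓝 (star x ⬝ᵥ (V' *ᵥ x))) := by
      simp only [dotProduct, mulVec]
      exact tendsto_finsetSum _ fun i _ => tendsto_const_nhds.mul
        (tendsto_finsetSum _ fun j _ => (hlim i j).mul tendsto_const_nhds)
    exact ge_of_tendsto h (hV.mono fun k hk => hk.dotProduct_mulVec_nonneg x)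

/-- The subsequential form of the Gaussian approximation, when the covariance matrices converge. -/
lemma tendsto_iSup_abs_measureReal_sub_of_tendsto {Ω : ℕ → Type*} [∀ k, MeasurableSpace (Ω k)]
    {μ : ∀ k, Measure (Ω k)} [∀ k, IsProbabilityMeasure (μ k)] {W : ∀ k, Ω k → Fin d → ℝ}
    (hW : ∀ k, Measurable (W k)) {V : ℕ → Matrix (Fin d) (Fin d) ℝ}
    {V' : Matrix (Fin d) (Fin d) ℝ} (hV : ∀ᶠ k in atTop, (V k).PosSemidef)
    (hlim : ∀ i j, Tendsto (fun k => V k i j) atTop (𝓝 (V' i j))) {σ : ℝ} (hσ : 0 < σ)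
    (htr : ∀ᶠ k in atTop, σ ≤ ∑ i, V k i i)
    (hchar : ∀ t : Fin d → ℝ, Tendsto (fun k => (∫ ω, cis (∑ i, t i * W k ω i) ∂(μ k)) -
      Complex.exp (-((∑ i, ∑ j, t i * t j * V k i j) / 2 : ℝ))) atTop (𝓝 0))
    {T : ∀ k, Ω k → ℝ} {r : ℕ → ℝ} (hr : Tendsto r atTop (𝓝 0))
    (hT : Tendsto (fun k => (μ k).real {ω | r k < |T k ω - ‖W k ω‖|}) atTop (𝓝 0)) :
    Tendsto (fun k => ⨆ x : ℝ, |(μ k).real {ω | T k ω ≤ x} -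
      (multivariateGaussian 0 (V k)).real {ξ | maxAbs ξ ≤ x}|) atTop (𝓝 0) := by
  have hV' := posSemidef_of_tendsto hV hlim
  -- The trace bound passes to the limit, so some limiting coordinate has positive variance; this
  -- makes `F` continuous.
  obtain ⟨i, hi⟩ : ∃ i, 0 < V' i i := by
    by_contra! hcon
    have h1 : σ ≤ ∑ i, V' i i :=
      ge_of_tendsto (tendsto_finsetSum _ fun i _ => hlim i i) htr
    linarith [Finset.sum_nonpos fun i (_ : i ∈ Finset.univ) => hcon i]
  set F : ℝ → ℝ := fun x => (multivariateGaussian 0 V').real {ξ | maxAbs ξ ≤ x} with hF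
  have hexp : ∀ t : Fin d → ℝ, Tendsto (fun k =>
      Complex.exp (-((∑ i, ∑ j, t i * t j * V k i j) / 2 : ℝ))) atTop
      (𝓝 (Complex.exp (-((∑ i, ∑ j, t i * t j * V' i j) / 2 : ℝ)))) := by
    intro t
    have h1 : Tendsto (fun k => (∑ i, ∑ j, t i * t j * V k i j) / 2) atTop
        (𝓝 ((∑ i, ∑ j, t i * t j * V' i j) / 2)) :=
      (tendsto_finsetSum _ fun i _ => tendsto_finsetSum _ fun j _ =>
        tendsto_const_nhds.mul (hlim i j)).div_const 2
    have h2 : Continuous fun s : ℝ => Complex.exp (-(s : ℂ)) := by fun_prop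
    exact (h2.tendsto _).comp h1
  have : ∀ k, IsProbabilityMeasure ((μ k).map fun ω =>
      (WithLp.toLp 2 (W k ω) : EuclideanSpace ℝ (Fin d))) := fun k =>
    Measure.isProbabilityMeasure_map ((WithLp.measurable_toLp 2 _).comp (hW k)).aemeasurable
  have hPW : ∀ x, Tendsto (fun k => (μ k).real {ω | ‖W k ω‖ ≤ x}) atTop (𝓝 (F x)) := by
    intro x
    have h := tendsto_measureReal_maxAbs_le (P := fun k => (μ k).map fun ω =>
      (WithLp.toLp 2 (W k ω) : EuclideanSpace ℝ (Fin d))) hV' hi (fun t => ?_) x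
    · refine h.congr fun k => ?_
      have hm : Measurable fun ω => (WithLp.toLp 2 (W k ω) : EuclideanSpace ℝ (Fin d)) :=
        (WithLp.measurable_toLp 2 _).comp (hW k)
      rw [map_measureReal_apply hm (measurableSet_le continuous_maxAbs.measurable measurable_const)]
      rfl
    · simp only [charFun_map_toLp (hW _), charFun_multivariateGaussian_zero hV']
      simpa using (hchar t).add (hexp t)
  have hPG : ∀ x, Tendsto (fun k => (multivariateGaussian 0 (V k)).real {ξ | maxAbs ξ ≤ x}) atTop
      (𝓝 (F x)) := by
    refine tendsto_measureReal_maxAbs_le hV' hi fun t => ?_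
    rw [charFun_multivariateGaussian_zero hV']
    refine (hexp t).congr' ?_
    filter_upwards [hV] with k hk
    rw [charFun_multivariateGaussian_zero hk]
  have : IsProbabilityMeasure ((multivariateGaussian 0 V').map maxAbs) :=
    Measure.isProbabilityMeasure_map continuous_maxAbs.measurable.aemeasurable
  have hFcdf : F = cdf ((multivariateGaussian 0 V').map maxAbs) :=
    funext fun x => (cdf_map_maxAbs _ x).symm
  have hFmono : Monotone F := hFcdf ▸ monotone_cdf _
  have hFc : Continuous F := hFcdf ▸ continuous_cdf_of_noAtoms _ (map_maxAbs_singleton hV' hi)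
  have hFbot : Tendsto F atBot (𝓝 0) := hFcdf ▸ tendsto_cdf_atBot _
  have hFtop : Tendsto F atTop (𝓝 1) := hFcdf ▸ tendsto_cdf_atTop _
  have huW := tendstoUniformly_of_tendsto_of_monotone
    (fun k => monotone_measureReal_le (μ k) fun ω => ‖W k ω‖) (fun _ _ => measureReal_nonneg)
    (fun _ _ => measureReal_le_one) hFmono hFc hFbot hFtop hPW
  have huG := tendstoUniformly_of_tendsto_of_monotone
    (fun k => monotone_measureReal_le (multivariateGaussian 0 (V k)) maxAbs)
    (fun _ _ => measureReal_nonneg) (fun _ _ => measureReal_le_one) hFmono hFc hFbot hFtop hPG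
  have hPT : ∀ x, Tendsto (fun k => (μ k).real {ω | T k ω ≤ x}) atTop (𝓝 (F x)) := by
    intro x
    -- Off an event of vanishing probability `T` is within `r` of the norm. Since the convergence
    -- for the norm is uniform and `F` is continuous, it may be evaluated at the moving points `x ±
    -- r`.
    have hup : Tendsto (fun k => (μ k).real {ω | ‖W k ω‖ ≤ x + r k} +
        (μ k).real {ω | r k < |T k ω - ‖W k ω‖|}) atTop (𝓝 (F x)) := by
      have h1 : Tendsto (fun k => x + r k) atTop (𝓝 x) := by simpa using tendsto_const_nhds.add hr
      simpa using (huW.tendsto_comp hFc.continuousAt h1).add hT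
    have hlow : Tendsto (fun k => (μ k).real {ω | ‖W k ω‖ ≤ x - r k} -
        (μ k).real {ω | r k < |T k ω - ‖W k ω‖|}) atTop (𝓝 (F x)) := by
      have h1 : Tendsto (fun k => x - r k) atTop (𝓝 x) := by simpa using tendsto_const_nhds.sub hr
      simpa using (huW.tendsto_comp hFc.continuousAt h1).sub hT
    refine tendsto_of_tendsto_of_tendsto_of_le_of_le hlow hup (fun k => ?_) fun k => ?_
    · rw [sub_le_iff_le_add]
      refine (measureReal_mono (fun ω hω => ?_)).trans (measureReal_union_le _ _)
      by_cases h : r k < |T k ω - ‖W k ω‖|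
      · exact Or.inr h
      · refine Or.inl ?_
        have h1 := (abs_le.1 (not_lt.1 h)).2
        have h2 : ‖W k ω‖ ≤ x - r k := hω
        change T k ω ≤ x
        linarith
    · refine (measureReal_mono (fun ω hω => ?_)).trans (measureReal_union_le _ _)
      by_cases h : r k < |T k ω - ‖W k ω‖|
      · exact Or.inr h
      · refine Or.inl ?_
        have h1 := (abs_le.1 (not_lt.1 h)).1
        have h2 : T k ω ≤ x := hω
        change ‖W k ω‖ ≤ x + r k
        linarith
  have huT := tendstoUniformly_of_tendsto_of_monotone
    (fun k => monotone_measureReal_le (μ k) (T k)) (fun _ _ => measureReal_nonneg)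
    (fun _ _ => measureReal_le_one) hFmono hFc hFbot hFtop hPT
  exact tendsto_iSup_abs_sub huT huG

/-- Gaussian approximation for the maximum of finitely many coordinates: closeness of characteristic
functions to Gaussian ones with bounded, non-vanishing covariances gives uniform closeness of the
distribution functions, also after an asymptotically negligible perturbation. -/
theorem tendsto_iSup_abs_measureReal_sub {Ω : ℕ → Type*} [∀ k, MeasurableSpace (Ω k)]
    {μ : ∀ k, Measure (Ω k)} [∀ k, IsProbabilityMeasure (μ k)] {W : ∀ k, Ω k → Fin d → ℝ}
    (hW : ∀ k, Measurable (W k)) {V : ℕ → Matrix (Fin d) (Fin d) ℝ}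
    (hV : ∀ᶠ k in atTop, (V k).PosSemidef) {C : ℝ} (hC : ∀ᶠ k in atTop, ∀ i j, |V k i j| ≤ C)
    {σ : ℝ} (hσ : 0 < σ) (htr : ∀ᶠ k in atTop, σ ≤ ∑ i, V k i i)
    (hchar : ∀ t : Fin d → ℝ, Tendsto (fun k => (∫ ω, cis (∑ i, t i * W k ω i) ∂(μ k)) -
      Complex.exp (-((∑ i, ∑ j, t i * t j * V k i j) / 2 : ℝ))) atTop (𝓝 0))
    {T : ∀ k, Ω k → ℝ} {r : ℕ → ℝ} (hr : Tendsto r atTop (𝓝 0))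
    (hT : Tendsto (fun k => (μ k).real {ω | r k < |T k ω - ‖W k ω‖|}) atTop (𝓝 0)) :
    Tendsto (fun k => ⨆ x : ℝ, |(μ k).real {ω | T k ω ≤ x} -
      (multivariateGaussian 0 (V k)).real {ξ | maxAbs ξ ≤ x}|) atTop (𝓝 0) := by
  -- The covariance matrices are only bounded, but every subsequence has a further one along which
  -- they converge, and the desired limit is 0 whatever their limit is.
  refine tendsto_of_subseq_tendsto fun ns hns => ?_
  have hbdd : ∃ᶠ k in atTop, (fun i j => V (ns k) i j) ∈
      Metric.closedBall (0 : Fin d → Fin d → ℝ) (max C 0) := by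
    refine Eventually.frequently ?_
    filter_upwards [hns.eventually hC] with k hk
    rw [mem_closedBall_zero_iff, pi_norm_le_iff_of_nonneg (le_max_right _ _)]
    intro i
    rw [pi_norm_le_iff_of_nonneg (le_max_right _ _)]
    exact fun j => (hk i j).trans (le_max_left _ _)
  obtain ⟨V', -, φ, hφ, hlim⟩ := tendsto_subseq_of_frequently_bounded Metric.isBounded_closedBall
    hbdd
  have hns' : Tendsto (fun k => ns (φ k)) atTop atTop := hns.comp hφ.tendsto_atTop
  refine ⟨φ, ?_⟩
  exact tendsto_iSup_abs_measureReal_sub_of_tendsto (μ := fun k => μ (ns (φ k)))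
    (W := fun k => W (ns (φ k))) (V := fun k => V (ns (φ k))) (V' := Matrix.of V')
    (T := fun k => T (ns (φ k))) (r := fun k => r (ns (φ k))) (fun k => hW _)
    (hns'.eventually hV)
    (fun i j => ((continuous_apply_apply i j).tendsto V').comp hlim) hσ (hns'.eventually htr)
    (fun t => (hchar t).comp hns') (hr.comp hns') (hT.comp hns')

end GaussianApproximation

/-! ### Algebra of the de-biased ridge estimator -/

namespace LinearModel

variable {n : ℕ} (S : LinearModel n)

lemma p_le : S.p ≤ n := by
  have h := S.X.rank_le_height
  rwa [S.rank_X] at h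

/-- The factor `ρ² / (λ j ^ 2 + ρ) ^ 2` of the `j`-th component of the bias. -/
noncomputable def shrinkage (j : Fin S.p) : ℝ := S.ρ ^ 2 / (S.lam j ^ 2 + S.ρ) ^ 2

/-- This identity is the effect of de-biasing: the plain ridge weight `λ / (λ² + ρ)` leaves the
factor `ρ / (λ² + ρ)`, of first order in `ρ`, and the correction replaces it by its square. -/
lemma weight_mul_lam {j : Fin S.p} (h : S.lam j ^ 2 + S.ρ ≠ 0) :
    S.weight j * S.lam j = 1 - S.shrinkage j := by
  unfold weight shrinkage
  field_simp
  ring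

/-- Sandwiching matrices between `Q` and its transpose is multiplicative. -/
lemma conj_mul_conj (A B : Matrix (Fin S.p) (Fin S.p) ℝ) :
    S.Q * A * S.Qᵀ * (S.Q * B * S.Qᵀ) = S.Q * (A * B) * S.Qᵀ := by
  calc S.Q * A * S.Qᵀ * (S.Q * B * S.Qᵀ) = S.Q * A * (S.Qᵀ * S.Q) * B * S.Qᵀ := by
        simp only [Matrix.mul_assoc]
    _ = _ := by rw [S.Q_orth, Matrix.mul_one]; simp only [Matrix.mul_assoc]

lemma transpose_X : S.Xᵀ = S.Q * diagonal S.lam * S.Pᵀ := by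
  conv_lhs => rw [S.svd]
  simp [Matrix.transpose_mul, Matrix.mul_assoc]

lemma gram_add_ridge : S.Xᵀ * S.X + S.ρ • (1 : Matrix (Fin S.p) (Fin S.p) ℝ) =
    S.Q * diagonal (fun j => S.lam j ^ 2 + S.ρ) * S.Qᵀ := by
  have h1 : S.Xᵀ * S.X = S.Q * (diagonal S.lam * diagonal S.lam) * S.Qᵀ := by
    rw [S.transpose_X]
    conv_lhs => rw [S.svd]
    calc S.Q * diagonal S.lam * S.Pᵀ * (S.P * diagonal S.lam * S.Qᵀ)
        = S.Q * diagonal S.lam * (S.Pᵀ * S.P) * diagonal S.lam * S.Qᵀ := by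
          simp only [Matrix.mul_assoc]
      _ = _ := by rw [S.P_orth, Matrix.mul_one]; simp only [Matrix.mul_assoc]
  have h2 : S.ρ • (1 : Matrix (Fin S.p) (Fin S.p) ℝ) = S.Q * (diagonal fun _ => S.ρ) * S.Qᵀ := by
    rw [← smul_one_eq_diagonal, Matrix.mul_smul, Matrix.mul_one, Matrix.smul_mul, S.Q_orth']
  rw [h1, h2, ← Matrix.add_mul, ← Matrix.mul_add, diagonal_mul_diagonal, diagonal_add]
  simp only [pow_two]

lemma inv_gram_add_ridge (h : ∀ j, S.lam j ^ 2 + S.ρ ≠ 0) :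
    (S.Xᵀ * S.X + S.ρ • (1 : Matrix (Fin S.p) (Fin S.p) ℝ))⁻¹ =
      S.Q * diagonal (fun j => (S.lam j ^ 2 + S.ρ)⁻¹) * S.Qᵀ := by
  refine Matrix.inv_eq_left_inv ?_
  rw [S.gram_add_ridge, S.conj_mul_conj, diagonal_mul_diagonal]
  have : (fun j => (S.lam j ^ 2 + S.ρ)⁻¹ * (S.lam j ^ 2 + S.ρ)) = fun _ => 1 :=
    funext fun j => inv_mul_cancel₀ (h j)
  rw [this, diagonal_one, Matrix.mul_one, S.Q_orth']

lemma debiased_eq (h : ∀ j, S.lam j ^ 2 + S.ρ ≠ 0) (y : Fin n → ℝ) :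
    S.debiased y = (S.Q * diagonal S.weight * S.Pᵀ) *ᵥ y := by
  have hinv : (diagonal S.lam ^ 2 + S.ρ • (1 : Matrix (Fin S.p) (Fin S.p) ℝ))⁻¹ =
      diagonal (fun j => (S.lam j ^ 2 + S.ρ)⁻¹) := by
    refine Matrix.inv_eq_left_inv ?_
    rw [smul_one_eq_diagonal, diagonal_pow, diagonal_add, diagonal_mul_diagonal, ← diagonal_one]
    congr 1
    funext j
    exact inv_mul_cancel₀ (h j)
  have hridge : S.ridge y =
      (S.Q * diagonal (fun j => (S.lam j ^ 2 + S.ρ)⁻¹ * S.lam j) * S.Pᵀ) *ᵥ y := by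
    rw [ridge, mulVec_mulVec, S.inv_gram_add_ridge h, S.transpose_X]
    congr 1
    calc S.Q * diagonal (fun j => (S.lam j ^ 2 + S.ρ)⁻¹) * S.Qᵀ * (S.Q * diagonal S.lam * S.Pᵀ)
        = S.Q * diagonal (fun j => (S.lam j ^ 2 + S.ρ)⁻¹) * (S.Qᵀ * S.Q) * diagonal S.lam *
            S.Pᵀ := by simp only [Matrix.mul_assoc]
      _ = _ := by rw [S.Q_orth, Matrix.mul_one, Matrix.mul_assoc S.Q, diagonal_mul_diagonal]
  rw [debiased, hinv, hridge, mulVec_mulVec, ← smul_mulVec, ← add_mulVec]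
  congr 1
  have hQ : S.Q * diagonal (fun j => (S.lam j ^ 2 + S.ρ)⁻¹) * S.Qᵀ *
      (S.Q * diagonal (fun j => (S.lam j ^ 2 + S.ρ)⁻¹ * S.lam j) * S.Pᵀ) =
      S.Q * diagonal (fun j => (S.lam j ^ 2 + S.ρ)⁻¹ * ((S.lam j ^ 2 + S.ρ)⁻¹ * S.lam j)) *
        S.Pᵀ := by
    calc _ = S.Q * diagonal (fun j => (S.lam j ^ 2 + S.ρ)⁻¹) * (S.Qᵀ * S.Q) *
            diagonal (fun j => (S.lam j ^ 2 + S.ρ)⁻¹ * S.lam j) * S.Pᵀ := by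
          simp only [Matrix.mul_assoc]
      _ = _ := by rw [S.Q_orth, Matrix.mul_one, Matrix.mul_assoc S.Q, diagonal_mul_diagonal]
  rw [hQ, ← Matrix.smul_mul, ← Matrix.mul_smul, ← Matrix.add_mul, ← Matrix.mul_add,
    ← diagonal_smul, diagonal_add]
  congr 3
  funext j
  have := h j
  simp only [Pi.smul_apply, smul_eq_mul, weight]
  field_simp

lemma debiased_response (h : ∀ j, S.lam j ^ 2 + S.ρ ≠ 0) (ε : Fin n → ℝ) :
    S.debiased (S.response ε) = S.β + (S.Q * diagonal S.weight * S.Pᵀ) *ᵥ ε -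
      (S.Q * diagonal S.shrinkage * S.Qᵀ) *ᵥ S.β := by
  have hX : S.Q * diagonal S.weight * S.Pᵀ * S.X = 1 - S.Q * diagonal S.shrinkage * S.Qᵀ := by
    have hw : diagonal S.weight * diagonal S.lam = 1 - diagonal S.shrinkage := by
      rw [diagonal_mul_diagonal, ← diagonal_one, diagonal_sub]
      congr 1
      funext j
      exact S.weight_mul_lam (h j)
    conv_lhs => rw [S.svd]
    calc S.Q * diagonal S.weight * S.Pᵀ * (S.P * diagonal S.lam * S.Qᵀ)
        = S.Q * diagonal S.weight * (S.Pᵀ * S.P) * diagonal S.lam * S.Qᵀ := by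
          simp only [Matrix.mul_assoc]
      _ = S.Q * (diagonal S.weight * diagonal S.lam) * S.Qᵀ := by
          rw [S.P_orth, Matrix.mul_one, Matrix.mul_assoc S.Q]
      _ = _ := by rw [hw, Matrix.mul_sub, Matrix.sub_mul, Matrix.mul_one, S.Q_orth']
  rw [S.debiased_eq h, response, mulVec_add, mulVec_mulVec, hX, sub_mulVec, one_mulVec]
  abel

/-- A linear combination of the estimation errors of the de-biased estimator. -/
lemma dotProduct_debiased_sub (h : ∀ j, S.lam j ^ 2 + S.ρ ≠ 0) (ε : Fin n → ℝ)
    (u : Fin S.p → ℝ) :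
    ∑ k, u k * (S.debiased (S.response ε) k - S.β k) =
      ∑ l, (∑ j, (u ᵥ* S.Q) j * S.weight j * S.P l j) * ε l -
        ∑ j, (u ᵥ* S.Q) j * S.shrinkage j * (S.β ᵥ* S.Q) j := by
  have hdot : ∀ w : Fin S.p → ℝ, ∑ k, u k * w k = u ⬝ᵥ w := fun w => rfl
  have h0 : ∀ k, S.debiased (S.response ε) k - S.β k =
      ((S.Q * diagonal S.weight * S.Pᵀ) *ᵥ ε - (S.Q * diagonal S.shrinkage * S.Qᵀ) *ᵥ S.β) k := by
    intro k
    rw [S.debiased_response h]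
    simp only [Pi.add_apply, Pi.sub_apply]
    ring
  simp only [h0]
  rw [hdot, dotProduct_sub, dotProduct_mulVec, dotProduct_mulVec, ← vecMul_vecMul,
    ← vecMul_vecMul, ← vecMul_vecMul, ← vecMul_vecMul, ← dotProduct_mulVec _ S.Qᵀ,
    mulVec_transpose]
  congr 1
  · refine Finset.sum_congr rfl fun l _ => ?_
    have hP : ∀ v : Fin S.p → ℝ, (v ᵥ* S.Pᵀ) l = ∑ j, v j * S.P l j := fun v => rfl
    simp only [hP, vecMul_diagonal]
  · refine Finset.sum_congr rfl fun j _ => ?_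
    rw [vecMul_diagonal]

lemma sum_sq_vecMul_Q (u : Fin S.p → ℝ) : ∑ j, (u ᵥ* S.Q) j ^ 2 = ∑ k, u k ^ 2 := by
  have h : (u ᵥ* S.Q) ⬝ᵥ (u ᵥ* S.Q) = u ⬝ᵥ u := by
    rw [← dotProduct_mulVec, mulVec_vecMul, S.Q_orth', one_mulVec]
  simpa only [dotProduct, ← pow_two] using h

lemma sum_sq_mulVec_P (v : Fin S.p → ℝ) : ∑ l, (∑ j, v j * S.P l j) ^ 2 = ∑ j, v j ^ 2 := by
  have h : (S.P *ᵥ v) ⬝ᵥ (S.P *ᵥ v) = v ⬝ᵥ v := by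
    rw [dotProduct_mulVec, vecMul_mulVec, S.P_orth, vecMul_one]
  have h' : ∀ l, (S.P *ᵥ v) l = ∑ j, v j * S.P l j := fun l => by
    simp only [mulVec, dotProduct, mul_comm]
  simpa only [dotProduct, h', ← pow_two] using h

end LinearModel

/-! ### Auxiliary inequalities and linear images of Gaussian vectors -/

section Maxima

variable {ι : Type*} [Finite ι] [Nonempty ι]

lemma abs_iSup_sub_iSup_le {f g : ι → ℝ} {r : ℝ} (h : ∀ i, |f i - g i| ≤ r) :
    |(⨆ i, f i) - ⨆ i, g i| ≤ r := by
  rw [abs_sub_le_iff]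
  constructor
  · rw [sub_le_iff_le_add]
    exact ciSup_le fun i => by
      have := le_ciSup (Finite.bddAbove_range g) i
      linarith [(abs_le.1 (h i)).2]
  · rw [sub_le_iff_le_add]
    exact ciSup_le fun i => by
      have := le_ciSup (Finite.bddAbove_range f) i
      linarith [(abs_le.1 (h i)).1]

end Maxima

/-- Cauchy–Schwarz with a weight `w` that dominates `g`. If `w` consists of the `d_j` and `a` of the
`c_ij`, the first root is at most `τ`, which yields bias bounds relative to `τ`. -/
lemma abs_sum_mul_mul_le {ι : Type*} (s : Finset ι) (a w g b : ι → ℝ) {c : ℝ} (hc : 0 ≤ c)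
    (h : ∀ j ∈ s, |g j| ≤ c * |w j|) :
    |∑ j ∈ s, a j * g j * b j| ≤
      c * √(∑ j ∈ s, a j ^ 2 * w j ^ 2) * √(∑ j ∈ s, b j ^ 2) := by
  calc |∑ j ∈ s, a j * g j * b j| ≤ ∑ j ∈ s, |a j * g j * b j| := Finset.abs_sum_le_sum_abs _ _
    _ ≤ ∑ j ∈ s, c * (|a j * w j| * |b j|) := by
        refine Finset.sum_le_sum fun j hj => ?_
        rw [abs_mul, abs_mul, abs_mul]
        have := mul_le_mul_of_nonneg_left (h j hj) (mul_nonneg (abs_nonneg (a j)) (abs_nonneg (b j)))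
        linarith
    _ = c * ∑ j ∈ s, |a j * w j| * |b j| := by rw [Finset.mul_sum]
    _ ≤ c * (√(∑ j ∈ s, |a j * w j| ^ 2) * √(∑ j ∈ s, |b j| ^ 2)) :=
        mul_le_mul_of_nonneg_left (Real.sum_mul_le_sqrt_mul_sqrt _ _ _) hc
    _ = _ := by simp only [sq_abs, mul_pow, mul_assoc]

/-- The image of a centred Gaussian vector under a linear map. -/
lemma map_mulVec_multivariateGaussian {d n : ℕ} {V : Matrix (Fin n) (Fin n) ℝ} (hV : V.PosSemidef)
    (A : Matrix (Fin d) (Fin n) ℝ) :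
    (multivariateGaussian 0 V).map (fun ξ => WithLp.toLp 2 (A *ᵥ WithLp.ofLp ξ)) =
      multivariateGaussian 0 (A * V * Aᵀ) := by
  have hm : Measurable fun ξ : EuclideanSpace ℝ (Fin n) =>
      (WithLp.toLp 2 (A *ᵥ WithLp.ofLp ξ) : EuclideanSpace ℝ (Fin d)) := by
    have : Continuous fun ξ : EuclideanSpace ℝ (Fin n) =>
      (WithLp.toLp 2 (A *ᵥ WithLp.ofLp ξ) : EuclideanSpace ℝ (Fin d)) := by fun_prop
    exact this.measurable
  have hAV : (A * V * Aᵀ).PosSemidef := by simpa using hV.mul_mul_conjTranspose_same A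
  have := Measure.isProbabilityMeasure_map (μ := multivariateGaussian 0 V) hm.aemeasurable
  refine Measure.ext_of_charFun (funext fun t => ?_)
  have h1 : charFun ((multivariateGaussian 0 V).map
      (fun ξ => WithLp.toLp 2 (A *ᵥ WithLp.ofLp ξ))) t =
      charFun (multivariateGaussian 0 V) (WithLp.toLp 2 (Aᵀ *ᵥ WithLp.ofLp t)) := by
    rw [charFun_apply, charFun_apply, integral_map hm.aemeasurable (by fun_prop)]
    congr with ξ
    congr 3
    simp only [EuclideanSpace.inner_eq_star_dotProduct, star_trivial]
    rw [dotProduct_mulVec, mulVec_transpose]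
  rw [h1, charFun_multivariateGaussian hV, charFun_multivariateGaussian hAV]
  have h2 : (Aᵀ *ᵥ WithLp.ofLp t) ⬝ᵥ V *ᵥ (Aᵀ *ᵥ WithLp.ofLp t) =
      WithLp.ofLp t ⬝ᵥ (A * V * Aᵀ) *ᵥ WithLp.ofLp t := by
    rw [mulVec_transpose, ← dotProduct_mulVec, ← mulVec_transpose, mulVec_mulVec, mulVec_mulVec,
      Matrix.mul_assoc]
  simp only [h2, inner_zero_right, Complex.ofReal_zero, zero_mul]

/-! ### Consequences of the lower bound on the singular values -/

namespace LinearModel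

variable {n : ℕ} (S : LinearModel n)

lemma shrinkage_nonneg (j : Fin S.p) : 0 ≤ S.shrinkage j := by unfold shrinkage; positivity

lemma sqrt_sum_sq_vecMul_Q_beta : √(∑ j, (S.β ᵥ* S.Q) j ^ 2) = ‖WithLp.toLp 2 S.β‖ := by
  rw [S.sum_sq_vecMul_Q, EuclideanSpace.norm_eq]
  simp

section Spectrum

variable {κ : ℝ} (hκ : 0 < κ) (hlam : ∀ j, κ ≤ S.lam j) (hρ : |S.ρ| ≤ κ ^ 2 / 4)

include hκ hlam hρ

lemma abs_ridge_le (j : Fin S.p) : |S.ρ| ≤ S.lam j ^ 2 / 4 := by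
  have := pow_le_pow_left₀ hκ.le (hlam j) 2
  linarith

lemma lam_sq_add_pos (j : Fin S.p) : 0 < S.lam j ^ 2 + S.ρ := by
  have h1 := S.abs_ridge_le hκ hlam hρ j
  have h2 : 0 < S.lam j ^ 2 := pow_pos (hκ.trans_le (hlam j)) 2
  linarith [(abs_le.1 h1).1]

/-- `ρ` may be negative, but `|ρ| ≤ λ² / 4` gives `λ² + ρ ≥ (3/4) λ²`; the constant 2 bounds
`(4/3)²`. -/
lemma shrinkage_le' (j : Fin S.p) : S.shrinkage j ≤ 2 * S.ρ ^ 2 / S.lam j ^ 4 := by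
  have h1 := (abs_le.1 (S.abs_ridge_le hκ hlam hρ j)).1
  have h2 := pow_pos (hκ.trans_le (hlam j)) 2
  have h3 : (3 / 4 * S.lam j ^ 2) ^ 2 ≤ (S.lam j ^ 2 + S.ρ) ^ 2 :=
    pow_le_pow_left₀ (by positivity) (by linarith) 2
  have h4 : 0 < S.lam j ^ 4 := pow_pos (hκ.trans_le (hlam j)) 4
  rw [shrinkage, div_le_div_iff₀ (pow_pos (S.lam_sq_add_pos hκ hlam hρ j) 2) h4]
  have h5 : S.lam j ^ 4 ≤ 2 * (S.lam j ^ 2 + S.ρ) ^ 2 := by nlinarith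
  nlinarith [mul_le_mul_of_nonneg_left h5 (sq_nonneg S.ρ)]

lemma shrinkage_le (j : Fin S.p) : S.shrinkage j ≤ 2 * S.ρ ^ 2 / κ ^ 4 := by
  refine (S.shrinkage_le' hκ hlam hρ j).trans ?_
  have := hlam j
  gcongr

lemma shrinkage_le_half (j : Fin S.p) : S.shrinkage j ≤ 1 / 2 := by
  refine (S.shrinkage_le' hκ hlam hρ j).trans ?_
  have h0 := S.abs_ridge_le hκ hlam hρ j
  have h4 : 0 < S.lam j ^ 4 := pow_pos (hκ.trans_le (hlam j)) 4
  have h5 : S.ρ ^ 2 ≤ (S.lam j ^ 2 / 4) ^ 2 := by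
    rw [← sq_abs S.ρ]
    exact pow_le_pow_left₀ (abs_nonneg _) h0 2
  rw [div_le_div_iff₀ h4 two_pos]
  nlinarith

lemma one_div_le_weight (j : Fin S.p) : 1 / (2 * S.lam j) ≤ S.weight j := by
  have h1 := S.weight_mul_lam (S.lam_sq_add_pos hκ hlam hρ j).ne'
  have h2 := S.shrinkage_le_half hκ hlam hρ j
  have h3 := hκ.trans_le (hlam j)
  rw [div_le_iff₀ (by positivity)]
  linarith

lemma weight_pos (j : Fin S.p) : 0 < S.weight j := by
  have h3 := hκ.trans_le (hlam j)
  exact lt_of_lt_of_le (by positivity) (S.one_div_le_weight hκ hlam hρ j)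

lemma weight_le (j : Fin S.p) : S.weight j ≤ 1 / κ := by
  have h1 := S.weight_mul_lam (S.lam_sq_add_pos hκ hlam hρ j).ne'
  have h2 := S.shrinkage_nonneg j
  rw [le_div_iff₀ hκ]
  have := mul_le_mul_of_nonneg_left (hlam j) (S.weight_pos hκ hlam hρ j).le
  linarith

/-- One factor `λ⁻¹` is absorbed by the weight and only `λ⁻³` is bounded through `κ`. Relative to
`τ` the bias is therefore of order `ρ² κ⁻³ ‖β‖`, which fits the lower bound on `δ`. -/
lemma shrinkage_le_mul_weight (j : Fin S.p) :
    S.shrinkage j ≤ 4 * S.ρ ^ 2 / κ ^ 3 * S.weight j := by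
  have h3 := hκ.trans_le (hlam j)
  calc S.shrinkage j ≤ 2 * S.ρ ^ 2 / S.lam j ^ 4 := S.shrinkage_le' hκ hlam hρ j
    _ = 4 * S.ρ ^ 2 / S.lam j ^ 3 * (1 / (2 * S.lam j)) := by field_simp; ring
    _ ≤ 4 * S.ρ ^ 2 / κ ^ 3 * S.weight j := by
        have h1 := hlam j
        have h2 := S.one_div_le_weight hκ hlam hρ j
        gcongr

/-- The estimation error of the de-biased estimator is a linear form in the errors with small
coefficients, up to a small bias. -/
lemma exists_abs_debiased_sub_le : ∃ w : Fin S.p → Fin n → ℝ, (∀ k, √(∑ l, w k l ^ 2) ≤ 1 / κ) ∧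
    ∀ (ε : Fin n → ℝ) (k : Fin S.p), |S.debiased (S.response ε) k - S.β k| ≤
      |∑ l, w k l * ε l| + 2 * S.ρ ^ 2 / κ ^ 4 * ‖WithLp.toLp 2 S.β‖ := by
  have hv : ∀ k, ∑ j, ((Pi.single k (1 : ℝ)) ᵥ* S.Q) j ^ 2 = 1 := fun k => by
    rw [S.sum_sq_vecMul_Q, Finset.sum_eq_single k (fun b _ hb => by simp [hb]) (by simp)]
    simp
  refine ⟨fun k l => ∑ j, ((Pi.single k (1 : ℝ)) ᵥ* S.Q) j * S.weight j * S.P l j,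
    fun k => ?_, fun ε k => ?_⟩
  · rw [S.sum_sq_mulVec_P fun j => ((Pi.single k (1 : ℝ)) ᵥ* S.Q) j * S.weight j]
    refine Real.sqrt_le_iff.2 ⟨by positivity, ?_⟩
    calc ∑ j, (((Pi.single k (1 : ℝ)) ᵥ* S.Q) j * S.weight j) ^ 2
        ≤ ∑ j, ((Pi.single k (1 : ℝ)) ᵥ* S.Q) j ^ 2 * (1 / κ) ^ 2 := by
          refine Finset.sum_le_sum fun j _ => ?_
          rw [mul_pow]
          have h1 := S.weight_le hκ hlam hρ j
          have h2 := (S.weight_pos hκ hlam hρ j).le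
          gcongr
      _ = (1 / κ) ^ 2 := by rw [← Finset.sum_mul, hv, one_mul]
  · have h := S.dotProduct_debiased_sub (fun j => (S.lam_sq_add_pos hκ hlam hρ j).ne') ε
      (Pi.single k 1)
    rw [Finset.sum_eq_single k (fun b _ hb => by simp [hb]) (by simp), Pi.single_eq_same,
      one_mul] at h
    rw [h]
    refine (abs_sub _ _).trans (add_le_add_right ?_ _)
    have h2 := abs_sum_mul_mul_le Finset.univ ((Pi.single k (1 : ℝ)) ᵥ* S.Q) (fun _ => 1)
      S.shrinkage (S.β ᵥ* S.Q) (c := 2 * S.ρ ^ 2 / κ ^ 4) (by positivity) fun j _ => by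
        rw [abs_of_nonneg (S.shrinkage_nonneg j), abs_one, mul_one]
        exact S.shrinkage_le hκ hlam hρ j
    simpa only [one_pow, mul_one, hv, Real.sqrt_one, S.sqrt_sum_sq_vecMul_Q_beta] using h2

end Spectrum

end LinearModel

/-! ### The studentized maximum when the support is recovered -/

namespace LinearModel

variable {n : ℕ} (S : LinearModel n)

lemma coef_eq_vecMul (N : Finset (Fin S.p)) (i : Fin S.p₁) (j : Fin S.p) :
    S.coef N i j = ((fun k => if k ∈ N then S.M i k else 0) ᵥ* S.Q) j := by
  simp [coef, vecMul, dotProduct, ite_mul]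

lemma sum_sq_coef (N : Finset (Fin S.p)) (i : Fin S.p₁) :
    ∑ j, S.coef N i j ^ 2 = ∑ k ∈ N, S.M i k ^ 2 := by
  simp only [S.coef_eq_vecMul, S.sum_sq_vecMul_Q, ite_pow, zero_pow two_ne_zero]
  rw [Finset.sum_ite_mem, Finset.univ_inter]

lemma normCoef_eq_zero {i : Fin S.p₁} (hi : i ∉ S.activeRows) (l : Fin n) :
    S.normCoef i l = 0 := by
  have h0 : ∑ j, S.coef S.support i j ^ 2 = 0 := by
    refine le_antisymm (not_lt.1 fun h => hi ?_) (Finset.sum_nonneg fun j _ => sq_nonneg _)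
    exact Finset.mem_filter.2 ⟨Finset.mem_univ _, h⟩
  have h1 : ∀ j, S.coef S.support i j = 0 := fun j => by
    have := (Finset.sum_eq_zero_iff_of_nonneg fun j _ => sq_nonneg (S.coef S.support i j)).1 h0 j
      (Finset.mem_univ j)
    exact pow_eq_zero_iff two_ne_zero |>.1 this
  simp [normCoef, h1]

lemma sqrt_le_tau (N : Finset (Fin S.p)) (i : Fin S.p₁) :
    √(∑ j, S.coef N i j ^ 2 * S.weight j ^ 2) ≤ S.tau N i :=
  Real.sqrt_le_sqrt (le_add_of_nonneg_left (by positivity))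

lemma one_div_sqrt_le_tau (N : Finset (Fin S.p)) (i : Fin S.p₁) : 1 / √n ≤ S.tau N i := by
  rw [← Real.sqrt_one, ← Real.sqrt_div zero_le_one]
  exact Real.sqrt_le_sqrt (le_add_of_nonneg_right
    (Finset.sum_nonneg fun j _ => mul_nonneg (sq_nonneg _) (sq_nonneg _)))

lemma tau_pos (hn : 0 < n) (N : Finset (Fin S.p)) (i : Fin S.p₁) : 0 < S.tau N i := by
  have : (0 : ℝ) < n := Nat.cast_pos.2 hn
  exact lt_of_lt_of_le (by positivity) (S.one_div_sqrt_le_tau N i)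

lemma sum_sq_normCoef (i : Fin S.p₁) : ∑ l, S.normCoef i l ^ 2 =
    (∑ j, S.coef S.support i j ^ 2 * S.weight j ^ 2) /
      (1 / (n : ℝ) + ∑ j, S.coef S.support i j ^ 2 * S.weight j ^ 2) := by
  simp only [normCoef, mul_pow, ← Finset.mul_sum]
  rw [S.sum_sq_mulVec_P fun j => S.coef S.support i j * S.weight j, tau, div_pow, one_pow,
    Real.sq_sqrt]
  · simp only [mul_pow]
    rw [one_div_mul_eq_div]
  · exact add_nonneg (by positivity)
      (Finset.sum_nonneg fun j _ => mul_nonneg (sq_nonneg _) (sq_nonneg _))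

lemma sum_sq_normCoef_le_one (i : Fin S.p₁) : ∑ l, S.normCoef i l ^ 2 ≤ 1 := by
  rw [S.sum_sq_normCoef]
  exact div_le_one_of_le₀ (le_add_of_nonneg_left (by positivity)) (add_nonneg (by positivity)
    (Finset.sum_nonneg fun j _ => mul_nonneg (sq_nonneg _) (sq_nonneg _)))

lemma le_sum_sq_normCoef (hn : 0 < n) {i : Fin S.p₁} {c : ℝ} (hc : 0 ≤ c)
    (h : c ≤ n * ∑ j, S.coef S.support i j ^ 2 * S.weight j ^ 2) :
    c / (1 + c) ≤ ∑ l, S.normCoef i l ^ 2 := by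
  have hn' : (0 : ℝ) < n := Nat.cast_pos.2 hn
  rw [S.sum_sq_normCoef]
  set s := ∑ j, S.coef S.support i j ^ 2 * S.weight j ^ 2
  have hs : s / (1 / (n : ℝ) + s) = n * s / (1 + n * s) := by field_simp
  rw [hs, div_le_div_iff₀ (by positivity) (by linarith)]
  nlinarith

/-- The normalized linear combination of the estimation errors, on the event that the support is
recovered. -/
lemma abs_sub_le_of_supportHat_eq (hn : 0 < n) {κ : ℝ} (hκ : 0 < κ) (hlam : ∀ j, κ ≤ S.lam j)
    (hρ : |S.ρ| ≤ κ ^ 2 / 4) {ε : Fin n → ℝ} (hε : S.supportHat (S.response ε) = S.support)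
    (i : Fin S.p₁) :
    |(|S.gammaHat (S.response ε) i - (S.M *ᵥ S.β) i| / S.tauHat (S.response ε) i) -
        (|∑ l, S.normCoef i l * ε l|)| ≤
      4 * S.ρ ^ 2 / κ ^ 3 * ‖WithLp.toLp 2 S.β‖ +
        √n * |∑ j ∈ S.supportᶜ, S.M i j * S.β j| := by
  have hn' : (0 : ℝ) < n := Nat.cast_pos.2 hn
  set τ := S.tau S.support i with hτ
  have hτ0 : 0 < τ := S.tau_pos hn _ i
  set bias := ∑ j, S.coef S.support i j * S.shrinkage j * (S.β ᵥ* S.Q) j with hbias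
  set rest := ∑ j ∈ S.supportᶜ, S.M i j * S.β j with hrest
  have hdecomp : S.gammaHat (S.response ε) i - (S.M *ᵥ S.β) i =
      τ * (∑ l, S.normCoef i l * ε l) - bias - rest := by
    have h1 := S.dotProduct_debiased_sub (fun j => (S.lam_sq_add_pos hκ hlam hρ j).ne') ε
      (fun k => if k ∈ S.support then S.M i k else 0)
    have h2 : S.gammaHat (S.response ε) i - (S.M *ᵥ S.β) i =
        ∑ k, (if k ∈ S.support then S.M i k else 0) *
          (S.debiased (S.response ε) k - S.β k) - rest := by
      have h3 : rest = ∑ k, if k ∈ S.support then 0 else S.M i k * S.β k := by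
        rw [hrest, ← Finset.univ_inter S.supportᶜ, ← Finset.sum_ite_mem]
        exact Finset.sum_congr rfl fun k _ => by by_cases h : k ∈ S.support <;> simp [h]
      rw [h3, ← Finset.sum_sub_distrib, gammaHat, mulVec, mulVec, dotProduct, dotProduct,
        ← Finset.sum_sub_distrib]
      refine Finset.sum_congr rfl fun k _ => ?_
      rw [betaHat, hε]
      split_ifs <;> ring
    rw [h2, h1, Finset.mul_sum]
    simp only [← S.coef_eq_vecMul]
    congr 2
    refine Finset.sum_congr rfl fun l _ => ?_
    rw [normCoef, ← hτ]
    field_simp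
  have hb : |bias| ≤ τ * (4 * S.ρ ^ 2 / κ ^ 3 * ‖WithLp.toLp 2 S.β‖) := by
    have h1 := abs_sum_mul_mul_le Finset.univ (S.coef S.support i) S.weight S.shrinkage
      (S.β ᵥ* S.Q) (c := 4 * S.ρ ^ 2 / κ ^ 3) (by positivity) fun j _ => by
        rw [abs_of_nonneg (S.shrinkage_nonneg j), abs_of_pos (S.weight_pos hκ hlam hρ j)]
        exact S.shrinkage_le_mul_weight hκ hlam hρ j
    rw [S.sqrt_sum_sq_vecMul_Q_beta] at h1
    calc |bias| ≤ _ := h1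
      _ ≤ 4 * S.ρ ^ 2 / κ ^ 3 * τ * ‖WithLp.toLp 2 S.β‖ := by
        have := S.sqrt_le_tau S.support i
        gcongr
      _ = _ := by ring
  -- The summand `1 / n` in `τ²` gives `1 ≤ τ √n`, so that the small coordinates can be compared
  -- with `τ`.
  have hr : |rest| ≤ τ * (√n * |rest|) := by
    have h1 : 1 ≤ τ * √n := by
      rw [← div_le_iff₀ (by positivity)]
      exact S.one_div_sqrt_le_tau S.support i
    nlinarith [abs_nonneg rest]
  rw [tauHat, hε, ← hτ]
  have h4 : |∑ l, S.normCoef i l * ε l| = |τ * ∑ l, S.normCoef i l * ε l| / τ := by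
    rw [abs_mul, abs_of_pos hτ0, mul_div_cancel_left₀ _ hτ0.ne']
  rw [h4, ← sub_div, abs_div, abs_of_pos hτ0, div_le_iff₀ hτ0]
  calc _ ≤ |S.gammaHat (S.response ε) i - (S.M *ᵥ S.β) i -
        τ * ∑ l, S.normCoef i l * ε l| := abs_abs_sub_abs_le _ _
    _ = |bias + rest| := by rw [hdecomp, ← abs_neg]; congr 1; ring
    _ ≤ |bias| + |rest| := abs_add_le _ _
    _ ≤ _ := by linarith

/-- The matrix of the normalized coefficients, padded with zero rows. -/
noncomputable def rowMatrix (d : ℕ) : Matrix (Fin d) (Fin n) ℝ :=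
  Matrix.of fun i l => if h : (i : ℕ) < S.p₁ then S.normCoef ⟨i, h⟩ l else 0

variable {d : ℕ}

/-- Zero rows do not affect the sup norm; the padding places all sample sizes in one dimension `d`,
as weak convergence requires. -/
lemma norm_rowMatrix_mulVec (hd : S.p₁ ≤ d) (hne : S.activeRows.Nonempty) (ε : Fin n → ℝ) :
    ‖S.rowMatrix d *ᵥ ε‖ = ⨆ i : Fin S.p₁, |∑ l, S.normCoef i l * ε l| := by
  obtain ⟨i₀, -⟩ := hne
  have : Nonempty (Fin S.p₁) := ⟨i₀⟩
  have hb := Finite.bddAbove_range fun i : Fin S.p₁ => |∑ l, S.normCoef i l * ε l|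
  refine le_antisymm ((pi_norm_le_iff_of_nonneg (Real.iSup_nonneg fun i => abs_nonneg _)).2
    fun i => ?_) (ciSup_le fun i => ?_)
  · by_cases h : (i : ℕ) < S.p₁
    · refine le_trans (le_of_eq ?_) (le_ciSup hb ⟨i, h⟩)
      simp [mulVec, dotProduct, rowMatrix, h]
    · have : (S.rowMatrix d *ᵥ ε) i = 0 := by simp [mulVec, dotProduct, rowMatrix, h]
      rw [this, norm_zero]
      exact Real.iSup_nonneg fun i => abs_nonneg _
  · refine le_trans (le_of_eq ?_) (norm_le_pi_norm _ (⟨i, i.2.trans_le hd⟩ : Fin d))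
    simp [mulVec, dotProduct, rowMatrix]

lemma iSup_activeRows_eq (hne : S.activeRows.Nonempty) (ε : Fin n → ℝ) :
    ⨆ i : {i // i ∈ S.activeRows}, |∑ l, S.normCoef i l * ε l| =
      ⨆ i : Fin S.p₁, |∑ l, S.normCoef i l * ε l| := by
  obtain ⟨i₀, hi₀⟩ := hne
  have : Nonempty (Fin S.p₁) := ⟨i₀⟩
  have : Nonempty {i // i ∈ S.activeRows} := ⟨⟨i₀, hi₀⟩⟩
  refine le_antisymm (ciSup_le fun i => le_ciSup
    (Finite.bddAbove_range fun i : Fin S.p₁ => |∑ l, S.normCoef i l * ε l|) i.1)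
    (ciSup_le fun i => ?_)
  by_cases h : i ∈ S.activeRows
  · exact le_ciSup (Finite.bddAbove_range fun i : {i // i ∈ S.activeRows} =>
      |∑ l, S.normCoef i l * ε l|) ⟨i, h⟩
  · simp only [S.normCoef_eq_zero h, zero_mul, Finset.sum_const_zero, abs_zero]
    exact Real.iSup_nonneg fun i => abs_nonneg _

lemma H_eq (hd : S.p₁ ≤ d) (hne : S.activeRows.Nonempty) {V : Matrix (Fin n) (Fin n) ℝ}
    (hV : V.PosSemidef) (x : ℝ) :
    S.H V x = (multivariateGaussian 0 (S.rowMatrix d * V * (S.rowMatrix d)ᵀ)).real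
      {ξ | maxAbs ξ ≤ x} := by
  have hm : Continuous fun ξ : EuclideanSpace ℝ (Fin n) =>
      (WithLp.toLp 2 (S.rowMatrix d *ᵥ WithLp.ofLp ξ) : EuclideanSpace ℝ (Fin d)) := by fun_prop
  rw [← map_mulVec_multivariateGaussian hV, map_measureReal_apply hm.measurable
    (measurableSet_le continuous_maxAbs.measurable measurable_const), H]
  congr 1
  ext ξ
  simp only [Set.mem_ofPred_eq, Set.mem_preimage, maxAbs, S.norm_rowMatrix_mulVec hd hne,
    S.iSup_activeRows_eq hne]

/-- On the event that the support is recovered, the studentized maximum is close to the maximum of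
finitely many linear forms in the errors. -/
lemma abs_studentizedMax_sub_le (hn : 0 < n) (hd : S.p₁ ≤ d) (hne : S.activeRows.Nonempty)
    {κ : ℝ} (hκ : 0 < κ) (hlam : ∀ j, κ ≤ S.lam j) (hρ : |S.ρ| ≤ κ ^ 2 / 4) {ε : Fin n → ℝ}
    (hε : S.supportHat (S.response ε) = S.support) :
    |S.studentizedMax (S.response ε) - ‖S.rowMatrix d *ᵥ ε‖| ≤
      4 * S.ρ ^ 2 / κ ^ 3 * ‖WithLp.toLp 2 S.β‖ +
        √n * ⨆ i : Fin S.p₁, |∑ j ∈ S.supportᶜ, S.M i j * S.β j| := by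
  have : Nonempty (Fin S.p₁) := ⟨hne.choose⟩
  rw [S.norm_rowMatrix_mulVec hd hne, studentizedMax]
  refine abs_iSup_sub_iSup_le fun i => (S.abs_sub_le_of_supportHat_eq hn hκ hlam hρ hε i).trans ?_
  have := le_ciSup (Finite.bddAbove_range fun i : Fin S.p₁ =>
    |∑ j ∈ S.supportᶜ, S.M i j * S.β j|) i
  gcongr

/-- The support is recovered if the estimation errors are small compared to the separation. -/
lemma supportHat_eq {c : ℝ} (hc0 : 0 < c) (hc : c < 1) (hb : 0 < S.b)
    (hout : ∀ i, i ∉ S.support → |S.β i| ≤ c * S.b)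
    (hin : ∀ i, i ∈ S.support → S.b / c ≤ |S.β i|) {y : Fin n → ℝ}
    (hy : ∀ k, |S.debiased y k - S.β k| ≤ (1 - c) * S.b / 2) : S.supportHat y = S.support := by
  ext k
  have hk := hy k
  have h1 := abs_sub_abs_le_abs_sub (S.debiased y k) (S.β k)
  have h2 := abs_sub_abs_le_abs_sub (S.β k) (S.debiased y k)
  rw [abs_sub_comm] at h2
  have h3 : 0 < (1 - c) * S.b := mul_pos (sub_pos.2 hc) hb
  simp only [supportHat, Finset.mem_filter, Finset.mem_univ, true_and]
  constructor
  · intro h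
    by_contra hcon
    have := hout k hcon
    linarith
  · intro h
    have h4 := hin k h
    -- `c (2 - c) ≤ 1` because `(1 - c)² ≥ 0`. So a gap of `(1 - c) b` lies on either side of the
    -- threshold, half of which is granted to the estimation error.
    have h5 : (2 - c) * S.b ≤ S.b / c := by
      rw [le_div_iff₀ hc0]
      nlinarith [sq_nonneg (1 - c)]
    linarith

end LinearModel

/-! ### Covariances and deviations of linear forms in the errors -/

lemma dotProduct_mulVec_eq_sum {ι : Type*} [Fintype ι] (V : Matrix ι ι ℝ) (t : ι → ℝ) :
    t ⬝ᵥ V *ᵥ t = ∑ i, ∑ j, t i * t j * V i j := by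
  simp only [dotProduct, mulVec, Finset.mul_sum]
  exact Finset.sum_congr rfl fun i _ => Finset.sum_congr rfl fun j _ => by ring

/-- A lower bound on the eigenvalues bounds the quadratic form from below. -/
lemma mul_sum_sq_le_of_hasEigenvalue {ι : Type*} [Fintype ι] [DecidableEq ι] {V : Matrix ι ι ℝ}
    (hV : V.IsHermitian) {c : ℝ}
    (hc : ∀ a : ℝ, Module.End.HasEigenvalue (Matrix.toLin' V) a → c < a) (w : ι → ℝ) :
    c * ∑ i, w i ^ 2 ≤ ∑ i, ∑ j, w i * w j * V i j := by
  have hH : (V - c • (1 : Matrix ι ι ℝ)).IsHermitian :=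
    hV.sub (by simp [IsHermitian])
  have hpos : (V - c • (1 : Matrix ι ι ℝ)).PosSemidef := by
    rw [hH.posSemidef_iff_eigenvalues_nonneg]
    intro i
    have h1 := hH.mulVec_eigenvectorBasis i
    have h2 : V *ᵥ ⇑(hH.eigenvectorBasis i) =
        (hH.eigenvalues i + c) • ⇑(hH.eigenvectorBasis i) := by
      rw [sub_mulVec, smul_mulVec, one_mulVec, sub_eq_iff_eq_add] at h1
      rw [h1, add_smul]
    have h3 : Module.End.HasEigenvalue (Matrix.toLin' V) (hH.eigenvalues i + c) := by
      refine Module.End.hasEigenvalue_of_hasEigenvector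
        (x := ⇑(hH.eigenvectorBasis i)) ⟨Module.End.mem_eigenspace_iff.2 h2, fun h0 => ?_⟩
      exact hH.eigenvectorBasis.orthonormal.ne_zero i (by ext j; exact congrFun h0 j)
    have := hc _ h3
    simp only [Pi.zero_apply]
    linarith
  have h := hpos.dotProduct_mulVec_nonneg w
  rw [star_trivial, sub_mulVec, dotProduct_sub, dotProduct_mulVec_eq_sum, smul_mulVec, one_mulVec,
    dotProduct_smul] at h
  have h4 : w ⬝ᵥ w = ∑ i, w i ^ 2 := by simp only [dotProduct, pow_two]
  rw [h4, smul_eq_mul] at h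
  linarith

namespace ErrorProcess

variable {n : ℕ} {Ω : Type*} [MeasurableSpace Ω] {μ : Measure Ω} [IsProbabilityMeasure μ]
  (E : ErrorProcess n μ) {m : ℝ} {k : ℕ}

lemma memLp_sum_mul_err {B : ℝ≥0}
    (hB : ∀ l, eLpNorm (fun ω => E.err ω l) (ENNReal.ofReal m) μ ≤ B) {p : ℝ≥0∞}
    (hp : p ≤ ENNReal.ofReal m) (w : Fin n → ℝ) : MemLp (fun ω => ∑ l, w l * E.err ω l) p μ :=
  memLp_finsetSum _ fun l _ => (E.memLp_err hB hp l).const_mul _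

lemma integral_sum_mul_err_pow_le (hkm : ((2 * k + 2 : ℕ) : ℝ) ≤ m)
    (hmean : ∀ l, ∫ ω, E.err ω l ∂μ = 0) {B D : ℝ≥0}
    (hB : ∀ l, eLpNorm (fun ω => E.err ω l) (ENNReal.ofReal m) μ ≤ B)
    (hD : B + ∑' j, E.maxDelta m j ≤ D) (w : Fin n → ℝ) :
    ∫ ω, (∑ l, w l * E.err ω l) ^ (2 * k + 2) ∂μ ≤
      (momentConst k * √(∑ l, w l ^ 2) * D) ^ (2 * k + 2) := by
  have hk := momentConst_pos k
  refine integral_pow_even_le_of_eLpNorm_le (by positivity)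
    (E.memLp_sum_mul_err hB (natCast_le_ofReal hkm) w)
    ((E.eLpNorm_sum_mul_err_le hkm hmean hB w).trans ?_)
  rw [ENNReal.ofReal_mul (q := (D : ℝ)) (by positivity), ENNReal.ofReal_coe_nnreal]
  gcongr

/-- A deviation bound for weighted sums of the errors. -/
lemma measureReal_le_abs_sum_mul_err_le (hkm : ((2 * k + 2 : ℕ) : ℝ) ≤ m)
    (hmean : ∀ l, ∫ ω, E.err ω l ∂μ = 0) {B D : ℝ≥0}
    (hB : ∀ l, eLpNorm (fun ω => E.err ω l) (ENNReal.ofReal m) μ ≤ B)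
    (hD : B + ∑' j, E.maxDelta m j ≤ D) (w : Fin n → ℝ) {s : ℝ} (hs : 0 < s) :
    μ.real {ω | s ≤ |∑ l, w l * E.err ω l|} ≤
      (momentConst k * √(∑ l, w l ^ 2) * D / s) ^ (2 * k + 2) := by
  have heven : Even (2 * k + 2) := ⟨k + 1, by ring⟩
  rw [div_pow, le_div_iff₀ (by positivity), mul_comm]
  refine le_trans ?_ (E.integral_sum_mul_err_pow_le hkm hmean hB hD w)
  have h := mul_meas_ge_le_integral_of_nonneg (μ := μ)
    (f := fun ω => (∑ l, w l * E.err ω l) ^ (2 * k + 2))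
    (Eventually.of_forall fun ω => heven.pow_nonneg _) ?_ (s ^ (2 * k + 2))
  · refine le_trans (mul_le_mul_of_nonneg_left (measureReal_mono fun ω hω => ?_) (by positivity)) h
    change s ^ (2 * k + 2) ≤ (∑ l, w l * E.err ω l) ^ (2 * k + 2)
    rw [← heven.pow_abs (∑ l, w l * E.err ω l)]
    exact pow_le_pow_left₀ hs.le hω _
  · refine ((E.memLp_sum_mul_err hB (natCast_le_ofReal hkm) w).integrable_norm_pow
      (by omega)).congr (Eventually.of_forall fun ω => ?_)
    simp only [Real.norm_eq_abs, heven.pow_abs]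

lemma integral_sum_mul_err_mul (hm : 2 ≤ m) {B : ℝ≥0}
    (hB : ∀ l, eLpNorm (fun ω => E.err ω l) (ENNReal.ofReal m) μ ≤ B) (v w : Fin n → ℝ) :
    ∫ ω, (∑ l, v l * E.err ω l) * (∑ l, w l * E.err ω l) ∂μ =
      ∑ i, ∑ j, v i * w j * E.cov i j := by
  have h2 : (2 : ℝ≥0∞) ≤ ENNReal.ofReal m := by
    simpa using ENNReal.ofReal_le_ofReal hm
  have hint : ∀ i j, Integrable (fun ω => E.err ω i * E.err ω j) μ := fun i j =>
    (E.memLp_err hB h2 i).integrable_mul (E.memLp_err hB h2 j)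
  have h : ∀ ω, (∑ l, v l * E.err ω l) * (∑ l, w l * E.err ω l) =
      ∑ i, ∑ j, v i * w j * (E.err ω i * E.err ω j) := fun ω => by
    rw [Finset.sum_mul_sum]
    exact Finset.sum_congr rfl fun i _ => Finset.sum_congr rfl fun j _ => by ring
  simp only [h]
  rw [integral_finsetSum _ fun i _ => integrable_finsetSum _ fun j _ => (hint i j).const_mul _]
  refine Finset.sum_congr rfl fun i _ => ?_
  rw [integral_finsetSum _ fun j _ => (hint i j).const_mul _]
  exact Finset.sum_congr rfl fun j _ => integral_const_mul _ _

omit [IsProbabilityMeasure μ] in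
lemma isHermitian_cov : E.cov.IsHermitian := by
  ext i j
  simp only [conjTranspose_apply, cov, of_apply, star_trivial, mul_comm]

lemma posSemidef_cov (hm : 2 ≤ m) {B : ℝ≥0}
    (hB : ∀ l, eLpNorm (fun ω => E.err ω l) (ENNReal.ofReal m) μ ≤ B) : E.cov.PosSemidef := by
  refine PosSemidef.of_dotProduct_mulVec_nonneg E.isHermitian_cov fun x => ?_
  rw [star_trivial, dotProduct_mulVec_eq_sum, ← E.integral_sum_mul_err_mul hm hB]
  exact integral_nonneg fun ω => mul_self_nonneg _

variable {d : ℕ} (A : Matrix (Fin d) (Fin n) ℝ)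

lemma conj_cov_apply (hm : 2 ≤ m) {B : ℝ≥0}
    (hB : ∀ l, eLpNorm (fun ω => E.err ω l) (ENNReal.ofReal m) μ ≤ B) (i j : Fin d) :
    (A * E.cov * Aᵀ) i j =
      ∫ ω, (∑ l, A i l * E.err ω l) * (∑ l, A j l * E.err ω l) ∂μ := by
  rw [E.integral_sum_mul_err_mul hm hB, Matrix.mul_apply]
  simp only [Matrix.mul_apply, transpose_apply, Finset.sum_mul]
  rw [Finset.sum_comm]
  exact Finset.sum_congr rfl fun i _ => Finset.sum_congr rfl fun j _ => by ring

omit [IsProbabilityMeasure μ] in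
lemma sum_mul_sum_mul_err (t : Fin d → ℝ) (ω : Ω) :
    ∑ i, t i * (A *ᵥ E.err ω) i = ∑ l, (t ᵥ* A) l * E.err ω l := by
  change t ⬝ᵥ (A *ᵥ E.err ω) = (t ᵥ* A) ⬝ᵥ E.err ω
  rw [dotProduct_mulVec]

lemma sum_sum_conj_cov (hm : 2 ≤ m) {B : ℝ≥0}
    (hB : ∀ l, eLpNorm (fun ω => E.err ω l) (ENNReal.ofReal m) μ ≤ B) (t : Fin d → ℝ) :
    ∑ i, ∑ j, t i * t j * (A * E.cov * Aᵀ) i j =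
      ∫ ω, (∑ l, (t ᵥ* A) l * E.err ω l) ^ 2 ∂μ := by
  simp only [pow_two]
  rw [E.integral_sum_mul_err_mul hm hB, ← dotProduct_mulVec_eq_sum, ← dotProduct_mulVec_eq_sum,
    dotProduct_mulVec, dotProduct_mulVec, ← vecMul_vecMul, ← vecMul_vecMul, ← dotProduct_mulVec _ Aᵀ,
    mulVec_transpose]

lemma abs_conj_cov_apply_le (hm : 2 ≤ m) (hmean : ∀ l, ∫ ω, E.err ω l ∂μ = 0) {B D : ℝ≥0}
    (hB : ∀ l, eLpNorm (fun ω => E.err ω l) (ENNReal.ofReal m) μ ≤ B)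
    (hD : B + ∑' j, E.maxDelta m j ≤ D) {a : ℝ} (ha : 0 ≤ a) (hA : ∀ i, √(∑ l, A i l ^ 2) ≤ a)
    (i j : Fin d) : |(A * E.cov * Aᵀ) i j| ≤ (momentConst 0 * a * D) ^ 2 := by
  have h2 : (2 : ℝ≥0∞) ≤ ENNReal.ofReal m := by
    simpa using ENNReal.ofReal_le_ofReal hm
  have hk := momentConst_pos 0
  have hsq : ∀ i, ∫ ω, (∑ l, A i l * E.err ω l) ^ 2 ∂μ ≤ (momentConst 0 * a * D) ^ 2 := by
    intro i
    refine (E.integral_sum_mul_err_pow_le (k := 0) (by simpa using hm) hmean hB hD (A i)).trans ?_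
    have := hA i
    simp only [mul_zero, zero_add]
    gcongr
  rw [E.conj_cov_apply A hm hB, pow_two (momentConst 0 * a * D)]
  refine (abs_integral_le_integral_abs).trans ?_
  simp only [abs_mul]
  exact integral_abs_mul_abs_le (E.memLp_sum_mul_err hB h2 _) (E.memLp_sum_mul_err hB h2 _)
    (by positivity) (by positivity) (hsq i) (hsq j)

end ErrorProcess

/-! ### Rates and constants uniform in the sample size -/

section PowerRates

lemma tendsto_zero_of_isBigO_rpow {f : ℕ → ℝ} {a : ℝ} (ha : a < 0)
    (hf : f =O[atTop] fun n : ℕ => (n : ℝ) ^ a) : Tendsto f atTop (𝓝 0) := by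
  have h : Tendsto (fun n : ℕ => (n : ℝ) ^ a) atTop (𝓝 0) := by
    have := (tendsto_rpow_neg_atTop (neg_pos.2 ha)).comp (tendsto_natCast_atTop_atTop (R := ℝ))
    simpa [Function.comp_def] using this
  exact hf.trans_tendsto h

lemma isBigO_mul_rpow {f g : ℕ → ℝ} {a b : ℝ} (hf : f =O[atTop] fun n : ℕ => (n : ℝ) ^ a)
    (hg : g =O[atTop] fun n : ℕ => (n : ℝ) ^ b) :
    (fun n => f n * g n) =O[atTop] fun n : ℕ => (n : ℝ) ^ (a + b) := by
  refine (hf.mul hg).congr' EventuallyEq.rfl ?_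
  filter_upwards [eventually_gt_atTop 0] with n hn
  rw [Real.rpow_add (Nat.cast_pos.2 hn)]

end PowerRates

section ErrorRates

variable {Ω : ℕ → Type*} [∀ n, MeasurableSpace (Ω n)] {μ : ∀ n, Measure (Ω n)}
  {E : ∀ n, ErrorProcess n (μ n)} {η m αε : ℝ}

lemma ErrorAssumption.exists_bounds (h : ErrorAssumption E η m αε) :
    ∃ (B D : ℝ≥0) (τ : ℕ → ℝ≥0), Tendsto τ atTop (𝓝 0) ∧ (∀ L, τ L ≤ D) ∧ ∀ n, 1 ≤ n →
      (∀ l, eLpNorm (fun ω => (E n).err ω l) (ENNReal.ofReal m) (μ n) ≤ B) ∧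
      B + ∑' j, (E n).maxDelta m j ≤ D ∧ ∀ L, ∑' j, (E n).maxDelta m (L + j) ≤ τ L := by
  obtain ⟨-, hα, -, ⟨C, hC⟩, ⟨B, hB⟩, -⟩ := h
  have hpos : ∀ L : ℕ, 0 < ((L : ℝ≥0) + 1) ^ αε := fun L => NNReal.rpow_pos (by positivity)
  have htail : ∀ n, 1 ≤ n → ∀ L : ℕ,
      ∑' j, (E n).maxDelta m (L + j) ≤ (C / ((L : ℝ≥0) + 1) ^ αε : ℝ≥0) := by
    intro n hn L
    have h1 : ((L : ℝ≥0∞) + 1) ^ αε * ∑' j, (E n).maxDelta m (L + j) ≤ C :=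
      (le_iSup (fun k : ℕ => ((k : ℝ≥0∞) + 1) ^ αε *
        ∑' j : ℕ, ⨆ i : Fin n, (E n).delta m i (k + j)) L).trans (hC n hn)
    have h2 : ((L : ℝ≥0∞) + 1) ^ αε = (((L : ℝ≥0) + 1) ^ αε : ℝ≥0) := by
      rw [ENNReal.coe_rpow_of_nonneg _ (by linarith)]
      simp
    rw [h2] at h1
    rw [ENNReal.coe_div (hpos L).ne', ENNReal.le_div_iff_mul_le
      (Or.inl (by exact_mod_cast (hpos L).ne')) (Or.inl ENNReal.coe_ne_top), mul_comm]
    exact h1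
  -- `τ L` bounds the dependence tail beyond `L` uniformly in `n`; `D` is the moment bound plus the
  -- tail bound at `L = 0`.
  refine ⟨B, B + C, fun L => C / ((L : ℝ≥0) + 1) ^ αε, ?_, fun L => ?_, fun n hn =>
    ⟨hB n hn, ?_, htail n hn⟩⟩
  · have h1 : Tendsto (fun L : ℕ => (C : ℝ) / ((L : ℝ) + 1) ^ αε) atTop (𝓝 0) :=
      tendsto_const_nhds.div_atTop ((tendsto_rpow_atTop (by linarith)).comp
        (tendsto_atTop_add_const_right _ _ tendsto_natCast_atTop_atTop))
    rw [← NNReal.tendsto_coe]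
    simpa using h1
  · refine le_trans (b := C) ?_ le_add_self
    refine div_le_self zero_le ?_
    exact NNReal.one_le_rpow le_add_self (by linarith)
  · have := htail n hn 0
    simp only [zero_add, CharP.cast_eq_zero, NNReal.one_rpow, div_one] at this
    rw [ENNReal.coe_add]
    gcongr

end ErrorRates

/-! ### Size of the normalized coefficients -/

section NormalizedRows

variable {n : ℕ} (S : LinearModel n) {d : ℕ}

namespace LinearModel

lemma sqrt_sum_sq_rowMatrix_le_one (i : Fin d) : √(∑ l, S.rowMatrix d i l ^ 2) ≤ 1 := by
  rw [Real.sqrt_le_one]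
  by_cases h : (i : ℕ) < S.p₁
  · simpa [rowMatrix, h] using S.sum_sq_normCoef_le_one ⟨i, h⟩
  · simp [rowMatrix, h]

lemma abs_rowMatrix_le (i : Fin d) (l : Fin n) : |S.rowMatrix d i l| ≤
    ⨆ i : {i // i ∈ S.activeRows}, ⨆ l : Fin n, |S.normCoef i l| := by
  have h0 : 0 ≤ ⨆ i : {i // i ∈ S.activeRows}, ⨆ l : Fin n, |S.normCoef i l| :=
    Real.iSup_nonneg fun i => Real.iSup_nonneg fun l => abs_nonneg _
  by_cases h : (i : ℕ) < S.p₁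
  · simp only [rowMatrix, of_apply, h, dite_true]
    by_cases ha : (⟨i, h⟩ : Fin S.p₁) ∈ S.activeRows
    · exact (le_ciSup (Finite.bddAbove_range fun l : Fin n => |S.normCoef ⟨i, h⟩ l|) l).trans
        (le_ciSup (Finite.bddAbove_range fun i : {i // i ∈ S.activeRows} =>
          ⨆ l : Fin n, |S.normCoef i l|) ⟨⟨i, h⟩, ha⟩)
    · rwa [S.normCoef_eq_zero ha, abs_zero]
  · simpa [rowMatrix, h] using h0

lemma sqrt_sum_sq_vecMul_rowMatrix_le (t : Fin d → ℝ) :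
    √(∑ l, (t ᵥ* S.rowMatrix d) l ^ 2) ≤ ∑ i, |t i| := by
  have h1 : √(∑ l, (t ᵥ* S.rowMatrix d) l ^ 2) =
      ‖(WithLp.toLp 2 (t ᵥ* S.rowMatrix d) : EuclideanSpace ℝ (Fin n))‖ := by
    rw [EuclideanSpace.norm_eq]; simp
  have h2 : (WithLp.toLp 2 (t ᵥ* S.rowMatrix d) : EuclideanSpace ℝ (Fin n)) =
      ∑ i, t i • (WithLp.toLp 2 (S.rowMatrix d i) : EuclideanSpace ℝ (Fin n)) := by
    ext l
    simp [vecMul, dotProduct]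
  rw [h1, h2]
  refine (norm_sum_le _ _).trans (Finset.sum_le_sum fun i _ => ?_)
  rw [norm_smul, EuclideanSpace.norm_eq, Real.norm_eq_abs]
  refine mul_le_of_le_one_right (abs_nonneg _) ?_
  simpa using S.sqrt_sum_sq_rowMatrix_le_one i

lemma abs_vecMul_rowMatrix_le (t : Fin d → ℝ) (l : Fin n) : |(t ᵥ* S.rowMatrix d) l| ≤
    (∑ i, |t i|) * ⨆ i : {i // i ∈ S.activeRows}, ⨆ l : Fin n, |S.normCoef i l| := by
  rw [vecMul, dotProduct, Finset.sum_mul]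
  refine (Finset.abs_sum_le_sum_abs _ _).trans (Finset.sum_le_sum fun i _ => ?_)
  rw [abs_mul]
  exact mul_le_mul_of_nonneg_left (S.abs_rowMatrix_le i l) (abs_nonneg _)

/-- The weights are at least `1 / (2 λ) ≥ 1 / (2 K √n)`, so the sum in `τ²` is at least of the order
of the added `1 / n`, and the normalized row keeps a norm bounded away from zero. -/
lemma le_sum_sq_normCoef_of_le (hn : 0 < n) {κ : ℝ} (hκ : 0 < κ) (hlam : ∀ j, κ ≤ S.lam j)
    (hρ : |S.ρ| ≤ κ ^ 2 / 4) {K : ℝ} (hK : ∀ j, S.lam j ≤ K * √n) (hK0 : 0 < K) {c : ℝ}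
    (hc : 0 ≤ c) {i : Fin S.p₁} (hi : c ≤ ∑ k ∈ S.support, S.M i k ^ 2) :
    c / (4 * K ^ 2) / (1 + c / (4 * K ^ 2)) ≤ ∑ l, S.normCoef i l ^ 2 := by
  have hn' : (0 : ℝ) < n := Nat.cast_pos.2 hn
  refine S.le_sum_sq_normCoef hn (by positivity) ?_
  have hw : ∀ j, 1 / (4 * K ^ 2 * n) ≤ S.weight j ^ 2 := fun j => by
    have h1 : 1 / (2 * (K * √n)) ≤ S.weight j := by
      refine le_trans ?_ (S.one_div_le_weight hκ hlam hρ j)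
      have := hκ.trans_le (hlam j)
      have := hK j
      gcongr
    calc 1 / (4 * K ^ 2 * n) = (1 / (2 * (K * √n))) ^ 2 := by
          rw [div_pow, mul_pow, mul_pow, Real.sq_sqrt hn'.le]; ring
      _ ≤ _ := by gcongr
  calc c / (4 * K ^ 2) = n * (c * (1 / (4 * K ^ 2 * n))) := by field_simp
    _ ≤ n * ((∑ j, S.coef S.support i j ^ 2) * (1 / (4 * K ^ 2 * n))) := by
        rw [S.sum_sq_coef]
        gcongr
    _ ≤ _ := by
        rw [Finset.sum_mul]
        refine mul_le_mul_of_nonneg_left (Finset.sum_le_sum fun j _ => ?_) hn'.le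
        exact mul_le_mul_of_nonneg_left (hw j) (sq_nonneg _)

end LinearModel

end NormalizedRows

/-! ### Recovery of the support -/

section Recovery

variable {Ω : ℕ → Type*} [∀ n, MeasurableSpace (Ω n)] {μ : ∀ n, Measure (Ω n)}
  [∀ n, IsProbabilityMeasure (μ n)] {S : ∀ n, LinearModel n} {E : ∀ n, ErrorProcess n (μ n)}
  {η m αε αβ : ℝ}

/-- The order of the squared ridge parameter times the norm of the parameter. -/
lemma isBigO_ridge_sq_mul_norm {δ : ℝ}
    (hρ : (fun n => (S n).ρ) =O[atTop] (fun n : ℕ => (n : ℝ) ^ (2 * η - δ)))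
    (hβ : (fun n => ‖WithLp.toLp 2 (S n).β‖) =O[atTop] (fun n : ℕ => (n : ℝ) ^ αβ)) :
    (fun n => (S n).ρ ^ 2 * ‖WithLp.toLp 2 (S n).β‖) =O[atTop]
      (fun n : ℕ => (n : ℝ) ^ (4 * η - 2 * δ + αβ)) := by
  have h := isBigO_mul_rpow (isBigO_mul_rpow hρ hρ) hβ
  refine (h.congr_left fun n => ?_).congr_right fun n => ?_
  · rw [pow_two]
  · congr 1; ring

lemma eventually_abs_ridge_le {δ c : ℝ} (hδ : 0 < δ) (hc : 0 < c)
    (hρ : (fun n => (S n).ρ) =O[atTop] (fun n : ℕ => (n : ℝ) ^ (2 * η - δ))) :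
    ∀ᶠ n : ℕ in atTop, |(S n).ρ| ≤ (c * (n : ℝ) ^ η) ^ 2 / 4 := by
  have h := tendsto_zero_of_isBigO_rpow (by linarith) (isBigO_mul_rpow hρ
    (isBigO_refl (fun n : ℕ => (n : ℝ) ^ (-(2 * η))) atTop)) (a := 2 * η - δ + -(2 * η))
  have h2 := h.abs.eventually_lt_const (u := c ^ 2 / 4) (by rw [abs_zero]; positivity)
  filter_upwards [h2, eventually_gt_atTop 0] with n hn hn0
  have hn' : (0 : ℝ) < n := Nat.cast_pos.2 hn0
  rw [abs_mul, abs_of_pos (Real.rpow_pos_of_pos hn' _), Real.rpow_neg hn'.le, ← div_eq_mul_inv,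
    div_lt_iff₀ (Real.rpow_pos_of_pos hn' _)] at hn
  rw [mul_pow, ← Real.rpow_mul_natCast hn'.le, mul_comm η]
  push_cast
  linarith

/-- The exponent `4η - 2δ + αβ - 3η` is negative exactly when `δ > (η + αβ) / 2`. -/
lemma tendsto_studentized_bias {δ c : ℝ} (hδ : (η + αβ) / 2 < δ)
    (hρ : (fun n => (S n).ρ) =O[atTop] (fun n : ℕ => (n : ℝ) ^ (2 * η - δ)))
    (hβ : (fun n => ‖WithLp.toLp 2 (S n).β‖) =O[atTop] (fun n : ℕ => (n : ℝ) ^ αβ)) :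
    Tendsto (fun n : ℕ => 4 * (S n).ρ ^ 2 / (c * (n : ℝ) ^ η) ^ 3 * ‖WithLp.toLp 2 (S n).β‖) atTop
      (𝓝 0) := by
  have h := tendsto_zero_of_isBigO_rpow (by linarith) (isBigO_mul_rpow
    (isBigO_ridge_sq_mul_norm hρ hβ) (isBigO_refl (fun n : ℕ => (n : ℝ) ^ (-(3 * η))) atTop))
    (a := 4 * η - 2 * δ + αβ + -(3 * η))
  have h2 := h.const_mul (4 / c ^ 3)
  rw [mul_zero] at h2
  refine h2.congr fun n => ?_
  rw [mul_pow, ← Real.rpow_mul_natCast n.cast_nonneg, Real.rpow_neg n.cast_nonneg, mul_comm η]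
  push_cast
  ring

/-- The exponent is `αβ - 2δ + ν`, which is less than `ν - η < 0`. -/
lemma tendsto_bias_div_threshold {δ c C ν : ℝ} (hδ : (η + αβ) / 2 < δ) (hν : ν < η)
    (hρ : (fun n => (S n).ρ) =O[atTop] (fun n : ℕ => (n : ℝ) ^ (2 * η - δ)))
    (hβ : (fun n => ‖WithLp.toLp 2 (S n).β‖) =O[atTop] (fun n : ℕ => (n : ℝ) ^ αβ)) :
    Tendsto (fun n : ℕ => 2 * (S n).ρ ^ 2 / (c * (n : ℝ) ^ η) ^ 4 * ‖WithLp.toLp 2 (S n).β‖ /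
      (C * (n : ℝ) ^ (-ν))) atTop (𝓝 0) := by
  have h := tendsto_zero_of_isBigO_rpow (by linarith) (isBigO_mul_rpow (isBigO_mul_rpow
    (isBigO_ridge_sq_mul_norm hρ hβ) (isBigO_refl (fun n : ℕ => (n : ℝ) ^ (-(4 * η))) atTop))
    (isBigO_refl (fun n : ℕ => (n : ℝ) ^ ν) atTop)) (a := 4 * η - 2 * δ + αβ + -(4 * η) + ν)
  have h2 := h.const_mul (2 / (c ^ 4 * C))
  rw [mul_zero] at h2
  refine h2.congr fun n => ?_
  rw [mul_pow, ← Real.rpow_mul_natCast n.cast_nonneg, Real.rpow_neg n.cast_nonneg,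
    Real.rpow_neg n.cast_nonneg, mul_comm η]
  push_cast
  field_simp

/-- There is an even moment within reach that beats the union bound over the coordinates. -/
lemma exists_even_exponent (hη : 0 < η) (hη' : η ≤ 1 / 2) (hm : 3 / η < m) {ν : ℝ}
    (hν : ν < η - 3 / m) : ∃ k : ℕ, ((2 * k + 2 : ℕ) : ℝ) ≤ m ∧
      1 - (η - ν) * ((2 * k + 2 : ℕ) : ℝ) < 0 := by
  have h6 : 6 < m := lt_of_le_of_lt (by rw [le_div_iff₀ hη]; linarith) hm
  have h1 : 3 < (η - ν) * m := by
    have : 3 / m < η - ν := by linarith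
    rwa [div_lt_iff₀ (by linarith)] at this
  have h2 : 0 < η - ν := by
    by_contra! h
    nlinarith
  have hfl := Nat.floor_le (show 0 ≤ m / 2 by linarith)
  have hfl' := Nat.lt_floor_add_one (m / 2)
  have h3 : 1 ≤ ⌊m / 2⌋₊ := Nat.le_floor (by push_cast; linarith)
  -- The order is `q = 2⌊m / 2⌋ > m - 2 > 2m / 3`, as `m > 6`; with `(η - ν) m > 3` this gives `(η -
  -- ν) q > 2`.
  refine ⟨⌊m / 2⌋₊ - 1, ?_, ?_⟩
  all_goals
    rw [show 2 * (⌊m / 2⌋₊ - 1) + 2 = 2 * ⌊m / 2⌋₊ by omega]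
    push_cast
  · linarith
  · nlinarith

/-- The support is recovered with probability tending to one. -/
lemma tendsto_measureReal_supportHat_ne (h1 : DesignAssumption S η)
    (h2 : ErrorAssumption E η m αε) (h3 : SparsityAssumption S η m αβ)
    (h4 : TuningAssumption S η m αβ) :
    Tendsto (fun n => (μ n).real
      {ω | (S n).supportHat ((S n).response ((E n).err ω)) ≠ (S n).support}) atTop (𝓝 0) := by
  obtain ⟨hη, hη', ⟨c, _, hc, -, hlam⟩, -, -⟩ := h1
  obtain ⟨B, D, _, -, -, hbd⟩ := h2.exists_bounds
  obtain ⟨hm, -, hmean, -⟩ := h2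
  obtain ⟨hαβ, -, hβ, -⟩ := h3
  obtain ⟨⟨δ, hδ, -, hρ⟩, ⟨C, ν, hC, hν0, hν, hb⟩, ⟨s, hs0, hs1, hs⟩⟩ := h4
  have hm0 : 0 < m := (div_pos three_pos hη).trans hm
  have hνη : ν < η := hν.trans (sub_lt_self _ (by positivity))
  obtain ⟨k, hkm, hk⟩ := exists_even_exponent hη hη' hm hν
  set q := 2 * k + 2 with hq
  -- The admissible error `(1 - s) b / 2` is shared equally between noise and bias, hence the
  -- quarter.
  set K := momentConst k * (1 / c) * D / ((1 - s) * C / 4) with hK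
  have hlim : Tendsto (fun n : ℕ => K ^ q * (n : ℝ) ^ (1 - (η - ν) * (q : ℝ))) atTop (𝓝 0) := by
    simpa using (tendsto_zero_of_isBigO_rpow hk (isBigO_refl _ _)).const_mul (K ^ q)
  have hbias := (tendsto_bias_div_threshold (c := c) (C := C) hδ hνη hρ hβ).eventually_lt_const
    (u := (1 - s) / 4) (by linarith)
  refine squeeze_zero' (Eventually.of_forall fun n => measureReal_nonneg) ?_ hlim
  filter_upwards [hbias, eventually_abs_ridge_le (by linarith) hc hρ, eventually_ge_atTop 1]
    with n hbn hρn hn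
  have hn' : (0 : ℝ) < n := Nat.cast_pos.2 hn
  have hb0 : 0 < (S n).b := by rw [hb n hn]; positivity
  have hκ : 0 < c * (n : ℝ) ^ η := by positivity
  obtain ⟨w, hw, hdev⟩ := (S n).exists_abs_debiased_sub_le hκ (fun j => (hlam n hn j).1) hρn
  rw [← hb n hn, div_lt_iff₀ hb0] at hbn
  have hsub : {ω | (S n).supportHat ((S n).response ((E n).err ω)) ≠ (S n).support} ⊆
      ⋃ i ∈ (Finset.univ : Finset (Fin (S n).p)),
        {ω | (1 - s) * (S n).b / 4 ≤ |∑ l, w i l * (E n).err ω l|} := by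
    intro ω hω
    by_contra hcon
    simp only [Set.mem_iUnion, Finset.mem_univ, exists_prop, true_and, not_exists,
      Set.mem_ofPred_eq, not_le] at hcon
    refine hω ((S n).supportHat_eq hs0 hs1 hb0 (hs n hn).1 (hs n hn).2 fun i => ?_)
    have h5 := hdev ((E n).err ω) i
    have h6 := hcon i
    linarith
  have hpt : ∀ i, (μ n).real {ω | (1 - s) * (S n).b / 4 ≤ |∑ l, w i l * (E n).err ω l|} ≤
      (K * (n : ℝ) ^ (-(η - ν))) ^ q := by
    intro i
    have hs' : 0 < 1 - s := sub_pos.2 hs1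
    have hmc := momentConst_pos k
    refine ((E n).measureReal_le_abs_sum_mul_err_le hkm (hmean n hn) (hbd n hn).1 (hbd n hn).2.1
      (w i) (s := (1 - s) * (S n).b / 4) (by positivity)).trans ?_
    have h7 : momentConst k * (1 / (c * (n : ℝ) ^ η)) * D / ((1 - s) * (S n).b / 4) =
        K * (n : ℝ) ^ (-(η - ν)) := by
      rw [hb n hn, hK, neg_sub, Real.rpow_sub hn', Real.rpow_neg hn'.le]
      field_simp
    rw [← h7]
    have := hw i
    gcongr
  calc _ ≤ _ := measureReal_mono hsub (measure_ne_top _ _)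
    _ ≤ ∑ i : Fin (S n).p,
        (μ n).real {ω | (1 - s) * (S n).b / 4 ≤ |∑ l, w i l * (E n).err ω l|} :=
      measureReal_biUnion_finset_le _ _
    _ ≤ ∑ i : Fin (S n).p, (K * (n : ℝ) ^ (-(η - ν))) ^ q := Finset.sum_le_sum fun i _ => hpt i
    _ = (S n).p * (K * (n : ℝ) ^ (-(η - ν))) ^ q := by simp
    _ ≤ n * (K * (n : ℝ) ^ (-(η - ν))) ^ q := by
      have := (S n).p_le
      have heven : Even q := ⟨k + 1, by omega⟩
      have := heven.pow_nonneg (K * (n : ℝ) ^ (-(η - ν)))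
      gcongr
    _ = _ := by
      rw [mul_pow, ← Real.rpow_mul_natCast hn'.le, sub_eq_add_neg 1, Real.rpow_add hn',
        Real.rpow_one, neg_mul]
      ring

end Recovery

/-! ### Characteristic functions of the normalized linear forms -/

section CharacteristicFunctions

variable {Ω : ℕ → Type*} [∀ n, MeasurableSpace (Ω n)] {μ : ∀ n, Measure (Ω n)}
  {S : ∀ n, LinearModel n} {E : ∀ n, ErrorProcess n (μ n)} {η m αε : ℝ}

lemma NonDominanceAssumption.tendsto_iSup_abs_normCoef (h : NonDominanceAssumption S αε) :
    Tendsto (fun n => ⨆ i : {i // i ∈ (S n).activeRows}, ⨆ l : Fin n, |(S n).normCoef i l|) atTop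
      (𝓝 0) := by
  refine h.2.isBigO.trans_tendsto ?_
  set z := max (9 / 2) (3 * αε / (2 * αε - 2)) with hz
  have hz0 : 0 < z := lt_of_lt_of_le (by norm_num) (le_max_left _ _)
  have h1 : Tendsto (fun n : ℕ => (n : ℝ) ^ (-(1 / 4) : ℝ)) atTop (𝓝 0) :=
    tendsto_zero_of_isBigO_rpow (by norm_num) (isBigO_refl _ _)
  have h2 : Tendsto (fun n : ℕ => Real.log n ^ (-z)) atTop (𝓝 0) :=
    (tendsto_rpow_neg_atTop hz0).comp (Real.tendsto_log_atTop.comp tendsto_natCast_atTop_atTop)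
  simpa using h1.mul h2

variable [∀ n, IsProbabilityMeasure (μ n)]

/-- The characteristic functions of the normalized linear combinations of the errors are
asymptotically those of the Gaussian vector with the same covariances. -/
lemma tendsto_integral_cis_sub (hη : 0 < η) (hη' : η ≤ 1 / 2) (h2 : ErrorAssumption E η m αε)
    (h6 : NonDominanceAssumption S αε) {d : ℕ} (t : Fin d → ℝ) :
    Tendsto (fun n => (∫ ω, cis (∑ i, t i * ((S n).rowMatrix d *ᵥ (E n).err ω) i) ∂(μ n)) -
      Complex.exp (-((∑ i, ∑ j, t i * t j *
        ((S n).rowMatrix d * (E n).cov * ((S n).rowMatrix d)ᵀ) i j) / 2 : ℝ))) atTop (𝓝 0) := by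
  obtain ⟨B, D, τ, hτ, hτD, hbd⟩ := h2.exists_bounds
  obtain ⟨hm, -, hmean, -⟩ := h2
  have hm6 : 6 < m := lt_of_le_of_lt (by rw [le_div_iff₀ hη]; linarith) hm
  have hmax := h6.tendsto_iSup_abs_normCoef
  set W := ∑ i, |t i| with hW
  have hW0 : 0 ≤ W := Finset.sum_nonneg fun i _ => abs_nonneg _
  rw [Metric.tendsto_nhds]
  intro δ hδ
  have hτ' : Tendsto (fun L => (momentConst 0 * W + 3 / 2 * (momentConst 0 * W) ^ 2 * D) *
      (τ L : ℝ)) atTop (𝓝 0) := by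
    simpa using (NNReal.tendsto_coe.2 hτ).const_mul
      (momentConst 0 * W + 3 / 2 * (momentConst 0 * W) ^ 2 * D)
  -- `L` is fixed first, making the coupling error small uniformly in `n`; then `L³` is a constant
  -- and the largest normalized coefficient tends to zero.
  obtain ⟨L, hL1, hL⟩ := ((eventually_ge_atTop 1).and
    (hτ'.eventually_lt_const (half_pos hδ))).exists
  have hmax' := ((hmax.const_mul W).mul_const (W ^ 2 * (B : ℝ) ^ 3)).const_mul
    (6 * (4 * (L : ℝ)) ^ 3)
  simp only [mul_zero, zero_mul] at hmax'
  filter_upwards [hmax'.eventually_lt_const (half_pos hδ), eventually_ge_atTop 1] with n hn hn1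
  rw [dist_zero_right]
  simp only [(E n).sum_mul_sum_mul_err]
  rw [(E n).sum_sum_conj_cov _ (by linarith) (hbd n hn1).1]
  refine ((E n).norm_integral_cis_sum_mul_err_sub_le (by linarith) (hmean n hn1) (hbd n hn1).1
    (hbd n hn1).2.1 hL1 ((hbd n hn1).2.2 L) _ hW0 ((S n).sqrt_sum_sq_vecMul_rowMatrix_le t)
    (mul_nonneg hW0 (Real.iSup_nonneg fun i => Real.iSup_nonneg fun l => abs_nonneg _))
    (fun l => (S n).abs_vecMul_rowMatrix_le t l) (hτD L)).trans_lt ?_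
  rw [mul_assoc _ (W ^ 2) ((B : ℝ) ^ 3)]
  linarith

end CharacteristicFunctions

end ThresholdRidge

/-! ### Proof of the main theorem -/

theorem theorem2 {Ω : ℕ → Type*} [∀ n, MeasurableSpace (Ω n)]
    (μ : ∀ n, Measure (Ω n)) [∀ n, IsProbabilityMeasure (μ n)]
    (S : ∀ n, ThresholdRidge.LinearModel n) (E : ∀ n, ThresholdRidge.ErrorProcess n (μ n))
    (η m αε αβ : ℝ)
    (h1 : ThresholdRidge.DesignAssumption S η)
    (h2 : ThresholdRidge.ErrorAssumption E η m αε)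
    (h3 : ThresholdRidge.SparsityAssumption S η m αβ)
    (h4 : ThresholdRidge.TuningAssumption S η m αβ)
    (h5 : ThresholdRidge.CombinationAssumption S η m)
    (h6 : ThresholdRidge.NonDominanceAssumption S αε) :
    Tendsto
      (fun n => ⨆ x : ℝ,
        |(μ n).real {ω | (S n).studentizedMax ((S n).response ((E n).err ω)) ≤ x}
          - (S n).H (E n).cov x|)
      atTop (𝓝 0) := by
  obtain ⟨hη, hη', ⟨cl, Cl, hcl, hCl, hlam⟩, -, ⟨d, hd⟩⟩ := id h1
  obtain ⟨B, D, _, -, -, hbd⟩ := h2.exists_bounds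
  obtain ⟨hm, -, hmean, -, -, ⟨cS, hcS, heig⟩⟩ := id h2
  obtain ⟨-, -, hβ, -⟩ := id h3
  obtain ⟨⟨δ, hδ, -, hρ⟩, -, -⟩ := id h4
  obtain ⟨hact, ⟨cM, _, hcM, -, hM⟩, hrest, -⟩ := h5
  have hm6 : 6 < m := lt_of_le_of_lt (by rw [le_div_iff₀ hη]; linarith) hm
  have hρ' := ThresholdRidge.eventually_abs_ridge_le (by linarith [h3.1]) hcl hρ
  have hbias := ThresholdRidge.tendsto_studentized_bias (c := cl) hδ hρ hβ
  have hrest' := hrest.tendsto_div_nhds_zero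
  have hκ : ∀ n : ℕ, 1 ≤ n → 0 < cl * (n : ℝ) ^ η := fun n hn =>
    mul_pos hcl (Real.rpow_pos_of_pos (Nat.cast_pos.2 hn) _)
  set A : ∀ n, Matrix (Fin d) (Fin n) ℝ := fun n => (S n).rowMatrix d with hA
  have hPSD : ∀ n, 1 ≤ n → (E n).cov.PosSemidef := fun n hn =>
    (E n).posSemidef_cov (by linarith) (hbd n hn).1
  have hV : ∀ n, 1 ≤ n → (A n * (E n).cov * (A n)ᵀ).PosSemidef := fun n hn => by
    simpa using (hPSD n hn).mul_mul_conjTranspose_same (A n)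
  set a := cM / (4 * Cl ^ 2) with ha
  have ha0 : 0 < a := by positivity
  -- One active row suffices, the other diagonal entries being nonnegative: its variance is at least
  -- `cS` times its squared norm, which is at least `a / (1 + a)`.
  have htrace : ∀ᶠ n in atTop, cS * (a / (1 + a)) ≤ ∑ i, (A n * (E n).cov * (A n)ᵀ) i i := by
    filter_upwards [hρ', eventually_ge_atTop 1] with n hρn hn
    obtain ⟨i, hi⟩ := hact n hn
    set i' : Fin d := ⟨i, i.2.trans_le (hd n hn)⟩ with hi'
    refine le_trans ?_ (Finset.single_le_sum (fun j _ => (hV n hn).diag_nonneg)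
      (Finset.mem_univ i'))
    have hrow : ∀ l, A n i' l = (S n).normCoef i l := fun l => by
      simp [hA, hi', ThresholdRidge.LinearModel.rowMatrix]
    rw [(E n).conj_cov_apply _ (by linarith) (hbd n hn).1,
      (E n).integral_sum_mul_err_mul (by linarith) (hbd n hn).1]
    refine le_trans ?_ (ThresholdRidge.mul_sum_sq_le_of_hasEigenvalue (E n).isHermitian_cov
      (heig n hn) (A n i'))
    simp only [hrow]
    refine mul_le_mul_of_nonneg_left ((S n).le_sum_sq_normCoef_of_le hn (hκ n hn)
      (fun j => (hlam n hn j).1) hρn (fun j => ?_) hCl hcM.le (hM n hn i hi).1) hcS.le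
    rw [Real.sqrt_eq_rpow]
    exact (hlam n hn j).2
  have hmain := ThresholdRidge.tendsto_iSup_abs_measureReal_sub (μ := μ)
    (W := fun n ω => A n *ᵥ (E n).err ω) (V := fun n => A n * (E n).cov * (A n)ᵀ)
    (T := fun n ω => (S n).studentizedMax ((S n).response ((E n).err ω)))
    -- `r` bounds the gap on the recovery event: the bias relative to `τ` plus `√n` times the small
    -- coordinates, written as a quotient by `1 / √n` to match the `o(n^(-1/2))` assumption.
    (r := fun n => 4 * (S n).ρ ^ 2 / (cl * (n : ℝ) ^ η) ^ 3 * ‖WithLp.toLp 2 (S n).β‖ +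
      (⨆ i : Fin (S n).p₁, |∑ j ∈ (S n).supportᶜ, (S n).M i j * (S n).β j|) / (1 / √n))
    (C := (ThresholdRidge.momentConst 0 * 1 * D) ^ 2) (σ := cS * (a / (1 + a)))
    (fun n => measurable_pi_lambda _ fun i => by
      simp only [Matrix.mulVec, dotProduct]
      exact Finset.measurable_sum _ fun l _ => ((E n).measurable_err l).const_mul _)
    ((eventually_ge_atTop 1).mono hV)
    ((eventually_ge_atTop 1).mono fun n hn i j => (E n).abs_conj_cov_apply_le (A n) (by linarith)
      (hmean n hn) (hbd n hn).1 (hbd n hn).2.1 zero_le_one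
      (fun i => (S n).sqrt_sum_sq_rowMatrix_le_one i) i j)
    (by positivity) htrace
    (fun t => ThresholdRidge.tendsto_integral_cis_sub hη hη' h2 h6 t)
    (by simpa using hbias.add hrest') ?_
  · refine hmain.congr' ?_
    filter_upwards [eventually_ge_atTop 1] with n hn
    simp only [(S n).H_eq (hd n hn) (hact n hn) (hPSD n hn), hA]
  · refine squeeze_zero' (Eventually.of_forall fun n => measureReal_nonneg) ?_
      (ThresholdRidge.tendsto_measureReal_supportHat_ne h1 h2 h3 h4)
    filter_upwards [hρ', eventually_ge_atTop 1] with n hρn hn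
    -- A gap larger than `r` is possible only where the support is not recovered.
    refine measureReal_mono fun ω hω hsupp =>
      absurd (Set.mem_ofPred_eq ▸ hω : _ < _) (not_lt.2 ?_)
    rw [div_div_eq_mul_div, div_one, mul_comm (⨆ i : Fin (S n).p₁, _) √n]
    exact (S n).abs_studentizedMax_sub_le hn (hd n hn) (hact n hn) (hκ n hn)
      (fun j => (hlam n hn j).1) hρn hsupp
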